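/- **Model.** Let $r>0$, $c_T>0$, $0<x^*<B$, $\lambda>0$, $\alpha>0$, with $r\neq c_T$ and $c_TB\neq rx^*$. Let $(W_i)$ be i.i.d. exponential random variables of rate $\lambda$ (the waiting times of a Poisson process of intensity $\lambda$) and $(Z_i)$ i.i.d. with law $\mathrm{Beta}(\alpha,1)$, independent of $(W_i)$. The capital process $X_t$ with $X_0=x\ge x^*$ solves $$\frac{dX_t}{dt}=r\,[X_t-x^*]^+ + c_T\,[B-X_t]^+$$ between the event times $W_1+\dots+W_i$, and at the $i$-th event time it is multiplied by $Z_i$. Let $\tau_x=\inf\{t\ge 0: X_t<x^*\}$ (with $\inf\emptyset=\infty$) be the trapping time, $\psi(x)=\mathbb P(\tau_x<\infty)$ the trapping probability, and for $\delta\ge 0$ let $m_\delta(x)=\mathbb E[e^{-\delta\tau_x}\mathbf 1_{\{\tau_x<\infty\}}]$ be the Laplace transform of the trapping time. **Parameters.** Put $x^{**}=\frac{c_TB-rx^*}{r-c_T}$, $y_u(x)=\frac{x}{x^*}$, $y_l(x)=-\frac{x}{x^{**}}$, $c_u=c_l=\alpha$, and, with $s_u=r$, $s_l=r-c_T$, for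 $i\in\{u,l\}$, $$a_i,\,b_i=\frac{-(\delta+\lambda-\alpha s_i)\mp\sqrt{(\delta+\lambda-\alpha s_i)^2+4s_i\alpha\delta}}{2s_i}$$ ($-$ for $a_i$, $+$ for $b_i$). Here ${}_2F_1(a,b;c;z)=\sum_{n\ge0}\frac{(a)_n(b)_n}{(c)_n}\frac{z^n}{n!}$ for $|z|<1$; at other real arguments $z\ne1$ it denotes the analytic continuation (the principal branch if $z<1$, and its limit from the lower half-plane if $z>1$). Let ${}_2\tilde F_1={}_2F_1/\Gamma(c)$. Powers of negative numbers are principal complex powers. **Constants.** For $k\in\{0,1\}$ write $$A_k(x)={}_2\tilde F_1(a_l+k,a_l-c_l+1;a_l-b_l+1;y_l(x)^{-1}),\qquad B_k(x)={}_2\tilde F_1(b_l+k,b_l-c_l+1;b_l-a_l+1;y_l(x)^{-1}),$$ $$U_k={}_2\tilde F_1(b_u+k,b_u-c_u+1;b_u-a_u+1;y_u(B)^{-1}),$$ $$P_A=(\delta+\lambda)x^*A_0(x^*)+c_Ta_l(B-x^*)A_1(x^*),\qquad P_B=(\delta+\lambda)x^*B_0(x^*)+c_Tb_l(B-x^*)B_1(x^*),$$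 $$Q_A=b_uU_1A_0(B)-a_lU_0A_1(B),\qquad Q_B=b_uU_1B_0(B)-b_lU_0B_1(B),$$ $$D=y_l(B)^{-b_l}P_AQ_B-y_l(B)^{-a_l}\,y_l(x^*)^{a_l-b_l}\,Q_AP_B,$$ $$A_{2,u}=\frac{\lambda x^*\,y_u(B)^{b_u}\,y_l(B)^{-(a_l+b_l)}\,y_l(x^*)^{a_l}\,\bigl(a_lA_1(B)B_0(B)-b_lA_0(B)B_1(B)\bigr)}{\Gamma(1-a_u+b_u)\,D},$$ $$A_{1,l}=\frac{\lambda x^*\,y_l(x^*)^{a_l}\,y_l(B)^{-b_l}\,Q_B}{\Gamma(1+a_l-b_l)\,D},\qquad A_{2,l}=-\frac{\lambda x^*\,y_l(B)^{-a_l}\,y_l(x^*)^{a_l}\,\Gamma(1+a_l-b_l)\,Q_A\,\sin((a_l-b_l)\pi)}{(a_l-b_l)\,\pi\,D}.$$ **Proposition.** (i) For every $\delta\ge0$ with $a_l-b_l\notin\mathbb Z$, $$m_\delta(x)=\begin{cases}A_{2,u}\,y_u(x)^{-b_u}\,{}_2F_1\bigl(b_u,b_u-c_u+1;b_u-a_u+1;y_u(x)^{-1}\bigr),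 & x\ge B,\\[4pt] A_{1,l}\,y_l(x)^{-a_l}\,{}_2F_1\bigl(a_l,a_l-c_l+1;a_l-b_l+1;y_l(x)^{-1}\bigr)\\ \quad{}+A_{2,l}\,y_l(x)^{-b_l}\,{}_2F_1\bigl(b_l,b_l-c_l+1;b_l-a_l+1;y_l(x)^{-1}\bigr), & x^*\le x<B.\end{cases}$$ (ii) For every $x\ge x^*$, $m_0(x)=\psi(x)=\lim_{\delta\downarrow0}m_\delta(x)$. -/

import Mathlib

open MeasureTheory ProbabilityTheory Filter Topology
open scoped ENNReal

noncomputable section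

namespace Trapping

/-! ### The capital process -/

/-- Numerical data of the household model: growth rate `r`, capital transfer rate `cT`, critical
capital `xs` `x^*`, capital barrier level `B`, intensity `lam` of the Poisson
process of losses, and the parameter `alpha` of the law Beta(alpha, 1) of the remaining
proportions. -/
structure Model where
  r : ℝ
  cT : ℝ
  xs : ℝ
  B : ℝ
  lam : ℝ
  alpha : ℝ

namespace Model

variable (M : Model)

/-- Right-hand side of the dynamics between losses,
`dX/dt = r [X - x^*]^+ + cT [B - X]^+`. -/
def drift (x : ℝ) : ℝ := M.r * max (x - M.xs) 0 + M.cT * max (M.B - x) 0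

/-- `f` solves `f' = drift f` on `[0, ∞)` with `f 0 = x` (one-sided derivative at `0`). -/
def IsTrajectory (x : ℝ) (f : ℝ → ℝ) : Prop :=
  f 0 = x ∧ ∀ t : ℝ, 0 ≤ t → HasDerivWithinAt f (M.drift (f t)) (Set.Ici 0) t

open Classical in
/-- The capital after time `t ≥ 0`, started from `x`, if no loss occurs. The drift is globally
Lipschitz, so the trajectory from `x` exists and is unique on `[0, ∞)`. -/
def flow (x t : ℝ) : ℝ := if h : ∃ f, M.IsTrajectory x f then h.choose t else 0

/-- The capital right after the `n`-th loss (`x` for `n = 0`), where `w n` is the waiting time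
between the `n`-th and the `(n+1)`-st loss and `z n` the proportion left by the `(n+1)`-st. -/
def postLoss (w z : ℕ → ℝ) (x : ℝ) : ℕ → ℝ
  | 0 => x
  | n + 1 => z n * M.flow (postLoss w z x n) (w n)

end Model

/-- The time of the `n`-th loss (`0` for `n = 0`). -/
def lossTime (w : ℕ → ℝ) (n : ℕ) : ℝ := ∑ i ∈ Finset.range n, w i

/-- The number of losses up to and including time `t`; with i.i.d. exponential waiting times of
rate `lam` this counting process is the Poisson process of intensity `lam`. -/
def lossCount (w : ℕ → ℝ) (t : ℝ) : ℕ := sSup {n : ℕ | lossTime w n ≤ t}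

namespace Model

variable (M : Model)

/-- The capital `X_t` with `X_0 = x`, along the waiting times `w` and remaining proportions `z`. -/
def capital (w z : ℕ → ℝ) (x t : ℝ) : ℝ :=
  M.flow (M.postLoss w z x (lossCount w t)) (t - lossTime w (lossCount w t))

/-- The trapping time `inf {t ≥ 0 : X_t < x^*}`, equal to `∞` if there is no such `t`. -/
def trappingTime (w z : ℕ → ℝ) (x : ℝ) : ℝ≥0∞ :=
  ⨅ (t : ℝ) (_ : 0 ≤ t) (_ : M.capital w z x t < M.xs), ENNReal.ofReal t

open Classical in
/-- The Laplace transform `E[exp(-δ τ_x) 1_{τ_x < ∞}]` of the trapping time. -/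
def laplace {Ω : Type*} [MeasurableSpace Ω] (P : Measure Ω) (W Z : ℕ → Ω → ℝ) (δ x : ℝ) : ℝ :=
  ∫ ω, (if M.trappingTime (fun i => W i ω) (fun i => Z i ω) x < ∞ then
      Real.exp (-δ * (M.trappingTime (fun i => W i ω) (fun i => Z i ω) x).toReal) else 0) ∂P

/-- The trapping probability `P(τ_x < ∞)`. -/
def trappingProb {Ω : Type*} [MeasurableSpace Ω] (P : Measure Ω) (W Z : ℕ → Ω → ℝ) (x : ℝ) : ℝ :=
  P.real {ω | M.trappingTime (fun i => W i ω) (fun i => Z i ω) x < ∞}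

end Model

/-! ### Gauss's hypergeometric function on the real line -/

/-- The complex plane cut along the vertical half-line from `1` upwards; it contains the open unit
disc and every real number other than `1`. -/
def cutPlane : Set ℂ := {z | ¬ (z.re = 1 ∧ 0 ≤ z.im)}

open Classical in
/-- Gauss's hypergeometric function with parameters `a, b, c` (`c ≠ 0, -1, -2, …`) at a real
`x ≠ 1`: the value at `x` of the analytic continuation of the Gauss series from the unit disc to
`cutPlane`. For `|x| < 1` it is the sum of the series, for `x < 1` the value of the principal
branch, and for `x > 1`, on the cut of the principal branch, the limit of the principal branch
from the lower half-plane. -/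
def gaussF (a b c x : ℝ) : ℂ :=
  if h : ∃ f : ℂ → ℂ, DifferentiableOn ℂ f cutPlane ∧
      ∀ z : ℂ, ‖z‖ < 1 → f z = ordinaryHypergeometric (a : ℂ) (b : ℂ) (c : ℂ) z
  then h.choose (x : ℂ) else 0

/-- The regularised hypergeometric function `₂F₁(a, b; c; x) / Γ(c)`. -/
def regF (a b c x : ℝ) : ℂ := gaussF a b c x / Complex.Gamma (c : ℂ)

/-! ### Parameters and constants of the closed form -/

/-- Smaller-sign root: `(-(δ+λ-αs) - √((δ+λ-αs)² + 4 s α δ)) / (2 s)`. -/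
def rootMinus (lam alpha s δ : ℝ) : ℝ :=
  (-(δ + lam - alpha * s) - √((δ + lam - alpha * s) ^ 2 + 4 * s * alpha * δ)) / (2 * s)

/-- Larger-sign root: `(-(δ+λ-αs) + √((δ+λ-αs)² + 4 s α δ)) / (2 s)`. -/
def rootPlus (lam alpha s δ : ℝ) : ℝ :=
  (-(δ + lam - alpha * s) + √((δ + lam - alpha * s) ^ 2 + 4 * s * alpha * δ)) / (2 * s)

namespace Model

variable (M : Model) (δ : ℝ)

/-- `x^{**} = (cT B - r x^*) / (r - cT)`. -/
def xss : ℝ := (M.cT * M.B - M.r * M.xs) / (M.r - M.cT)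

def au : ℝ := rootMinus M.lam M.alpha M.r δ
def bu : ℝ := rootPlus M.lam M.alpha M.r δ
def al : ℝ := rootMinus M.lam M.alpha (M.r - M.cT) δ
def bl : ℝ := rootPlus M.lam M.alpha (M.r - M.cT) δ
def cu : ℝ := M.alpha
def cl : ℝ := M.alpha

def yu (x : ℝ) : ℝ := x / M.xs
def yl (x : ℝ) : ℝ := -x / M.xss

/-- Regularised `₂F₁(b_u, b_u-c_u+1; b_u-a_u+1; 1/y_u(x))`. -/
def RU (x : ℝ) : ℂ :=
  regF (M.bu δ) (M.bu δ - M.cu + 1) (M.bu δ - M.au δ + 1) (M.yu x)⁻¹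

/-- Regularised `₂F₁(b_u+1, b_u-c_u+1; b_u-a_u+1; 1/y_u(x))`. -/
def RU' (x : ℝ) : ℂ :=
  regF (M.bu δ + 1) (M.bu δ - M.cu + 1) (M.bu δ - M.au δ + 1) (M.yu x)⁻¹

/-- Regularised `₂F₁(a_l, a_l-c_l+1; a_l-b_l+1; 1/y_l(x))`. -/
def RA (x : ℝ) : ℂ :=
  regF (M.al δ) (M.al δ - M.cl + 1) (M.al δ - M.bl δ + 1) (M.yl x)⁻¹

/-- Regularised `₂F₁(a_l+1, a_l-c_l+1; a_l-b_l+1; 1/y_l(x))`. -/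
def RA' (x : ℝ) : ℂ :=
  regF (M.al δ + 1) (M.al δ - M.cl + 1) (M.al δ - M.bl δ + 1) (M.yl x)⁻¹

/-- Regularised `₂F₁(b_l, b_l-c_l+1; b_l-a_l+1; 1/y_l(x))`. -/
def RB (x : ℝ) : ℂ :=
  regF (M.bl δ) (M.bl δ - M.cl + 1) (M.bl δ - M.al δ + 1) (M.yl x)⁻¹

/-- Regularised `₂F₁(b_l+1, b_l-c_l+1; b_l-a_l+1; 1/y_l(x))`. -/
def RB' (x : ℝ) : ℂ :=
  regF (M.bl δ + 1) (M.bl δ - M.cl + 1) (M.bl δ - M.al δ + 1) (M.yl x)⁻¹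

/-- Coefficient of the `a_l`-solution in the boundary condition at `x^*`. -/
def PA : ℂ :=
  (δ + M.lam) * M.xs * M.RA δ M.xs + M.cT * M.al δ * (M.B - M.xs) * M.RA' δ M.xs

/-- Coefficient of the `b_l`-solution in the boundary condition at `x^*`. -/
def PB : ℂ :=
  (δ + M.lam) * M.xs * M.RB δ M.xs + M.cT * M.bl δ * (M.B - M.xs) * M.RB' δ M.xs

/-- Coefficient of the `a_l`-solution in the matching condition at `B`. -/
def QA : ℂ :=
  M.bu δ * M.RU' δ M.B * M.RA δ M.B - M.al δ * M.RU δ M.B * M.RA' δ M.B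

/-- Coefficient of the `b_l`-solution in the matching condition at `B`. -/
def QB : ℂ :=
  M.bu δ * M.RU' δ M.B * M.RB δ M.B - M.bl δ * M.RU δ M.B * M.RB' δ M.B

/-- The common denominator of the constants. All powers are principal complex powers. -/
def den : ℂ :=
  (M.yl M.B : ℂ) ^ (-M.bl δ : ℂ) * M.PA δ * M.QB δ
    - (M.yl M.B : ℂ) ^ (-M.al δ : ℂ) * (M.yl M.xs : ℂ) ^ (M.al δ - M.bl δ : ℂ)
      * M.QA δ * M.PB δ

/-- The constant `A_{2,u}`. -/
def A2u : ℂ :=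
  (M.lam * (M.yu M.B : ℂ) ^ (M.bu δ : ℂ) * M.xs
      * (M.yl M.B : ℂ) ^ (-(M.al δ + M.bl δ) : ℂ) * (M.yl M.xs : ℂ) ^ (M.al δ : ℂ)
      * (M.al δ * M.RA' δ M.B * M.RB δ M.B - M.bl δ * M.RA δ M.B * M.RB' δ M.B))
    / (Complex.Gamma (1 - M.au δ + M.bu δ) * M.den δ)

/-- The constant `A_{1,l}`, with denominators cleared. -/
def A1l : ℂ :=
  (M.lam * M.xs * (M.yl M.xs : ℂ) ^ (M.al δ : ℂ) * (M.yl M.B : ℂ) ^ (-M.bl δ : ℂ) * M.QB δ)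
    / (Complex.Gamma (1 + M.al δ - M.bl δ) * M.den δ)

/-- The constant `A_{2,l}`. -/
def A2l : ℂ :=
  (M.lam * M.xs * (M.yl M.B : ℂ) ^ (-M.al δ : ℂ) * (M.yl M.xs : ℂ) ^ (M.al δ : ℂ)
      * Complex.Gamma (1 + M.al δ - M.bl δ) * M.QA δ
      * Complex.sin ((M.al δ - M.bl δ) * Real.pi))
    / ((M.al δ - M.bl δ) * Real.pi * (-M.den δ))

/-- Where the quotients below make sense, `A1l` is the nested fraction
`λ x^* y_l(x^*)^{a_l} (1 + 1/(-1 + R)) / (Γ(1+a_l-b_l) P_A)`, with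
`R = y_l(B)^{a_l-b_l} y_l(x^*)^{b_l-a_l} P_A Q_B / (Q_A P_B)`. -/
theorem A1l_eq (hB : M.yl M.B ≠ 0) (hxs : M.yl M.xs ≠ 0) (hPA : M.PA δ ≠ 0) (hPB : M.PB δ ≠ 0)
    (hQA : M.QA δ ≠ 0) (hden : M.den δ ≠ 0) :
    M.A1l δ =
      (M.lam * M.xs * (M.yl M.xs : ℂ) ^ (M.al δ : ℂ)
        * (1 + 1 / (-1 + (M.yl M.B : ℂ) ^ (M.al δ - M.bl δ : ℂ)
            * (M.yl M.xs : ℂ) ^ (M.bl δ - M.al δ : ℂ) * M.PA δ * M.QB δ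
            / (M.QA δ * M.PB δ))))
      / (Complex.Gamma (1 + M.al δ - M.bl δ) * M.PA δ) := by
  have hB' : (M.yl M.B : ℂ) ≠ 0 := by exact_mod_cast hB
  have hxs' : (M.yl M.xs : ℂ) ≠ 0 := by exact_mod_cast hxs
  have e1 : (M.yl M.B : ℂ) ^ (M.al δ - M.bl δ : ℂ)
      = (M.yl M.B : ℂ) ^ (-M.bl δ : ℂ) / (M.yl M.B : ℂ) ^ (-M.al δ : ℂ) := by
    rw [← Complex.cpow_sub _ _ hB']; congr 1; ring
  have e2 : (M.yl M.xs : ℂ) ^ (M.bl δ - M.al δ : ℂ)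
      = ((M.yl M.xs : ℂ) ^ (M.al δ - M.bl δ : ℂ))⁻¹ := by
    rw [← Complex.cpow_neg]; congr 1; ring
  have hu : (M.yl M.B : ℂ) ^ (-M.al δ : ℂ) ≠ 0 := by simp [Complex.cpow_eq_zero_iff, hB']
  have hv : (M.yl M.xs : ℂ) ^ (M.al δ - M.bl δ : ℂ) ≠ 0 := by
    simp [Complex.cpow_eq_zero_iff, hxs']
  unfold A1l
  rw [e1, e2]
  unfold den at hden ⊢
  generalize (M.yl M.B : ℂ) ^ (-M.al δ : ℂ) = u at *
  generalize (M.yl M.xs : ℂ) ^ (M.al δ - M.bl δ : ℂ) = v at *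
  generalize (M.yl M.B : ℂ) ^ (-M.bl δ : ℂ) = s at *
  generalize M.PA δ = pa at *
  generalize M.PB δ = pb at *
  generalize M.QA δ = qa at *
  generalize M.QB δ = qb at *
  have key : (1 : ℂ) + 1 / (-1 + s / u * v⁻¹ * pa * qb / (qa * pb))
      = s * pa * qb / (s * pa * qb - u * v * qa * pb) := by
    have h1 : -1 + s / u * v⁻¹ * pa * qb / (qa * pb)
        = (s * pa * qb - u * v * qa * pb) / (u * v * qa * pb) := by
      field_simp
      ring
    rw [h1]
    field_simp
    ring
  rw [key]
  by_cases hG : Complex.Gamma (1 + M.al δ - M.bl δ) = 0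
  · simp [hG]
  · field_simp

end Model

end Trapping

end

namespace Trapping

/-! Probabilistic side. The drift is nonnegative on the capital range, so trapping can occur only at
a loss, and by the strong law the losses do not accumulate. Splitting according to the loss that
traps gives the Neumann series `trapSeries` = ∑ Tⁿ g, where T = `stepOp` is the discounted one-loss
operator killed below x* and g = `stepTrap` is the discounted probability that the next loss traps
(`tsum_trapTerm`, `Driving.laplace_eq`). This series is the least nonnegative solution of u = g + Tu
(`trapSeries_le`).

Analytic side. For bounded h extended by 1 below x*, the identity h = g + Th follows by integrating
drift·h' - (λ+δ)h + λ E h(Zx) = 0 along the flow. Since Z is Beta(α,1), x^α E h(Zx) = ∫₀ˣ α v^(α-1)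
h(v) dv, and one differentiation leaves a second-order ODE. On each side of B the drift is affine,
s(x-ζ), and in y = x/ζ the ODE is Gauss's equation with exponents a, b at infinity
(`isPieceSol_sol`). The candidate uses the b_u-solution above B, both solutions below, C¹ matching
at B, and the condition that the equation imposes at x* (`isSolution_glue`, `IsSolution.fixed`);
Cramer's rule then gives the stated constants.

Uniqueness (`eq_zero_of_subsolution`). The modulus of a difference of bounded solutions is a
subsolution of T. If δ > 0, T is a strict contraction. If δ = 0 and αr ≤ λ, a shifted logarithm is a
supersolution; its small multiples dominate far out, while near x* survival of one loss has
probability bounded away from 1. If δ = 0 and αr > λ, then b_u > 0, the candidate tends to 0, and so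
does `trapSeries` by minimality. The same uniqueness gives D ≠ 0: otherwise the matched combination
would solve the homogeneous problem, hence vanish, although its upper coefficient is a nonzero
Wronskian (`Regular.den_ne_zero`).

The continued Gauss function is produced by Euler's integral along a rotated ray, extended to all
parameters by contiguous relations (`hasContinuation`); the identity theorem carries those relations
to the cut plane. Part (ii) is dominated convergence on the probabilistic definition and does not
pass through the closed form. -/

lemma HasSum.of_eq {f g : ℕ → ℂ} {s : ℂ} (h : HasSum g s) (e : ∀ n, f n = g n) : HasSum f s := by
  rwa [funext e]

/-! ### The Gauss series on the unit disc -/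

/-- Coefficients of the Gauss series. -/
noncomputable def hypCoeff (a b c : ℂ) (n : ℕ) : ℂ := ordinaryHypergeometricCoefficient a b c n

/-- If some parameter is a non-positive integer the coefficients eventually vanish (for the lower
one because 0⁻¹ = 0), so the radius is infinite; otherwise it is 1. Summability on the disc thus
needs no condition on the parameters. -/
lemma one_le_radius_hypergeometric (a b c : ℂ) :
    1 ≤ (ordinaryHypergeometricSeries ℂ a b c).radius := by
  by_cases h : ∀ kn : ℕ, (kn : ℂ) ≠ -a ∧ (kn : ℂ) ≠ -b ∧ (kn : ℂ) ≠ -c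
  · rw [ordinaryHypergeometricSeries_radius_eq_one ℂ a b c h]
  · push Not at h
    obtain ⟨k, hk⟩ := h
    by_cases h1 : (k : ℂ) = -a
    · obtain rfl : a = -(k : ℂ) := by rw [h1, neg_neg]
      rw [ordinaryHypergeometric_radius_top_of_neg_nat₁]; exact le_top
    by_cases h2 : (k : ℂ) = -b
    · obtain rfl : b = -(k : ℂ) := by rw [h2, neg_neg]
      rw [ordinaryHypergeometric_radius_top_of_neg_nat₂]; exact le_top
    obtain rfl : c = -(k : ℂ) := by rw [hk h1 h2, neg_neg]
    rw [ordinaryHypergeometric_radius_top_of_neg_nat₃]; exact le_top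

lemma hasFPowerSeriesOnBall_hypergeometric (a b c : ℂ) :
    HasFPowerSeriesOnBall (ordinaryHypergeometric a b c : ℂ → ℂ)
      (ordinaryHypergeometricSeries ℂ a b c) 0 1 :=
  ((ordinaryHypergeometricSeries ℂ a b c).hasFPowerSeriesOnBall
    (zero_lt_one.trans_le (one_le_radius_hypergeometric a b c))).mono zero_lt_one
    (one_le_radius_hypergeometric a b c)

lemma mem_eball_one {z : ℂ} (hz : ‖z‖ < 1) : z ∈ Metric.eball (0 : ℂ) 1 := by
  have : (1 : ℝ≥0∞) = ENNReal.ofReal 1 := by simp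
  rw [this, Metric.eball_ofReal]
  simpa using hz

lemma hasSum_hypergeometric (a b c : ℂ) {z : ℂ} (hz : ‖z‖ < 1) :
    HasSum (fun n => hypCoeff a b c n * z ^ n) (ordinaryHypergeometric a b c z) := by
  have := (hasFPowerSeriesOnBall_hypergeometric a b c).hasSum (mem_eball_one hz)
  simp only [zero_add] at this
  refine HasSum.of_eq this fun n => ?_
  rw [ordinaryHypergeometricSeries_apply_eq, hypCoeff, smul_eq_mul]

lemma differentiableOn_hypergeometric (a b c : ℂ) :
    DifferentiableOn ℂ (ordinaryHypergeometric a b c : ℂ → ℂ) (Metric.ball 0 1) := by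
  have := (hasFPowerSeriesOnBall_hypergeometric a b c).differentiableOn
  refine this.mono fun z hz => mem_eball_one (by simpa using hz)

lemma iteratedDeriv_hypergeometric_zero (a b c : ℂ) (n : ℕ) :
    iteratedDeriv n (ordinaryHypergeometric a b c : ℂ → ℂ) 0 = n.factorial * hypCoeff a b c n := by
  have := (hasFPowerSeriesOnBall_hypergeometric a b c).factorial_smul 1 n
  rw [iteratedDeriv_eq_iteratedFDeriv, ← this, ordinaryHypergeometricSeries_apply_eq, hypCoeff]
  simp

lemma hasSum_mul_deriv_hypergeometric (a b c : ℂ) {z : ℂ} (hz : ‖z‖ < 1) :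
    HasSum (fun n => n * hypCoeff a b c n * z ^ n)
      (z * deriv (ordinaryHypergeometric a b c : ℂ → ℂ) z) := by
  have hd : DifferentiableOn ℂ (deriv (ordinaryHypergeometric a b c : ℂ → ℂ))
      (Metric.ball 0 1) := (differentiableOn_hypergeometric a b c).deriv Metric.isOpen_ball
  have := (Complex.hasSum_taylorSeries_on_ball hd (by simpa using hz : z ∈ _)).mul_left z
  simp only [← iteratedDeriv_succ', iteratedDeriv_hypergeometric_zero, sub_zero, smul_eq_mul]
    at this
  rw [← hasSum_nat_add_iff' 1]
  simp only [Finset.range_one, Finset.sum_singleton, Nat.cast_zero, zero_mul, sub_zero]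
  refine HasSum.of_eq this fun n => ?_
  have : (n.factorial : ℂ) ≠ 0 := by exact_mod_cast n.factorial_ne_zero
  rw [Nat.factorial_succ]
  push_cast
  field_simp
  ring

lemma hypCoeff_zero (a b c : ℂ) : hypCoeff a b c 0 = 1 := by
  simp [hypCoeff, ordinaryHypergeometricCoefficient]

lemma hypCoeff_eq (a b c : ℂ) (n : ℕ) : hypCoeff a b c n =
    (ascPochhammer ℂ n).eval a * (ascPochhammer ℂ n).eval b /
      ((ascPochhammer ℂ n).eval c * n.factorial) := by
  simp only [hypCoeff, ordinaryHypergeometricCoefficient]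
  rw [div_eq_mul_inv, mul_inv]; ring

/-- `c` is an admissible lower parameter: not a non-positive integer. -/
def LowerParam (c : ℂ) : Prop := ∀ k : ℕ, c + k ≠ 0

lemma LowerParam.add_nat {c : ℂ} (h : LowerParam c) (n : ℕ) : LowerParam (c + n) := by
  intro k hk
  apply h (n + k)
  push_cast
  rw [← hk]; ring

lemma LowerParam.ascPochhammer_ne_zero {c : ℂ} (h : LowerParam c) (n : ℕ) :
    (ascPochhammer ℂ n).eval c ≠ 0 := by
  intro h0
  obtain ⟨k, -, hk⟩ := (ascPochhammer_eval_eq_zero_iff n c).1 h0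
  exact h k (by rw [hk]; ring)

lemma ascPochhammer_eval_add_one_mul (a : ℂ) (n : ℕ) :
    a * (ascPochhammer ℂ n).eval (a + 1) = (ascPochhammer ℂ n).eval a * (a + n) := by
  rw [← ascPochhammer_succ_eval, ascPochhammer_succ_left]
  simp

lemma hypCoeff_upper_succ (a b c : ℂ) (n : ℕ) :
    a * hypCoeff (a + 1) b c n = (a + n) * hypCoeff a b c n := by
  rw [hypCoeff_eq, hypCoeff_eq, mul_div_assoc', ← mul_assoc, ascPochhammer_eval_add_one_mul]
  ring

lemma hypCoeff_lower_pred {c : ℂ} (h : LowerParam c) (a b : ℂ) (n : ℕ) :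
    c * hypCoeff a b c n = (c + n) * hypCoeff a b (c + 1) n := by
  have h1 := h.ascPochhammer_ne_zero n
  have h2 := (h.add_nat 1).ascPochhammer_ne_zero n
  have h3 := ascPochhammer_eval_add_one_mul c n
  have h4 : (n.factorial : ℂ) ≠ 0 := by exact_mod_cast n.factorial_ne_zero
  simp only [Nat.cast_one] at h2
  rw [hypCoeff_eq, hypCoeff_eq]
  field_simp
  linear_combination (ascPochhammer ℂ n).eval a * (ascPochhammer ℂ n).eval b * h3

/-- Coefficient of z^(n+1) in (θ - (a+1-c)) F(a+1) - (c-a-1) F(a) = z (θ + b) F(a+1), with θ = z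
d/dz. -/
lemma hypCoeff_upper_pair {c : ℂ} (h : LowerParam c) (a b : ℂ) (n : ℕ) :
    ((n + 1 : ℕ) - (a + 1 - c)) * hypCoeff (a + 1) b c (n + 1)
      - (c - a - 1) * hypCoeff a b c (n + 1) = (n + b) * hypCoeff (a + 1) b c n := by
  have h1 := h.ascPochhammer_ne_zero n
  have h2 := h n
  have h4 : (n.factorial : ℂ) ≠ 0 := by exact_mod_cast n.factorial_ne_zero
  have h5 : (n : ℂ) + 1 ≠ 0 := by exact_mod_cast n.succ_ne_zero
  simp only [hypCoeff_eq, ascPochhammer_succ_eval, Nat.factorial_succ]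
  rw [← ascPochhammer_eval_add_one_mul a n]
  push_cast
  field_simp
  ring

/-- `z F' = a (F(a+1) - F(a))`. -/
lemma mul_deriv_hypergeometric (a b c : ℂ) {z : ℂ} (hz : ‖z‖ < 1) :
    z * deriv (ordinaryHypergeometric a b c : ℂ → ℂ) z =
      a * (ordinaryHypergeometric (a + 1) b c z - ordinaryHypergeometric a b c z) := by
  refine (hasSum_mul_deriv_hypergeometric a b c hz).unique ?_
  refine HasSum.of_eq (((hasSum_hypergeometric (a + 1) b c hz).sub
    (hasSum_hypergeometric a b c hz)).mul_left a) fun n => ?_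
  linear_combination - z ^ n * hypCoeff_upper_succ a b c n

/-- `c F(c) = c F(c+1) + z F'(c+1)`. -/
lemma lower_pred_hypergeometric {c : ℂ} (h : LowerParam c) (a b : ℂ) {z : ℂ} (hz : ‖z‖ < 1) :
    c * ordinaryHypergeometric a b c z = c * ordinaryHypergeometric a b (c + 1) z
      + z * deriv (ordinaryHypergeometric a b (c + 1) : ℂ → ℂ) z := by
  refine ((hasSum_hypergeometric a b c hz).mul_left c).unique ?_
  refine HasSum.of_eq (((hasSum_hypergeometric a b (c + 1) hz).mul_left c).add
    (hasSum_mul_deriv_hypergeometric a b (c + 1) hz)) fun n => ?_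
  linear_combination z ^ n * hypCoeff_lower_pred h a b n

/-- `z (1 - z) F'(a+1) = (c - a - 1) F(a) + (a + 1 - c + b z) F(a+1)`. -/
lemma mul_one_sub_mul_deriv_hypergeometric {c : ℂ} (h : LowerParam c) (a b : ℂ) {z : ℂ}
    (hz : ‖z‖ < 1) :
    z * (1 - z) * deriv (ordinaryHypergeometric (a + 1) b c : ℂ → ℂ) z =
      (c - a - 1) * ordinaryHypergeometric a b c z
        + (a + 1 - c + b * z) * ordinaryHypergeometric (a + 1) b c z := by
  have hF := hasSum_hypergeometric (a + 1) b c hz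
  have hL := (((hasSum_mul_deriv_hypergeometric (a + 1) b c hz).sub (hF.mul_left (a + 1 - c))).sub
    ((hasSum_hypergeometric a b c hz).mul_left (c - a - 1)))
  have hR := ((hasSum_mul_deriv_hypergeometric (a + 1) b c hz).add (hF.mul_left b)).mul_left z
  -- The constant terms on the left cancel, so the left series can be shifted by one to match the
  -- factor z on the right.
  rw [← hasSum_nat_add_iff' 1] at hL
  have := HasSum.unique (HasSum.of_eq hL fun n => ?_) hR
  · simp only [Finset.range_one, Finset.sum_singleton, hypCoeff_zero] at this
    linear_combination this
  · have h1 := hypCoeff_upper_pair h a b n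
    push_cast at h1 ⊢
    rw [pow_succ]
    linear_combination - z ^ n * z * h1

/-! ### A contour integral representing the analytic continuation -/

lemma add_mem_slitPlane {ρ : ℂ} (h : ρ ∈ Complex.slitPlane) {s : ℝ} (hs : 0 ≤ s) :
    (s : ℂ) + ρ ∈ Complex.slitPlane := by
  rw [Complex.mem_slitPlane_iff] at h ⊢
  simp only [Complex.add_re, Complex.ofReal_re, Complex.add_im, Complex.ofReal_im, zero_add]
  rcases h with h | h
  · left; linarith
  · right; exact h

lemma exists_lower_bound_norm_add {ρ : ℂ} (h : ρ ∈ Complex.slitPlane) :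
    ∃ d > 0, ∀ s : ℝ, 0 ≤ s → d ≤ ‖(s : ℂ) + ρ‖ := by
  rw [Complex.mem_slitPlane_iff] at h
  rcases h with h | h
  · refine ⟨ρ.re, h, fun s hs => ?_⟩
    refine le_trans ?_ (Complex.re_le_norm _)
    simp; exact hs
  · refine ⟨|ρ.im|, abs_pos.2 h, fun s hs => ?_⟩
    refine le_trans ?_ (Complex.abs_im_le_norm _)
    simp

/-- Comparing |s+ρ| with 1+s uniformly over a ball of ρ provides one majorant for the whole ball, as
differentiation under the integral requires. -/
lemma exists_bounds_norm_add {ρ₀ : ℂ} (h : ρ₀ ∈ Complex.slitPlane) :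
    ∃ ε > 0, ∃ c₁ > 0, ∃ c₂ > 0, ∀ ρ ∈ Metric.ball ρ₀ ε, ρ ∈ Complex.slitPlane ∧
      ∀ s : ℝ, 0 ≤ s → c₁ * (1 + s) ≤ ‖(s : ℂ) + ρ‖ ∧ ‖(s : ℂ) + ρ‖ ≤ c₂ * (1 + s) := by
  obtain ⟨d, hd, hd'⟩ := exists_lower_bound_norm_add h
  obtain ⟨ε, hε, hball⟩ := Metric.isOpen_iff.1 Complex.isOpen_slitPlane ρ₀ h
  set k : ℝ := 1 + (1 + ‖ρ₀‖) / d with hk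
  have hk0 : 0 < k := by positivity
  have key : ∀ s : ℝ, 0 ≤ s → (1 + s) ≤ k * ‖(s : ℂ) + ρ₀‖ := by
    intro s hs
    have h1 := hd' s hs
    have h2 : s - ‖ρ₀‖ ≤ ‖(s : ℂ) + ρ₀‖ := by
      have := norm_sub_norm_le (s : ℂ) (-ρ₀)
      simpa [abs_of_nonneg hs] using this
    have h3 : (1 + ‖ρ₀‖) ≤ (1 + ‖ρ₀‖) / d * ‖(s : ℂ) + ρ₀‖ := by
      rw [div_mul_eq_mul_div, le_div_iff₀ hd]
      gcongr
    rw [hk, add_mul]; linarith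
  refine ⟨min ε (1 / (2 * k)), by positivity, 1 / (2 * k), by positivity, ‖ρ₀‖ + 1 + 1 / (2 * k),
    by positivity, fun ρ hρ => ⟨hball (Metric.ball_subset_ball (min_le_left _ _) hρ), ?_⟩⟩
  intro s hs
  have hdist : ‖ρ - ρ₀‖ ≤ 1 / (2 * k) := by
    have := hρ; rw [Metric.mem_ball, dist_eq_norm] at this
    exact this.le.trans (min_le_right _ _)
  have hs1 : 1 ≤ 1 + s := by linarith
  have e : (s : ℂ) + ρ = ((s : ℂ) + ρ₀) + (ρ - ρ₀) := by ring
  constructor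
  · have h1 : 1 / k * (1 + s) ≤ ‖(s : ℂ) + ρ₀‖ := by
      rw [div_mul_eq_mul_div, one_mul, div_le_iff₀ hk0, mul_comm]; exact key s hs
    have h2 : ‖(s : ℂ) + ρ₀‖ - ‖ρ - ρ₀‖ ≤ ‖(s : ℂ) + ρ‖ := by
      rw [e]
      have := norm_sub_norm_le ((s : ℂ) + ρ₀) (-(ρ - ρ₀))
      rwa [norm_neg, sub_neg_eq_add] at this
    have h3 : 1 / (2 * k) * 1 ≤ 1 / (2 * k) * (1 + s) := by gcongr
    have h4 : 1 / k = 1 / (2 * k) + 1 / (2 * k) := by field_simp; norm_num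
    rw [h4, add_mul] at h1
    linarith
  · have h1 : ‖(s : ℂ) + ρ‖ ≤ s + ‖ρ₀‖ + 1 / (2 * k) := by
      rw [e]
      refine (norm_add_le _ _).trans (add_le_add ((norm_add_le _ _).trans ?_) hdist)
      simp [abs_of_nonneg hs]
    have h2 : 0 ≤ ‖ρ₀‖ * s := by positivity
    have h3 : 0 ≤ 1 / (2 * k) * s := by positivity
    nlinarith

/-- The sum of both powers is a bound whatever the sign of the exponent; as the exponent is real,
the argument of w does not affect the norm. -/
lemma norm_cpow_le_of_bounds {w : ℂ} {c₁ c₂ t : ℝ} (h₁ : 0 < c₁) (ht : 0 < t)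
    (hl : c₁ * t ≤ ‖w‖) (hu : ‖w‖ ≤ c₂ * t) (e : ℝ) :
    ‖w ^ (e : ℂ)‖ ≤ (c₁ ^ e + c₂ ^ e) * t ^ e := by
  have h₂ : 0 < c₂ := by
    by_contra h
    push Not at h
    have : c₂ * t ≤ 0 := mul_nonpos_of_nonpos_of_nonneg h ht.le
    have : 0 < c₁ * t := by positivity
    linarith
  rw [Complex.norm_cpow_real, add_mul, ← Real.mul_rpow h₁.le ht.le, ← Real.mul_rpow h₂.le ht.le]
  rcases le_total 0 e with he | he
  · have := Real.rpow_le_rpow (norm_nonneg _) hu he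
    have : 0 ≤ (c₁ * t) ^ e := by positivity
    linarith
  · have := Real.rpow_le_rpow_of_nonpos (by positivity) hl he
    have : 0 ≤ (c₂ * t) ^ e := by positivity
    linarith

lemma integrableOn_rpow_mul_one_add_rpow {p q : ℝ} (hp : 0 < p) (hpq : p < q) :
    IntegrableOn (fun s : ℝ => s ^ (p - 1) * (1 + s) ^ (-q)) (Set.Ioi 0) := by
  have hm : Measurable fun s : ℝ => s ^ (p - 1) * (1 + s) ^ (-q) := by fun_prop
  rw [← Set.Ioc_union_Ioi_eq_Ioi (zero_le_one (α := ℝ))]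
  refine IntegrableOn.union ?_ ?_
  · have h := (intervalIntegral.intervalIntegrable_rpow' (a := 0) (b := 1)
      (by linarith : -1 < p - 1))
    rw [intervalIntegrable_iff_integrableOn_Ioc_of_le zero_le_one] at h
    refine Integrable.mono' h hm.aestronglyMeasurable ?_
    refine (ae_restrict_iff' measurableSet_Ioc).2 (Eventually.of_forall fun s hs => ?_)
    have h0 : 0 ≤ s ^ (p - 1) := Real.rpow_nonneg hs.1.le _
    have h1 : 0 ≤ (1 + s) ^ (-q) := Real.rpow_nonneg (by linarith [hs.1]) _
    rw [Real.norm_of_nonneg (mul_nonneg h0 h1)]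
    have : (1 + s) ^ (-q) ≤ 1 := Real.rpow_le_one_of_one_le_of_nonpos (by linarith [hs.1])
      (by linarith)
    nlinarith
  · have h := integrableOn_Ioi_rpow_of_lt (by linarith : p - 1 - q < -1) zero_lt_one
    refine Integrable.mono' h hm.aestronglyMeasurable ?_
    refine (ae_restrict_iff' measurableSet_Ioi).2 (Eventually.of_forall fun s hs => ?_)
    have hs0 : (0 : ℝ) < s := zero_lt_one.trans hs
    have h0 : 0 ≤ s ^ (p - 1) := Real.rpow_nonneg hs0.le _
    have h1 : 0 ≤ (1 + s) ^ (-q) := Real.rpow_nonneg (by linarith) _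
    rw [Real.norm_of_nonneg (mul_nonneg h0 h1), sub_eq_add_neg (p - 1), Real.rpow_add hs0]
    gcongr 1
    exact Real.rpow_le_rpow_of_nonpos hs0 (by linarith) (by linarith)

/-- Integrand of `contourInt`. -/
noncomputable def contourIntegrand (p c a : ℝ) (ρ : ℂ) (s : ℝ) : ℂ :=
  ((s ^ (p - 1) : ℝ) : ℂ) * ((s : ℂ) + -Complex.I) ^ ((a - c : ℝ) : ℂ)
    * ((s : ℂ) + ρ) ^ ((-a : ℝ) : ℂ)

/-- `∫₀^∞ s^(p-1) (s-i)^(a-c) (s+ρ)^(-a) ds`, a multiple of `F(a, c-p; c; 1 - iρ)`. -/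
noncomputable def contourInt (p c a : ℝ) (ρ : ℂ) : ℂ :=
  ∫ s in Set.Ioi (0 : ℝ), contourIntegrand p c a ρ s

lemma neg_I_mem_slitPlane : -Complex.I ∈ Complex.slitPlane := by
  rw [Complex.mem_slitPlane_iff]; right; simp

lemma measurable_contourIntegrand (p c a : ℝ) (ρ : ℂ) : Measurable (contourIntegrand p c a ρ) := by
  unfold contourIntegrand
  fun_prop

lemma exists_bound_contourIntegrand (p c a : ℝ) {ρ₀ : ℂ} (h : ρ₀ ∈ Complex.slitPlane) :
    ∃ ε > 0, ∃ C : ℝ, ∀ ρ ∈ Metric.ball ρ₀ ε, ρ ∈ Complex.slitPlane ∧ ∀ s : ℝ, 0 < s →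
      ‖contourIntegrand p c a ρ s‖ ≤ C * (s ^ (p - 1) * (1 + s) ^ (-c)) := by
  obtain ⟨ε, hε, c₁, hc₁, c₂, hc₂, hb⟩ := exists_bounds_norm_add h
  obtain ⟨ε', hε', c₁', hc₁', c₂', hc₂', hb'⟩ := exists_bounds_norm_add neg_I_mem_slitPlane
  refine ⟨ε, hε, (c₁' ^ (a - c) + c₂' ^ (a - c)) * (c₁ ^ (-a) + c₂ ^ (-a)),
    fun ρ hρ => ⟨(hb ρ hρ).1, fun s hs => ?_⟩⟩
  have hs1 : 0 < 1 + s := by linarith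
  have h1 := (hb ρ hρ).2 s hs.le
  have h2 := (hb' _ (Metric.mem_ball_self hε')).2 s hs.le
  have e1 := norm_cpow_le_of_bounds hc₁ hs1 h1.1 h1.2 (-a)
  have e2 := norm_cpow_le_of_bounds hc₁' hs1 h2.1 h2.2 (a - c)
  have e0 : 0 ≤ s ^ (p - 1) := Real.rpow_nonneg hs.le _
  rw [contourIntegrand, norm_mul, norm_mul, Complex.norm_real, Real.norm_of_nonneg e0]
  calc _ ≤ s ^ (p - 1) * ((c₁' ^ (a - c) + c₂' ^ (a - c)) * (1 + s) ^ (a - c))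
        * ((c₁ ^ (-a) + c₂ ^ (-a)) * (1 + s) ^ (-a)) := by gcongr
    _ = _ := by
      have : (1 + s) ^ (-c) = (1 + s) ^ (a - c) * (1 + s) ^ (-a) := by
        rw [← Real.rpow_add hs1]; ring_nf
      rw [this]; ring

lemma integrableOn_contourIntegrand {p c : ℝ} (hp : 0 < p) (hpc : p < c) (a : ℝ) {ρ : ℂ}
    (h : ρ ∈ Complex.slitPlane) : IntegrableOn (contourIntegrand p c a ρ) (Set.Ioi 0) := by
  obtain ⟨ε, hε, C, hC⟩ := exists_bound_contourIntegrand p c a h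
  refine Integrable.mono' ((integrableOn_rpow_mul_one_add_rpow hp hpc).const_mul C)
    (measurable_contourIntegrand p c a ρ).aestronglyMeasurable ?_
  exact (ae_restrict_iff' measurableSet_Ioi).2 (Eventually.of_forall fun s hs =>
    (hC ρ (Metric.mem_ball_self hε)).2 s hs)

/-- Differentiating (s+ρ)^(-a) raises a by one; raising c along with it keeps the power of s - i
unchanged, so the family of integrals is closed under differentiation. -/
lemma hasDerivAt_contourInt {p c : ℝ} (hp : 0 < p) (hpc : p < c) (a : ℝ) {ρ : ℂ}
    (h : ρ ∈ Complex.slitPlane) :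
    HasDerivAt (contourInt p c a) (-a * contourInt p (c + 1) (a + 1) ρ) ρ := by
  obtain ⟨ε, hε, C, hC⟩ := exists_bound_contourIntegrand p (c + 1) (a + 1) h
  have key := hasDerivAt_integral_of_dominated_loc_of_deriv_le (μ := volume.restrict (Set.Ioi 0))
    (F := fun ρ s => contourIntegrand p c a ρ s)
    (F' := fun ρ s => -a * contourIntegrand p (c + 1) (a + 1) ρ s) (x₀ := ρ)
    (bound := fun s => |a| * (C * (s ^ (p - 1) * (1 + s) ^ (-(c + 1)))))
    (Metric.ball_mem_nhds ρ hε)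
    (Eventually.of_forall fun ρ => (measurable_contourIntegrand p c a ρ).aestronglyMeasurable)
    (integrableOn_contourIntegrand hp hpc a h)
    ((measurable_contourIntegrand p (c + 1) (a + 1) ρ).const_mul _).aestronglyMeasurable ?_
    (((integrableOn_rpow_mul_one_add_rpow hp (by linarith)).const_mul C).const_mul _) ?_
  · have := key.2
    rw [integral_const_mul] at this
    exact this
  · refine (ae_restrict_iff' measurableSet_Ioi).2 (Eventually.of_forall fun s hs x hx => ?_)
    rw [norm_mul, norm_neg, Complex.norm_real, Real.norm_eq_abs]
    gcongr
    exact (hC x hx).2 s hs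
  · refine (ae_restrict_iff' measurableSet_Ioi).2 (Eventually.of_forall fun s hs x hx => ?_)
    have hx' := add_mem_slitPlane (hC x hx).1 (le_of_lt hs : (0:ℝ) ≤ s)
    have h1 := ((hasDerivAt_id x).const_add (s : ℂ)).cpow_const (c := ((-a : ℝ) : ℂ)) hx'
    have h2 := h1.const_mul (((s ^ (p - 1) : ℝ) : ℂ) *
      ((s : ℂ) + -Complex.I) ^ ((a - c : ℝ) : ℂ))
    refine h2.congr_deriv ?_
    rw [contourIntegrand]
    have e1 : (a + 1 - (c + 1) : ℝ) = a - c := by ring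
    have e2 : ((-(a + 1) : ℝ) : ℂ) = ((-a : ℝ) : ℂ) - 1 := by push_cast; ring
    rw [e1, e2]; simp; ring

/-- The value of `contourInt` at `ρ = -i`, i.e. at `z = 0`. -/
noncomputable def contourConst (p c : ℝ) : ℂ := contourInt p c 0 (-Complex.I)

lemma contourIntegrand_neg_I (p c a s : ℝ) :
    contourIntegrand p c a (-Complex.I) s =
      ((s ^ (p - 1) : ℝ) : ℂ) * ((s : ℂ) + -Complex.I) ^ ((-c : ℝ) : ℂ) := by
  have h0 : (s : ℂ) + -Complex.I ≠ 0 := by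
    intro h; have := congrArg Complex.im h; simp at this
  rw [contourIntegrand, mul_assoc, ← Complex.cpow_add _ _ h0]
  congr 2; push_cast; ring

/-- At ρ = -i the two complex powers merge into (s-i)^(-c), which does not involve a. -/
lemma contourInt_neg_I (p c a : ℝ) : contourInt p c a (-Complex.I) = contourConst p c := by
  simp only [contourConst, contourInt, contourIntegrand_neg_I]

/-- Integration by parts: s^p (s-i)^(-c) vanishes at 0 and at infinity because 0 < p < c. -/
lemma contourConst_parts {p c : ℝ} (hp : 0 < p) (hpc : p < c) :
    p * contourConst p c = c * contourConst (p + 1) (c + 1) := by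
  have hi1 := integrableOn_contourIntegrand hp hpc 0 neg_I_mem_slitPlane
  have hi2 := integrableOn_contourIntegrand (p := p + 1) (c := c + 1) (by linarith)
    (by linarith) 0 neg_I_mem_slitPlane
  have key := integral_Ioi_of_hasDerivAt_of_tendsto (a := 0) (m := 0)
    (f := fun s : ℝ => ((s ^ p : ℝ) : ℂ) * ((s : ℂ) + -Complex.I) ^ ((-c : ℝ) : ℂ))
    (f' := fun s => p * contourIntegrand p c 0 (-Complex.I) s
      - c * contourIntegrand (p + 1) (c + 1) 0 (-Complex.I) s) ?_ ?_
    ((hi1.const_mul _).sub (hi2.const_mul _)) ?_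
  · rw [integral_sub (hi1.const_mul _) (hi2.const_mul _), integral_const_mul,
      integral_const_mul] at key
    simp only [Real.zero_rpow hp.ne', Complex.ofReal_zero, zero_mul, sub_zero] at key
    exact sub_eq_zero.1 key
  · refine ContinuousAt.continuousWithinAt (ContinuousAt.mul ?_ ?_)
    · exact (Complex.continuous_ofReal.continuousAt).comp
        (Real.continuousAt_rpow_const _ _ (Or.inr hp.le))
    · exact ContinuousAt.cpow (by fun_prop) continuousAt_const
        (add_mem_slitPlane neg_I_mem_slitPlane le_rfl)
  · intro s (hs : 0 < s)
    have hw := add_mem_slitPlane neg_I_mem_slitPlane hs.le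
    have h1 := (Real.hasDerivAt_rpow_const (p := p) (Or.inl hs.ne')).ofReal_comp
    have h2 := (((hasDerivAt_id (s : ℂ)).add_const (-Complex.I)).cpow_const
      (c := ((-c : ℝ) : ℂ)) hw).comp_ofReal
    refine (h1.mul h2).congr_deriv ?_
    simp only [contourIntegrand_neg_I, id, add_sub_cancel_right]
    have e2 : ((-(c + 1) : ℝ) : ℂ) = ((-c : ℝ) : ℂ) - 1 := by push_cast; ring
    rw [e2]; push_cast; ring
  · rw [tendsto_zero_iff_norm_tendsto_zero]
    refine squeeze_zero' (g := fun s : ℝ => s ^ (-(c - p))) (Eventually.of_forall fun s =>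
      norm_nonneg _) ?_ (tendsto_rpow_neg_atTop (by linarith))
    filter_upwards [eventually_gt_atTop 0] with s hs
    have e0 : 0 ≤ s ^ p := Real.rpow_nonneg hs.le _
    rw [norm_mul, Complex.norm_real, Real.norm_of_nonneg e0, Complex.norm_cpow_real,
      show -(c - p) = p + -c by ring, Real.rpow_add hs]
    gcongr 1
    refine Real.rpow_le_rpow_of_nonpos hs ?_ (by linarith)
    refine le_trans ?_ (Complex.re_le_norm _)
    simp

/-- Write one factor s as (s-i) + i. -/
lemma contourConst_split {p c : ℝ} (hp : 0 < p) (hpc : p < c) :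
    contourConst (p + 1) (c + 1) = contourConst p c + Complex.I * contourConst p (c + 1) := by
  have hi1 := integrableOn_contourIntegrand hp hpc 0 neg_I_mem_slitPlane
  have hi2 := integrableOn_contourIntegrand (p := p) (c := c + 1) hp
    (by linarith) 0 neg_I_mem_slitPlane
  rw [contourConst, contourConst, contourConst, contourInt, contourInt, contourInt,
    ← integral_const_mul, ← integral_add hi1 (hi2.const_mul _)]
  refine setIntegral_congr_fun measurableSet_Ioi fun s (hs : 0 < s) => ?_
  have h0 : (s : ℂ) + -Complex.I ≠ 0 := by
    intro h; have := congrArg Complex.im h; simp at this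
  simp only [contourIntegrand_neg_I]
  have e1 : ((-c : ℝ) : ℂ) = ((-(c + 1) : ℝ) : ℂ) + 1 := by push_cast; ring
  rw [e1, Complex.cpow_add _ _ h0, Complex.cpow_one, add_sub_cancel_right]
  have e2 : s ^ p = s ^ (p - 1) * s := by rw [Real.rpow_sub_one hs.ne']; field_simp
  rw [e2]; push_cast; ring

lemma contourConst_succ {p c : ℝ} (hp : 0 < p) (hpc : p < c) :
    c * contourConst p (c + 1) = Complex.I * (c - p) * contourConst p c := by
  have h1 := contourConst_parts hp hpc
  rw [contourConst_split hp hpc] at h1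
  linear_combination Complex.I * h1 + c * contourConst p (c + 1) * Complex.I_sq

/-- For s > 0 the argument of s - i lies in (-π/2, 0). With 0 < c ≤ 2 the argument of (s-i)^(-c)
lies in (0, π), so the integrand has positive imaginary part. -/
lemma contourConst_ne_zero_of_le {p c : ℝ} (hp : 0 < p) (hpc : p < c) (hc : c ≤ 2) :
    contourConst p c ≠ 0 := by
  have hi1 := integrableOn_contourIntegrand hp hpc 0 neg_I_mem_slitPlane
  have him : ∀ s : ℝ, 0 < s → 0 < (contourIntegrand p c 0 (-Complex.I) s).im := by
    intro s hs
    rw [contourIntegrand_neg_I, Complex.im_ofReal_mul, Complex.cpow_ofReal_im]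
    have h1 : Complex.arg ((s : ℂ) + -Complex.I) < 0 := by
      rw [Complex.arg_neg_iff]; simp
    have h2 : -(Real.pi / 2) < Complex.arg ((s : ℂ) + -Complex.I) :=
      (abs_lt.1 (Complex.abs_arg_lt_pi_div_two_iff.2 (Or.inl (by simpa using hs)))).1
    have h3 : (0 : ℝ) < ‖(s : ℂ) + -Complex.I‖ := by
      rw [norm_pos_iff]
      intro h; have := congrArg Complex.im h; simp at this
    have h4 : 0 < Real.sin (Complex.arg ((s : ℂ) + -Complex.I) * -c) := by
      apply Real.sin_pos_of_pos_of_lt_pi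
      · nlinarith
      · nlinarith [Real.pi_pos]
    have := Real.rpow_pos_of_pos hs (p - 1)
    have := Real.rpow_pos_of_pos h3 (-c)
    positivity
  suffices 0 < (contourConst p c).im by
    intro h; simp [h] at this
  have e : (contourConst p c).im =
      ∫ s in Set.Ioi (0 : ℝ), (contourIntegrand p c 0 (-Complex.I) s).im :=
    (integral_im hi1).symm
  rw [e, setIntegral_pos_iff_support_of_nonneg_ae]
  · refine lt_of_lt_of_le ?_ (measure_mono (s := Set.Ioi (0 : ℝ)) fun s hs =>
      ⟨(him s hs).ne', hs⟩)
    simp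
  · exact (ae_restrict_iff' measurableSet_Ioi).2 (Eventually.of_forall fun s hs => (him s hs).le)
  · exact hi1.im

/-- Two recursions bring c down to at most 2: `contourConst_succ` lowers c alone when p < c-1, and
`contourConst_parts` lowers p and c together otherwise. -/
lemma contourConst_ne_zero {p c : ℝ} (hp : 0 < p) (hpc : p < c) : contourConst p c ≠ 0 := by
  suffices ∀ n : ℕ, ∀ p c : ℝ, 0 < p → p < c → c ≤ n + 2 → contourConst p c ≠ 0 by
    obtain ⟨n, hn⟩ := exists_nat_ge c
    exact this n p c hp hpc (by linarith)
  intro n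
  induction n with
  | zero => intro p c hp hpc hc; exact contourConst_ne_zero_of_le hp hpc (by simpa using hc)
  | succ n ih =>
    intro p c hp hpc hc h0
    push_cast at hc
    by_cases hc2 : c ≤ 2
    · exact contourConst_ne_zero_of_le hp hpc hc2 h0
    push Not at hc2
    by_cases hp1 : p < c - 1
    · have h1 := contourConst_succ hp hp1
      rw [sub_add_cancel, h0, mul_zero] at h1
      have h2 := ih p (c - 1) hp hp1 (by linarith)
      have h3 : ((c - 1 : ℝ) : ℂ) - p ≠ 0 := by
        rw [← Complex.ofReal_sub, Complex.ofReal_ne_zero]; linarith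
      exact mul_ne_zero (mul_ne_zero Complex.I_ne_zero h3) h2 h1.symm
    -- Here p ≥ c - 1 > 1, so p - 1 is still positive.
    · push Not at hp1
      have h1 := contourConst_parts (p := p - 1) (c := c - 1) (by linarith) (by linarith)
      rw [sub_add_cancel, sub_add_cancel, h0, mul_zero] at h1
      have h2 := ih (p - 1) (c - 1) (by linarith) (by linarith) (by linarith)
      have h3 : ((p - 1 : ℝ) : ℂ) ≠ 0 := by
        rw [Complex.ofReal_ne_zero]; linarith
      exact mul_ne_zero h3 h2 h1

/-! ### Existence of the analytic continuation -/

lemma isOpen_cutPlane : IsOpen cutPlane := by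
  have : IsClosed {z : ℂ | z.re = 1 ∧ 0 ≤ z.im} :=
    (isClosed_eq Complex.continuous_re continuous_const).inter
      (isClosed_le continuous_const Complex.continuous_im)
  exact this.isOpen_compl

lemma mem_cutPlane_of_norm_lt {z : ℂ} (hz : ‖z‖ < 1) : z ∈ cutPlane := by
  rintro ⟨h, -⟩
  have := Complex.re_le_norm z
  linarith

lemma ofReal_mem_cutPlane {x : ℝ} (hx : x ≠ 1) : (x : ℂ) ∈ cutPlane := by
  rintro ⟨h, -⟩
  exact hx (by simpa using h)

/-- The centre 1 - i lies on the line of the cut, below it: a segment from there meets the cut only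
if its endpoint is on the cut. -/
lemma starConvex_cutPlane : StarConvex ℝ (1 - Complex.I) cutPlane := by
  rintro z hz s t hs ht hst ⟨h1, h2⟩
  simp at h1 h2
  apply hz
  rcases eq_or_lt_of_le ht with h0 | h0
  · subst h0; obtain rfl : s = 1 := by linarith
    norm_num at h2
  · have h3 : z.re = 1 := by
      have : t * (z.re - 1) = 0 := by rw [mul_sub]; linarith
      rcases mul_eq_zero.1 this with h | h <;> linarith
    refine ⟨h3, ?_⟩
    by_contra hneg
    push Not at hneg
    nlinarith

lemma isPreconnected_cutPlane : IsPreconnected cutPlane :=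
  (starConvex_cutPlane.isPathConnected (by
    rintro ⟨-, h⟩; norm_num at h)).isConnected.isPreconnected

/-- The map z ↦ i(z-1) carries the removed half-line onto the closed negative real axis, so
principal powers of i(z-1) are analytic on `cutPlane`. -/
lemma I_mul_sub_one_mem_slitPlane {z : ℂ} (hz : z ∈ cutPlane) :
    Complex.I * (z - 1) ∈ Complex.slitPlane := by
  rw [Complex.mem_slitPlane_iff]
  by_cases h : z.re = 1
  · left
    have : ¬ 0 ≤ z.im := fun h' => hz ⟨h, h'⟩
    simpa using this
  · right
    simpa [sub_eq_zero] using h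

lemma hasDerivAt_contourInt_comp {p c : ℝ} (hp : 0 < p) (hpc : p < c) (a : ℝ) {z : ℂ}
    (hz : z ∈ cutPlane) :
    HasDerivAt (fun z => contourInt p c a (Complex.I * (z - 1)))
      (-Complex.I * a * contourInt p (c + 1) (a + 1) (Complex.I * (z - 1))) z := by
  have h1 := hasDerivAt_contourInt hp hpc a (I_mul_sub_one_mem_slitPlane hz)
  have h2 : HasDerivAt (fun z => Complex.I * (z - 1)) Complex.I z := by
    simpa using ((hasDerivAt_id z).sub_const 1).const_mul Complex.I
  refine (h1.comp z h2).congr_deriv ?_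
  ring

lemma iteratedDeriv_contourInt_comp {p c : ℝ} (hp : 0 < p) (hpc : p < c) (a : ℝ) (n : ℕ) :
    ∀ z ∈ cutPlane, iteratedDeriv n (fun z => contourInt p c a (Complex.I * (z - 1))) z =
      (-Complex.I) ^ n * (ascPochhammer ℂ n).eval (a : ℂ)
        * contourInt p (c + n) (a + n) (Complex.I * (z - 1)) := by
  induction n with
  | zero => intro z _; simp
  | succ n ih =>
    intro z hz
    have hev : iteratedDeriv n (fun z => contourInt p c a (Complex.I * (z - 1))) =ᶠ[𝓝 z]
        fun z => (-Complex.I) ^ n * (ascPochhammer ℂ n).eval (a : ℂ)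
        * contourInt p (c + n) (a + n) (Complex.I * (z - 1)) := by
      filter_upwards [isOpen_cutPlane.mem_nhds hz] with w hw using ih w hw
    have hn : (0 : ℝ) ≤ n := n.cast_nonneg
    rw [iteratedDeriv_succ, hev.deriv_eq,
      ((hasDerivAt_contourInt_comp hp (by linarith : p < c + n) (a + n) hz).const_mul _).deriv,
      ascPochhammer_succ_eval, pow_succ]
    push_cast
    rw [← add_assoc, ← add_assoc]
    ring

lemma contourConst_add_nat {b c : ℝ} (hb : 0 < b) (hbc : b < c) (n : ℕ) :
    (ascPochhammer ℂ n).eval (c : ℂ) * contourConst (c - b) (c + n) =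
      Complex.I ^ n * (ascPochhammer ℂ n).eval (b : ℂ) * contourConst (c - b) c := by
  induction n with
  | zero => simp
  | succ n ih =>
    have hn : (0 : ℝ) ≤ n := n.cast_nonneg
    have := contourConst_succ (p := c - b) (c := c + n) (by linarith) (by linarith)
    rw [ascPochhammer_succ_eval, ascPochhammer_succ_eval, pow_succ]
    push_cast at this ⊢
    rw [← add_assoc]
    linear_combination (ascPochhammer ℂ n).eval (c : ℂ) * this + Complex.I * (b + n) * ih

/-- The Gauss function with parameters `a, b, c` extends analytically to `cutPlane`. -/
def HasContinuation (a b c : ℝ) : Prop :=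
  ∃ f : ℂ → ℂ, DifferentiableOn ℂ f cutPlane ∧
    ∀ z : ℂ, ‖z‖ < 1 → f z = ordinaryHypergeometric (a : ℂ) (b : ℂ) (c : ℂ) z

lemma HasContinuation.symm {a b c : ℝ} (h : HasContinuation a b c) : HasContinuation b a c := by
  obtain ⟨f, hf, hf'⟩ := h
  refine ⟨f, hf, fun z hz => ?_⟩
  rw [hf' z hz, ordinaryHypergeometric, ordinaryHypergeometric, ordinaryHypergeometricSeries_symm]

lemma lowerParam_of_pos {c : ℝ} (hc : 0 < c) : LowerParam (c : ℂ) := by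
  intro k h
  have : (c + k : ℝ) = 0 := by exact_mod_cast h
  have := k.cast_nonneg (α := ℝ)
  linarith

/-- Euler's integral with t = 1/(1+u) becomes ∫ u^(c-b-1) (1+u)^(a-c) (1+u-z)^(-a) du. Turning the
ray to u = is makes it singular only for z in 1 + i[0,∞), the complement of `cutPlane`. The Taylor
coefficients at 0 agree with the Gauss series: differentiation yields (a)_n, and the recursion for
`contourConst` yields (b)_n/(c)_n. -/
lemma hasContinuation_of_pos_of_lt {b c : ℝ} (hb : 0 < b) (hbc : b < c) (a : ℝ) :
    HasContinuation a b c := by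
  have hp : 0 < c - b := by linarith
  have hpc : c - b < c := by linarith
  have hd : DifferentiableOn ℂ (fun z => contourInt (c - b) c a (Complex.I * (z - 1))) cutPlane :=
    fun z hz => (hasDerivAt_contourInt_comp hp hpc a hz).differentiableAt.differentiableWithinAt
  refine ⟨fun z => (contourConst (c - b) c)⁻¹ * contourInt (c - b) c a (Complex.I * (z - 1)),
    hd.const_mul _, fun z hz => ?_⟩
  have hK := contourConst_ne_zero hp hpc
  have hs := (Complex.hasSum_taylorSeries_on_ball (c := 0) (r := 1) (hd.mono fun w hw =>
    mem_cutPlane_of_norm_lt (by simpa using hw)) (by simpa using hz : z ∈ _)).mul_left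
    (contourConst (c - b) c)⁻¹
  refine hs.unique (HasSum.of_eq (hasSum_hypergeometric a b c hz) fun n => ?_)
  rw [iteratedDeriv_contourInt_comp hp hpc a n 0 (mem_cutPlane_of_norm_lt (by simp)),
    zero_sub, mul_neg, mul_one, contourInt_neg_I, hypCoeff_eq, sub_zero, smul_eq_mul, smul_eq_mul]
  have h1 := contourConst_add_nat hb hbc n
  have h2 := (lowerParam_of_pos (hb.trans hbc)).ascPochhammer_ne_zero n
  have h4 : (n.factorial : ℂ) ≠ 0 := by exact_mod_cast n.factorial_ne_zero
  have h5 : contourConst (c - b) (c + n) = Complex.I ^ n * (ascPochhammer ℂ n).eval (b : ℂ)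
      * contourConst (c - b) c / (ascPochhammer ℂ n).eval (c : ℂ) := by
    rw [← h1]; field_simp
  have h6 : (-Complex.I) ^ n * Complex.I ^ n = 1 := by
    rw [← mul_pow]; simp
  rw [h5]
  field_simp
  linear_combination z ^ n * (ascPochhammer ℂ n).eval (a : ℂ) *
    (ascPochhammer ℂ n).eval (b : ℂ) * h6

lemma deriv_eq_of_eq_on_ball {f g : ℂ → ℂ} (h : ∀ z : ℂ, ‖z‖ < 1 → f z = g z) {z : ℂ}
    (hz : ‖z‖ < 1) : deriv f z = deriv g z := by
  apply Filter.EventuallyEq.deriv_eq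
  filter_upwards [Metric.isOpen_ball.mem_nhds (by simpa using hz : z ∈ Metric.ball (0 : ℂ) 1)]
    with w hw using h w (by simpa using hw)

/-- Solve the relation `mul_one_sub_mul_deriv_hypergeometric` for F(a); the coefficient c - a - 1
must not vanish. -/
lemma HasContinuation.lower_upper {a b c : ℝ} (h : HasContinuation (a + 1) b c)
    (hc : LowerParam (c : ℂ)) (hca : c ≠ a + 1) : HasContinuation a b c := by
  obtain ⟨f, hf, hf'⟩ := h
  refine ⟨fun z => (z * (1 - z) * deriv f z - (a + 1 - c + b * z) * f z) / (c - a - 1), ?_, ?_⟩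
  · have := hf.deriv isOpen_cutPlane
    fun_prop
  · intro z hz
    have h1 := mul_one_sub_mul_deriv_hypergeometric hc (a : ℂ) b hz
    have h2 : ((c : ℂ) - a - 1) ≠ 0 := by
      intro h0
      have : (c - a - 1 : ℝ) = 0 := by exact_mod_cast h0
      exact hca (by linarith)
    push_cast at hf'
    simp only [hf' z hz, deriv_eq_of_eq_on_ball hf' hz, h1]
    field_simp
    ring

lemma HasContinuation.lower_lower {a b c : ℝ} (h : HasContinuation a b (c + 1))
    (hc : LowerParam (c : ℂ)) : HasContinuation a b c := by
  obtain ⟨f, hf, hf'⟩ := h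
  refine ⟨fun z => f z + z * deriv f z / c, ?_, ?_⟩
  · have := hf.deriv isOpen_cutPlane
    fun_prop
  · intro z hz
    have h1 := lower_pred_hypergeometric hc (a : ℂ) b hz
    have h2 : (c : ℂ) ≠ 0 := by simpa using hc 0
    push_cast at hf'
    simp only [hf' z hz, deriv_eq_of_eq_on_ball hf' hz]
    field_simp
    linear_combination - h1

/-- Shift a and c up until 0 < a+n < c+N, where the integral applies with the numerator parameters
exchanged. Then descend in a, where a+n < c+N keeps the divisor of `lower_upper` nonzero, and
afterwards in c. -/
lemma hasContinuation (a b : ℝ) {c : ℝ} (hc : LowerParam (c : ℂ)) : HasContinuation a b c := by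
  obtain ⟨n, hn⟩ := exists_nat_gt (-a)
  obtain ⟨N, hN⟩ := exists_nat_gt (a + n - c)
  have hupper : ∀ j : ℕ, j ≤ n → HasContinuation (a + n - j) b (c + N) := by
    intro j
    induction j with
    | zero =>
      intro _
      refine (hasContinuation_of_pos_of_lt ?_ ?_ b).symm <;> simp <;> linarith
    | succ j ih =>
      intro hj
      have h1 := ih (by omega)
      push_cast
      have e : a + n - j = (a + n - (j + 1)) + 1 := by ring
      rw [e] at h1
      refine h1.lower_upper ?_ ?_
      · exact_mod_cast hc.add_nat N
      · have := j.cast_nonneg (α := ℝ)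
        linarith
  have hlower : ∀ j : ℕ, j ≤ N → HasContinuation a b (c + N - j) := by
    intro j
    induction j with
    | zero => intro _; simpa using hupper n le_rfl
    | succ j ih =>
      intro hj
      have h1 := ih (by omega)
      have e : c + N - j = (c + N - (j + 1 : ℕ)) + 1 := by push_cast; ring
      rw [e] at h1
      refine h1.lower_lower ?_
      have := hc.add_nat (N - (j + 1))
      rw [Nat.cast_sub hj] at this
      convert this using 1
      push_cast; ring
  simpa using hlower N le_rfl

/-! ### The continued function and its differential equations -/

open Classical in
/-- The analytic continuation of the Gauss function to `cutPlane`. -/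
noncomputable def gaussCont (a b c : ℝ) : ℂ → ℂ :=
  if h : HasContinuation a b c then h.choose else 0

lemma gaussF_eq_gaussCont (a b c x : ℝ) : gaussF a b c x = gaussCont a b c x := by
  unfold gaussF gaussCont HasContinuation
  split_ifs <;> rfl

lemma differentiableOn_gaussCont (a b : ℝ) {c : ℝ} (hc : LowerParam (c : ℂ)) :
    DifferentiableOn ℂ (gaussCont a b c) cutPlane := by
  rw [gaussCont, dif_pos (hasContinuation a b hc)]
  exact (hasContinuation a b hc).choose_spec.1

lemma gaussCont_eq (a b : ℝ) {c : ℝ} (hc : LowerParam (c : ℂ)) {z : ℂ} (hz : ‖z‖ < 1) :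
    gaussCont a b c z = ordinaryHypergeometric (a : ℂ) (b : ℂ) (c : ℂ) z := by
  rw [gaussCont, dif_pos (hasContinuation a b hc)]
  exact (hasContinuation a b hc).choose_spec.2 z hz

lemma gaussCont_zero (a b : ℝ) {c : ℝ} (hc : LowerParam (c : ℂ)) : gaussCont a b c 0 = 1 := by
  rw [gaussCont_eq a b hc (by simp), ordinaryHypergeometric_zero]

/-- Identity theorem: power-series relations on the disc persist on all of `cutPlane`, in particular
at real arguments beyond 1. -/
lemma eq_on_cutPlane {f g : ℂ → ℂ} (hf : DifferentiableOn ℂ f cutPlane)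
    (hg : DifferentiableOn ℂ g cutPlane) (h : ∀ z : ℂ, ‖z‖ < 1 → f z = g z) :
    ∀ z ∈ cutPlane, f z = g z := by
  refine (hf.analyticOnNhd isOpen_cutPlane).eqOn_of_preconnected_of_eventuallyEq
    (hg.analyticOnNhd isOpen_cutPlane) isPreconnected_cutPlane
    (mem_cutPlane_of_norm_lt (z := 0) (by simp)) ?_
  filter_upwards [Metric.ball_mem_nhds (0 : ℂ) one_pos] with w hw using h w (by simpa using hw)

lemma mul_deriv_gaussCont (a b : ℝ) {c : ℝ} (hc : LowerParam (c : ℂ)) :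
    ∀ z ∈ cutPlane, z * deriv (gaussCont a b c) z =
      a * (gaussCont (a + 1) b c z - gaussCont a b c z) := by
  have h1 := differentiableOn_gaussCont a b hc
  have h2 := differentiableOn_gaussCont (a + 1) b hc
  have h3 := h1.deriv isOpen_cutPlane
  refine eq_on_cutPlane (by fun_prop) (by fun_prop) fun z hz => ?_
  rw [deriv_eq_of_eq_on_ball (fun z hz => gaussCont_eq a b hc hz) hz, gaussCont_eq _ _ hc hz,
    gaussCont_eq _ _ hc hz, mul_deriv_hypergeometric _ _ _ hz]
  push_cast; rfl

lemma mul_one_sub_mul_deriv_gaussCont (a b : ℝ) {c : ℝ} (hc : LowerParam (c : ℂ)) :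
    ∀ z ∈ cutPlane, z * (1 - z) * deriv (gaussCont (a + 1) b c) z =
      (c - a - 1) * gaussCont a b c z + (a + 1 - c + b * z) * gaussCont (a + 1) b c z := by
  have h1 := differentiableOn_gaussCont a b hc
  have h2 := differentiableOn_gaussCont (a + 1) b hc
  have h3 := h2.deriv isOpen_cutPlane
  refine eq_on_cutPlane (by fun_prop) (by fun_prop) fun z hz => ?_
  rw [deriv_eq_of_eq_on_ball (fun z hz => gaussCont_eq (a + 1) b hc hz) hz, gaussCont_eq _ _ hc hz,
    gaussCont_eq _ _ hc hz]
  push_cast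
  rw [mul_one_sub_mul_deriv_hypergeometric hc _ _ hz]

/-! ### Wronskian of the two solutions at infinity -/

/-- Up to a factor, the Wronskian of `y^(-a) F(a, a-c+1; a-b+1; 1/y)` and
`y^(-b) F(b, b-c+1; b-a+1; 1/y)` at `z = 1/y`. -/
noncomputable def wronskian (a b c : ℝ) (z : ℂ) : ℂ :=
  a * gaussCont (a + 1) (a - c + 1) (a - b + 1) z * gaussCont b (b - c + 1) (b - a + 1) z
    - b * gaussCont a (a - c + 1) (a - b + 1) z * gaussCont (b + 1) (b - c + 1) (b - a + 1) z

lemma differentiableOn_wronskian {a b c : ℝ} (hab : LowerParam ((a - b + 1 : ℝ) : ℂ))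
    (hba : LowerParam ((b - a + 1 : ℝ) : ℂ)) : DifferentiableOn ℂ (wronskian a b c) cutPlane := by
  have h1 := differentiableOn_gaussCont a (a - c + 1) hab
  have h2 := differentiableOn_gaussCont (a + 1) (a - c + 1) hab
  have h3 := differentiableOn_gaussCont b (b - c + 1) hba
  have h4 := differentiableOn_gaussCont (b + 1) (b - c + 1) hba
  unfold wronskian
  fun_prop

/-- Abel's identity. The contiguous relations carry a factor z, so they give it for z ≠ 0 and
continuity supplies z = 0. -/
lemma deriv_wronskian {a b c : ℝ} (hab : LowerParam ((a - b + 1 : ℝ) : ℂ))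
    (hba : LowerParam ((b - a + 1 : ℝ) : ℂ)) :
    ∀ z ∈ cutPlane, (1 - z) * deriv (wronskian a b c) z = (a + b - c + 1) * wronskian a b c z := by
  have hd := differentiableOn_wronskian (c := c) hab hba
  have hd' := hd.deriv isOpen_cutPlane
  have key : ∀ z ∈ cutPlane, z ≠ 0 →
      (1 - z) * deriv (wronskian a b c) z = (a + b - c + 1) * wronskian a b c z := by
    intro z hz hz0
    have hn := isOpen_cutPlane.mem_nhds hz
    have h1 := ((differentiableOn_gaussCont a (a - c + 1) hab).differentiableAt hn).hasDerivAt
    have h2 := ((differentiableOn_gaussCont (a + 1) (a - c + 1) hab).differentiableAt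
      hn).hasDerivAt
    have h3 := ((differentiableOn_gaussCont b (b - c + 1) hba).differentiableAt hn).hasDerivAt
    have h4 := ((differentiableOn_gaussCont (b + 1) (b - c + 1) hba).differentiableAt
      hn).hasDerivAt
    have hw : HasDerivAt (wronskian a b c) _ z :=
      (((h2.const_mul (a : ℂ)).mul h3)).sub ((h1.const_mul (b : ℂ)).mul h4)
    rw [hw.deriv]
    have e1 := mul_deriv_gaussCont a (a - c + 1) hab z hz
    have e2 := mul_one_sub_mul_deriv_gaussCont a (a - c + 1) hab z hz
    have e3 := mul_deriv_gaussCont b (b - c + 1) hba z hz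
    have e4 := mul_one_sub_mul_deriv_gaussCont b (b - c + 1) hba z hz
    apply mul_left_cancel₀ hz0
    unfold wronskian
    push_cast at e1 e2 e3 e4 ⊢
    set A := gaussCont a (a - c + 1) (a - b + 1) z
    set A1 := gaussCont (a + 1) (a - c + 1) (a - b + 1) z
    set B := gaussCont b (b - c + 1) (b - a + 1) z
    set B1 := gaussCont (b + 1) (b - c + 1) (b - a + 1) z
    linear_combination a * B * e2 + (1 - z) * a * A1 * e3 - (1 - z) * b * B1 * e1 - b * A * e4
  intro z hz
  by_cases hz0 : z = 0
  · subst hz0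
    have hn := isOpen_cutPlane.mem_nhds hz
    have c1 : ContinuousAt (fun z => (1 - z) * deriv (wronskian a b c) z) 0 := by
      have := (hd'.differentiableAt hn).continuousAt
      fun_prop
    have c2 : ContinuousAt (fun z => (a + b - c + 1) * wronskian a b c z) 0 := by
      have := (hd.differentiableAt hn).continuousAt
      fun_prop
    refine tendsto_nhds_unique_of_eventuallyEq (c1.tendsto.mono_left nhdsWithin_le_nhds)
      (c2.tendsto.mono_left (nhdsWithin_le_nhds (s := {0}ᶜ))) ?_
    filter_upwards [mem_nhdsWithin_of_mem_nhds hn, self_mem_nhdsWithin] with w hw hw0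
      using key w hw hw0
  · exact key z hz hz0

/-- By Abel's identity `wronskian` times (i(z-1))^(a+b-c+1) is constant on the connected set
`cutPlane`, and `wronskian` equals a - b at 0. -/
lemma wronskian_ne_zero {a b c : ℝ} (hne : a ≠ b) (hab : LowerParam ((a - b + 1 : ℝ) : ℂ))
    (hba : LowerParam ((b - a + 1 : ℝ) : ℂ)) : ∀ z ∈ cutPlane, wronskian a b c z ≠ 0 := by
  intro z hz
  have h0 : (0 : ℂ) ∈ cutPlane := mem_cutPlane_of_norm_lt (by simp)
  have hd := differentiableOn_wronskian (c := c) hab hba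
  have hder : ∀ w ∈ cutPlane, HasDerivAt (fun w => wronskian a b c w *
      (Complex.I * (w - 1)) ^ (a + b - c + 1 : ℂ)) 0 w := by
    intro w hw
    have hs := I_mul_sub_one_mem_slitPlane hw
    have h1 := (hd.differentiableAt (isOpen_cutPlane.mem_nhds hw)).hasDerivAt
    have h2 : HasDerivAt (fun z => Complex.I * (z - 1)) Complex.I w := by
      simpa using ((hasDerivAt_id w).sub_const 1).const_mul Complex.I
    refine (h1.mul (h2.cpow_const (c := (a + b - c + 1 : ℂ)) hs)).congr_deriv ?_
    have hne0 := Complex.slitPlane_ne_zero hs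
    have hw1 : w - 1 ≠ 0 := (mul_ne_zero_iff.1 hne0).2
    have e := deriv_wronskian (c := c) hab hba w hw
    rw [Complex.cpow_sub _ _ hne0, Complex.cpow_one]
    have e' : deriv (wronskian a b c) w = -((a + b - c + 1) * wronskian a b c w) / (w - 1) := by
      rw [eq_div_iff hw1, ← e]; ring
    rw [e']
    field_simp
    ring
  have hconst := isOpen_cutPlane.is_const_of_deriv_eq_zero isPreconnected_cutPlane
    (fun w hw => (hder w hw).differentiableAt.differentiableWithinAt)
    (fun w hw => (hder w hw).deriv) hz h0
  intro hw
  simp only [hw, zero_mul] at hconst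
  have hI : (Complex.I * (0 - 1)) ^ (a + b - c + 1 : ℂ) ≠ 0 := by
    rw [Ne, Complex.cpow_eq_zero_iff]
    simp
  rcases mul_eq_zero.1 hconst.symm with h | h
  · simp only [wronskian, gaussCont_zero _ _ hab, gaussCont_zero _ _ hba, mul_one] at h
    exact hne (by exact_mod_cast sub_eq_zero.1 h)
  · exact hI h

/-! ### The solutions at infinity as functions of a real variable -/

/-- `y^(-a) F(a, a-c+1; a-b+1; 1/y)`. -/
noncomputable def sol (a b c y : ℝ) : ℂ :=
  (y : ℂ) ^ (-a : ℂ) * gaussF a (a - c + 1) (a - b + 1) y⁻¹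

/-- `-y` times the derivative of `sol`. -/
noncomputable def solFlux (a b c y : ℝ) : ℂ :=
  a * ((y : ℂ) ^ (-a : ℂ) * gaussF (a + 1) (a - c + 1) (a - b + 1) y⁻¹)

/-- Negative y lie on the branch cut, but along the real line the principal power is (-y)^s e^(iπs),
which is differentiable. -/
lemma hasDerivAt_ofReal_cpow_const' {y : ℝ} (hy : y ≠ 0) (s : ℂ) :
    HasDerivAt (fun y : ℝ => (y : ℂ) ^ s) (s * (y : ℂ) ^ s / y) y := by
  have hyc : (y : ℂ) ≠ 0 := by exact_mod_cast hy
  rcases lt_or_gt_of_ne hy with h | h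
  · have h1 : HasDerivAt (fun y : ℝ => (-(y : ℂ)) ^ s * Complex.exp (Real.pi * Complex.I * s))
        (s * (-(y : ℂ)) ^ (s - 1) * (-1) * Complex.exp (Real.pi * Complex.I * s)) y := by
      have hs : (-(y : ℂ)) ∈ Complex.slitPlane := by
        rw [Complex.mem_slitPlane_iff]; left; simpa using h
      have := ((hasDerivAt_id (y : ℂ)).neg.cpow_const (c := s) hs).comp_ofReal
      exact this.mul_const _
    refine (h1.congr_of_eventuallyEq ?_).congr_deriv ?_
    · filter_upwards [Iio_mem_nhds h] with x hx
      exact Complex.ofReal_cpow_of_nonpos (le_of_lt hx) s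
    · rw [Complex.ofReal_cpow_of_nonpos h.le, Complex.cpow_sub _ _ (neg_ne_zero.2 hyc),
        Complex.cpow_one]
      field_simp
  · have hs : (y : ℂ) ∈ Complex.slitPlane := by
      rw [Complex.mem_slitPlane_iff]; left; simpa using h
    refine (((hasDerivAt_id (y : ℂ)).cpow_const (c := s) hs).comp_ofReal).congr_deriv ?_
    simp only [id]
    rw [Complex.cpow_sub _ _ hyc, Complex.cpow_one]
    field_simp

lemma hasDerivAt_gaussF_inv (a b : ℝ) {c : ℝ} (hc : LowerParam (c : ℂ)) {y : ℝ} (hy : y ≠ 0)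
    (hy1 : y ≠ 1) : HasDerivAt (fun y : ℝ => gaussF a b c y⁻¹)
      (-(deriv (gaussCont a b c) ((y⁻¹ : ℝ) : ℂ)) / y ^ 2) y := by
  have hm : ((y⁻¹ : ℝ) : ℂ) ∈ cutPlane := ofReal_mem_cutPlane (by simpa using hy1)
  have h1 := ((differentiableOn_gaussCont a b hc).differentiableAt
    (isOpen_cutPlane.mem_nhds hm)).hasDerivAt
  have h2 := (hasDerivAt_inv hy).ofReal_comp
  have h3 := HasDerivAt.scomp y h1 h2
  refine (h3.congr_of_eventuallyEq (Eventually.of_forall fun x =>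
    gaussF_eq_gaussCont _ _ _ _)).congr_deriv ?_
  push_cast
  rw [smul_eq_mul]
  field_simp

lemma hasDerivAt_sol {a b : ℝ} (c : ℝ) (hab : LowerParam ((a - b + 1 : ℝ) : ℂ)) {y : ℝ}
    (hy : y ≠ 0) (hy1 : y ≠ 1) :
    HasDerivAt (sol a b c) (-solFlux a b c y / y) y := by
  have hyc : (y : ℂ) ≠ 0 := by exact_mod_cast hy
  have hm : ((y⁻¹ : ℝ) : ℂ) ∈ cutPlane := ofReal_mem_cutPlane (by simpa using hy1)
  refine ((hasDerivAt_ofReal_cpow_const' hy (-a : ℂ)).mul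
    (hasDerivAt_gaussF_inv a (a - c + 1) hab hy hy1)).congr_deriv ?_
  have e := mul_deriv_gaussCont a (a - c + 1) hab _ hm
  rw [solFlux, gaussF_eq_gaussCont, gaussF_eq_gaussCont]
  push_cast at e ⊢
  have e' : deriv (gaussCont a (a - c + 1) (a - b + 1)) (y : ℂ)⁻¹ = y * (a *
      (gaussCont (a + 1) (a - c + 1) (a - b + 1) (y : ℂ)⁻¹
        - gaussCont a (a - c + 1) (a - b + 1) (y : ℂ)⁻¹)) := by
    rw [← e]; field_simp
  rw [e']
  field_simp
  ring

lemma hasDerivAt_solFlux {a b : ℝ} (c : ℝ) (hab : LowerParam ((a - b + 1 : ℝ) : ℂ)) {y : ℝ}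
    (hy : y ≠ 0) (hy1 : y ≠ 1) :
    HasDerivAt (solFlux a b c)
      ((a * b * sol a b c y - (a + b + (1 - c) / y) * solFlux a b c y) / (y - 1)) y := by
  have hyc : (y : ℂ) ≠ 0 := by exact_mod_cast hy
  have hyc1 : (y : ℂ) - 1 ≠ 0 := by rw [sub_ne_zero]; exact_mod_cast hy1
  have hm : ((y⁻¹ : ℝ) : ℂ) ∈ cutPlane := ofReal_mem_cutPlane (by simpa using hy1)
  refine (((hasDerivAt_ofReal_cpow_const' hy (-a : ℂ)).mul
    (hasDerivAt_gaussF_inv (a + 1) (a - c + 1) hab hy hy1)).const_mul (a : ℂ)).congr_deriv ?_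
  have e := mul_one_sub_mul_deriv_gaussCont a (a - c + 1) hab _ hm
  rw [solFlux, sol, gaussF_eq_gaussCont, gaussF_eq_gaussCont]
  push_cast at e ⊢
  set A := gaussCont a (a - c + 1) (a - b + 1) (y : ℂ)⁻¹
  set A1 := gaussCont (a + 1) (a - c + 1) (a - b + 1) (y : ℂ)⁻¹
  have e' : deriv (gaussCont (a + 1) (a - c + 1) (a - b + 1)) (y : ℂ)⁻¹ = y ^ 2 / (y - 1) *
      (((a - b + 1 : ℂ) - a - 1) * A + (a + 1 - (a - b + 1) + (a - c + 1) * (y : ℂ)⁻¹) * A1) := by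
    rw [← e]; field_simp
  rw [e']
  field_simp
  ring

/-! ### Linear systems on one affine piece of the drift -/

/-- The integro-differential equation turned into a linear system on an interval where the drift
is `s (x - ζ)`; here `p = -x u'`. -/
structure IsPieceSol (lam alpha δ s ζ : ℝ) (S : Set ℝ) (u p : ℝ → ℂ) : Prop where
  deriv_u : ∀ x ∈ S, HasDerivAt u (-p x / x) x
  deriv_p : ∀ x ∈ S, HasDerivAt p
    ((-(alpha * δ) * u x + (δ + lam - alpha * s - s * (1 - alpha) * ζ / x) * p x)
      / (s * (x - ζ))) x

lemma IsPieceSol.comb {lam alpha δ s ζ : ℝ} {S : Set ℝ} {u p v q : ℝ → ℂ}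
    (h₁ : IsPieceSol lam alpha δ s ζ S u p) (h₂ : IsPieceSol lam alpha δ s ζ S v q) (k l : ℂ) :
    IsPieceSol lam alpha δ s ζ S (fun x => k * u x + l * v x) (fun x => k * p x + l * q x) where
  deriv_u x hx := (((h₁.deriv_u x hx).const_mul k).add
    ((h₂.deriv_u x hx).const_mul l)).congr_deriv (by ring)
  deriv_p x hx := (((h₁.deriv_p x hx).const_mul k).add
    ((h₂.deriv_p x hx).const_mul l)).congr_deriv (by ring)

/-- Rescaling by ζ moves the zero of the drift to the singular point y = 1 of Gauss's equation; the
sum and product of the exponents match the coefficients of the system. -/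
lemma isPieceSol_sol {lam alpha δ s ζ a b : ℝ} {S : Set ℝ} (hs : s ≠ 0) (hζ : ζ ≠ 0)
    (hS : ∀ x ∈ S, x ≠ 0 ∧ x ≠ ζ) (hab : LowerParam ((a - b + 1 : ℝ) : ℂ))
    (hprod : s * (a * b) = -(alpha * δ)) (hsum : s * (a + b) = -(δ + lam - alpha * s)) :
    IsPieceSol lam alpha δ s ζ S (fun x => sol a b alpha (x / ζ))
      (fun x => solFlux a b alpha (x / ζ)) := by
  have hd : ∀ x : ℝ, HasDerivAt (fun x : ℝ => x / ζ) (1 / ζ) x := fun x =>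
    (hasDerivAt_id x).div_const ζ
  have hζc : (ζ : ℂ) ≠ 0 := by exact_mod_cast hζ
  have hsc : (s : ℂ) ≠ 0 := by exact_mod_cast hs
  have hprodc : (s : ℂ) * (a * b) = -(alpha * δ) := by exact_mod_cast hprod
  have hsumc : (s : ℂ) * (a + b) = -(δ + lam - alpha * s) := by exact_mod_cast hsum
  refine ⟨fun x hx => ?_, fun x hx => ?_⟩
  · obtain ⟨h0, h1⟩ := hS x hx
    have hxc : (x : ℂ) ≠ 0 := by exact_mod_cast h0
    refine ((hasDerivAt_sol alpha hab (y := x / ζ) (div_ne_zero h0 hζ)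
      (by rwa [Ne, div_eq_one_iff_eq hζ])).scomp x (hd x)).congr_deriv ?_
    rw [Complex.real_smul]; push_cast; field_simp
  · obtain ⟨h0, h1⟩ := hS x hx
    have hxc : (x : ℂ) ≠ 0 := by exact_mod_cast h0
    have hx1 : (x : ℂ) - ζ ≠ 0 := by rw [sub_ne_zero]; exact_mod_cast h1
    have hx2 : (x : ℂ) / ζ - 1 ≠ 0 := by
      rw [sub_ne_zero, Ne, div_eq_one_iff_eq hζc]; exact_mod_cast h1
    refine ((hasDerivAt_solFlux alpha hab (y := x / ζ) (div_ne_zero h0 hζ)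
      (by rwa [Ne, div_eq_one_iff_eq hζ])).scomp x (hd x)).congr_deriv ?_
    rw [Complex.real_smul]; push_cast
    have e1 : (a : ℂ) * b = -(alpha * δ) / s := by rw [← hprodc]; field_simp
    have e2 : (a : ℂ) + b = -(δ + lam - alpha * s) / s := by rw [← hsumc]; field_simp
    rw [e1, e2]
    field_simp
    ring

/-- This reverses the passage from the integral equation to the ODE: the differentiated function is
x^α (drift·u' - (λ+δ)u), which the model equates to -λ times the beta-weighted integral. -/
lemma IsPieceSol.hasDerivAt_flux {lam alpha δ s ζ : ℝ} {S : Set ℝ} {u p : ℝ → ℂ}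
    (h : IsPieceSol lam alpha δ s ζ S u p) (hs : s ≠ 0) {x : ℝ} (hxS : x ∈ S) (hx : 0 < x)
    (hxζ : x ≠ ζ) :
    HasDerivAt (fun x : ℝ => ((x ^ alpha : ℝ) : ℂ) * (-(s * (x - ζ) / x * p x) - (lam + δ) * u x))
      (-(lam * alpha * ((x ^ (alpha - 1) : ℝ) : ℂ) * u x)) x := by
  have hxc : (x : ℂ) ≠ 0 := by exact_mod_cast hx.ne'
  have hx1 : (x : ℂ) - ζ ≠ 0 := by rw [sub_ne_zero]; exact_mod_cast hxζ
  have hsc : (s : ℂ) ≠ 0 := by exact_mod_cast hs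
  have h1 := (Real.hasDerivAt_rpow_const (p := alpha) (Or.inl hx.ne')).ofReal_comp
  have hid : HasDerivAt (fun x : ℝ => (x : ℂ)) 1 x := Complex.ofRealCLM.hasDerivAt
  have h2 := ((hid.sub_const (ζ : ℂ)).const_mul (s : ℂ)).div hid hxc
  have h3 := (h2.mul (h.deriv_p x hxS)).neg.sub ((h.deriv_u x hxS).const_mul (lam + δ : ℂ))
  refine (h1.mul h3).congr_deriv ?_
  have e : x ^ alpha = x ^ (alpha - 1) * x := by rw [Real.rpow_sub_one hx.ne']; field_simp
  rw [e]
  simp only [Pi.div_apply, Pi.mul_apply, Pi.neg_apply, Pi.sub_apply]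
  push_cast
  field_simp
  ring

/-- Both sides share the derivative d at the junction, so one-sided derivatives combine into a
two-sided one. -/
lemma hasDerivAt_glue {E : Type*} [NormedAddCommGroup E] [NormedSpace ℝ E] {g k : ℝ → E} {d : E}
    {t t₀ : ℝ} (hg : t ≤ t₀ → HasDerivAt g d t) (hk : t₀ ≤ t → HasDerivAt k d t)
    (h₀ : g t₀ = k t₀) : HasDerivAt (fun t => if t₀ ≤ t then k t else g t) d t := by
  rcases lt_trichotomy t t₀ with h | h | h
  · refine (hg h.le).congr_of_eventuallyEq ?_
    filter_upwards [Iio_mem_nhds h] with x hx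
    rw [if_neg (not_le.2 hx)]
  · subst h
    rw [← hasDerivWithinAt_univ, ← Set.Iic_union_Ici (a := t)]
    refine HasDerivWithinAt.union ?_ ?_
    · refine (hg le_rfl).hasDerivWithinAt.congr (fun x hx => ?_) (by simp [h₀])
      have hx' : x ≤ t := hx
      rcases eq_or_lt_of_le hx' with h | h
      · subst h; simp [h₀]
      · rw [if_neg (not_le.2 h)]
    · exact (hk le_rfl).hasDerivWithinAt.congr (fun x hx => if_pos hx) (by simp)
  · refine (hk h.le).congr_of_eventuallyEq ?_
    filter_upwards [Ioi_mem_nhds h] with x hx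
    rw [if_pos (le_of_lt hx)]

namespace Model

/-- The standing assumptions on the data of the model. -/
structure Admissible (M : Model) : Prop where
  hr : 0 < M.r
  hcT : 0 < M.cT
  hxs : 0 < M.xs
  hB : M.xs < M.B
  hlam : 0 < M.lam
  halpha : 0 < M.alpha
  hrc : M.r ≠ M.cT
  hxss : M.cT * M.B ≠ M.r * M.xs

variable {M : Model}

/-! ### The flow between losses -/

lemma drift_of_ge (hM : M.Admissible) {x : ℝ} (hx : M.B ≤ x) : M.drift x = M.r * (x - M.xs) := by
  have := hM.hB
  rw [drift, max_eq_left (by linarith), max_eq_right (by linarith)]; ring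

lemma Admissible.sub_ne_zero (hM : M.Admissible) : M.r - M.cT ≠ 0 := by
  have := hM.hrc
  intro h; apply this; linarith

/-- The point -x** is the zero of this affine branch, which is why y_l(x) = x/(-x**) is the variable
below B. -/
lemma drift_of_mem_Icc (hM : M.Admissible) {x : ℝ} (hx : M.xs ≤ x) (hx' : x ≤ M.B) :
    M.drift x = (M.r - M.cT) * (x - -M.xss) := by
  have := hM.sub_ne_zero
  rw [drift, max_eq_left (by linarith), max_eq_left (by linarith), xss]
  field_simp
  ring

lemma drift_nonneg (hM : M.Admissible) (x : ℝ) : 0 ≤ M.drift x := by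
  have := hM.hr; have := hM.hcT
  rw [drift]; positivity

lemma drift_pos (hM : M.Admissible) {x : ℝ} (hx : M.xs ≤ x) : 0 < M.drift x := by
  have := hM.hr; have := hM.hcT
  rcases lt_or_ge x M.B with h | h
  · have h1 : 0 ≤ M.r * max (x - M.xs) 0 := by positivity
    have h2 : 0 < M.cT * max (M.B - x) 0 := by
      have : 0 < max (M.B - x) 0 := lt_max_of_lt_left (by linarith)
      positivity
    rw [drift]; linarith
  · rw [drift_of_ge hM h]
    have := hM.hB
    have : 0 < x - M.xs := by linarith
    positivity

lemma lipschitzWith_drift (hM : M.Admissible) :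
    LipschitzWith (Real.toNNReal (M.r + M.cT)) M.drift := by
  have := hM.hr; have := hM.hcT
  refine LipschitzWith.of_dist_le_mul fun x y => ?_
  rw [Real.dist_eq, Real.dist_eq, Real.coe_toNNReal _ (by linarith)]
  have h1 : |max (x - M.xs) 0 - max (y - M.xs) 0| ≤ |x - y| := by
    simpa using abs_max_sub_max_le_abs (x - M.xs) (y - M.xs) 0
  have h2 : |max (M.B - x) 0 - max (M.B - y) 0| ≤ |x - y| := by
    have := abs_max_sub_max_le_abs (M.B - x) (M.B - y) 0
    rwa [show M.B - x - (M.B - y) = -(x - y) by ring, abs_neg] at this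
  have e : M.drift x - M.drift y = M.r * (max (x - M.xs) 0 - max (y - M.xs) 0)
      + M.cT * (max (M.B - x) 0 - max (M.B - y) 0) := by
    rw [drift, drift]; ring
  rw [e]
  refine (abs_add_le _ _).trans ?_
  rw [abs_mul, abs_mul, abs_of_pos hM.hr, abs_of_pos hM.hcT, add_mul]
  gcongr

lemma exists_trajectory_of_ge (hM : M.Admissible) {x : ℝ} (hx : M.B ≤ x) (t₀ : ℝ) :
    ∀ t, t₀ ≤ t → M.B ≤ M.xs + (x - M.xs) * Real.exp (M.r * (t - t₀)) ∧
      HasDerivAt (fun t => M.xs + (x - M.xs) * Real.exp (M.r * (t - t₀)))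
        (M.drift (M.xs + (x - M.xs) * Real.exp (M.r * (t - t₀)))) t := by
  intro t ht
  have hB := hM.hB
  have hge : M.B ≤ M.xs + (x - M.xs) * Real.exp (M.r * (t - t₀)) := by
    have h1 : 1 ≤ Real.exp (M.r * (t - t₀)) :=
      Real.one_le_exp (mul_nonneg hM.hr.le (by linarith))
    nlinarith
  refine ⟨hge, ?_⟩
  rw [drift_of_ge hM hge]
  have h1 : HasDerivAt (fun t => M.r * (t - t₀)) M.r t := by
    simpa using ((hasDerivAt_id t).sub_const t₀).const_mul M.r
  refine ((h1.exp.const_mul (x - M.xs)).const_add M.xs).congr_deriv ?_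
  ring

/-- Explicit solution: the distance to -x** grows or decays exponentially until the capital reaches
B, after which the distance to x* grows at rate r. -/
lemma exists_isTrajectory (hM : M.Admissible) {x : ℝ} (hx : M.xs ≤ x) :
    ∃ f, M.IsTrajectory x f := by
  rcases le_or_gt M.B x with h | h
  · refine ⟨fun t => M.xs + (x - M.xs) * Real.exp (M.r * (t - 0)), by simp, fun t ht => ?_⟩
    exact (exists_trajectory_of_ge hM h 0 t ht).2.hasDerivWithinAt
  · have hs := hM.sub_ne_zero
    set s := M.r - M.cT with hs_def
    have hxp : 0 < s * (x - -M.xss) := by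
      rw [← drift_of_mem_Icc hM hx h.le]; exact drift_pos hM hx
    have hBp : 0 < s * (M.B - -M.xss) := by
      rw [← drift_of_mem_Icc hM hM.hB.le le_rfl]; exact drift_pos hM hM.hB.le
    have hx0 : x - -M.xss ≠ 0 := (mul_ne_zero_iff.1 hxp.ne').2
    -- The factor by which the distance to -x** must change for the capital to reach B. It is
    -- positive for either sign of s, being a quotient of two drift values.
    set q := (M.B - -M.xss) / (x - -M.xss) with hq
    have hqp : 0 < q := by
      have : q = (s * (M.B - -M.xss)) / (s * (x - -M.xss)) := by rw [hq]; field_simp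
      rw [this]; positivity
    set t₀ := Real.log q / s with ht₀
    set g : ℝ → ℝ := fun t => (x - -M.xss) * Real.exp (s * t) + -M.xss with hg
    have hg0 : g t₀ = M.B := by
      simp only [hg, ht₀]
      rw [mul_div_cancel₀ _ hs, Real.exp_log hqp, hq]
      field_simp
      ring
    have hgd : ∀ t, HasDerivAt g (s * (g t - -M.xss)) t := by
      intro t
      have h1 : HasDerivAt (fun t => s * t) s t := by
        simpa using (hasDerivAt_id t).const_mul s
      refine ((h1.exp.const_mul (x - -M.xss)).add_const (-M.xss)).congr_deriv ?_
      simp only [hg]; ring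
    have hgm : StrictMono g := by
      refine strictMono_of_hasDerivAt_pos hgd fun t => ?_
      have : s * (g t - -M.xss) = s * (x - -M.xss) * Real.exp (s * t) := by
        simp only [hg]; ring
      rw [this]; positivity
    have hg00 : g 0 = x := by simp [hg]
    have ht0 : 0 < t₀ := by
      rw [← hgm.lt_iff_lt, hg0, hg00]; exact h
    refine ⟨fun t => if t₀ ≤ t then M.xs + (M.B - M.xs) * Real.exp (M.r * (t - t₀)) else g t,
      ?_, fun t ht => ?_⟩
    · simp only [if_neg (not_le.2 ht0), hg00]
    · refine HasDerivAt.hasDerivWithinAt (hasDerivAt_glue ?_ ?_ (by simp [hg0]))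
      · intro ht'
        have e1 : M.xs ≤ g t := by
          have := hgm.monotone ht
          rw [hg00] at this; linarith
        have e2 : g t ≤ M.B := by rw [← hg0]; exact hgm.monotone ht'
        have e3 : (if t₀ ≤ t then M.xs + (M.B - M.xs) * Real.exp (M.r * (t - t₀)) else g t)
            = g t := by
          split_ifs with h'
          · obtain rfl : t = t₀ := le_antisymm ht' h'
            rw [hg0]; simp
          · rfl
        beta_reduce
        rw [e3, drift_of_mem_Icc hM e1 e2]
        exact hgd t
      · intro ht'
        simp only [if_pos ht']
        exact (exists_trajectory_of_ge hM le_rfl t₀ t ht').2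

lemma flow_isTrajectory (hM : M.Admissible) {x : ℝ} (hx : M.xs ≤ x) :
    M.IsTrajectory x (M.flow x) := by
  have h := exists_isTrajectory hM hx
  have e : M.flow x = h.choose := by
    funext t; rw [flow, dif_pos h]
  rw [e]; exact h.choose_spec

lemma flow_zero_of_ge (hM : M.Admissible) {x : ℝ} (hx : M.xs ≤ x) : M.flow x 0 = x :=
  (flow_isTrajectory hM hx).1

/-- No trajectory from below x* has to be constructed: the default value 0 of `flow` is itself below
x*. -/
lemma flow_zero_lt (hM : M.Admissible) {x : ℝ} (hx : x < M.xs) : M.flow x 0 < M.xs := by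
  rw [flow]
  split_ifs with h
  · rw [h.choose_spec.1]; exact hx
  · exact hM.hxs

lemma continuousOn_flow (hM : M.Admissible) {x : ℝ} (hx : M.xs ≤ x) :
    ContinuousOn (M.flow x) (Set.Ici 0) := fun t ht =>
  ((flow_isTrajectory hM hx).2 t ht).continuousWithinAt

lemma hasDerivAt_flow (hM : M.Admissible) {x : ℝ} (hx : M.xs ≤ x) {t : ℝ} (ht : 0 < t) :
    HasDerivAt (M.flow x) (M.drift (M.flow x t)) t :=
  ((flow_isTrajectory hM hx).2 t ht.le).hasDerivAt (Ici_mem_nhds ht)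

lemma monotoneOn_flow (hM : M.Admissible) {x : ℝ} (hx : M.xs ≤ x) :
    MonotoneOn (M.flow x) (Set.Ici 0) := by
  refine monotoneOn_of_deriv_nonneg (convex_Ici 0) (continuousOn_flow hM hx) ?_ ?_
  · intro t ht
    rw [interior_Ici] at ht
    exact (hasDerivAt_flow hM hx ht).differentiableAt.differentiableWithinAt
  · intro t ht
    rw [interior_Ici] at ht
    rw [(hasDerivAt_flow hM hx ht).deriv]
    exact drift_nonneg hM _

lemma le_flow (hM : M.Admissible) {x : ℝ} (hx : M.xs ≤ x) {t : ℝ} (ht : 0 ≤ t) :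
    x ≤ M.flow x t := by
  have := monotoneOn_flow hM hx (Set.self_mem_Ici) ht ht
  rwa [flow_zero_of_ge hM hx] at this

lemma dist_flow_le (hM : M.Admissible) {x y : ℝ} (hx : M.xs ≤ x) (hy : M.xs ≤ y) {t : ℝ}
    (ht : 0 ≤ t) : |M.flow x t - M.flow y t| ≤ |x - y| * Real.exp ((M.r + M.cT) * t) := by
  have hderiv : ∀ z, M.xs ≤ z → ∀ s ∈ Set.Ico 0 t,
      HasDerivWithinAt (M.flow z) (M.drift (M.flow z s)) (Set.Ici s) s := fun z hz s hs =>
    ((flow_isTrajectory hM hz).2 s hs.1).mono (Set.Ici_subset_Ici.2 hs.1)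
  have hcont : ∀ z, M.xs ≤ z → ContinuousOn (M.flow z) (Set.Icc 0 t) := fun z hz =>
    (continuousOn_flow hM hz).mono Set.Icc_subset_Ici_self
  have := dist_le_of_trajectories_ODE (v := fun _ => M.drift) (fun _ => lipschitzWith_drift hM)
    (hcont x hx) (hderiv x hx) (hcont y hy) (hderiv y hy) (δ := |x - y|)
    (by rw [flow_zero_of_ge hM hx, flow_zero_of_ge hM hy, Real.dist_eq]) t ⟨ht, le_rfl⟩
  have h1 := hM.hr; have h2 := hM.hcT
  rwa [Real.dist_eq, sub_zero, Real.coe_toNNReal _ (by linarith)] at this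

/-- Grönwall's bound in the starting point, uniform for bounded times, is combined with continuity
in time. -/
lemma continuousOn_flow_uncurry (hM : M.Admissible) :
    ContinuousOn (fun q : ℝ × ℝ => M.flow q.1 q.2) (Set.Ici M.xs ×ˢ Set.Ici 0) := by
  rintro ⟨y, t⟩ ⟨hy, ht⟩
  simp only [Set.mem_Ici] at hy ht
  have h1 : Tendsto (fun q : ℝ × ℝ => |q.1 - y| * Real.exp ((M.r + M.cT) * q.2))
      (𝓝[Set.Ici M.xs ×ˢ Set.Ici 0] (y, t)) (𝓝 0) := by
    have : Continuous fun q : ℝ × ℝ => |q.1 - y| * Real.exp ((M.r + M.cT) * q.2) := by fun_prop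
    have h := (this.tendsto (y, t)).mono_left (nhdsWithin_le_nhds
      (s := Set.Ici M.xs ×ˢ Set.Ici (0 : ℝ)))
    simpa using h
  have h2 : Tendsto (fun q : ℝ × ℝ => M.flow y q.2)
      (𝓝[Set.Ici M.xs ×ˢ Set.Ici 0] (y, t)) (𝓝 (M.flow y t)) := by
    refine (continuousOn_flow hM hy t ht).tendsto.comp ?_
    refine tendsto_nhdsWithin_iff.2 ⟨(continuous_snd.tendsto (y, t)).mono_left
      nhdsWithin_le_nhds, ?_⟩
    filter_upwards [self_mem_nhdsWithin] with q hq using hq.2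
  have h3 : Tendsto (fun q : ℝ × ℝ => M.flow q.1 q.2 - M.flow y q.2)
      (𝓝[Set.Ici M.xs ×ˢ Set.Ici 0] (y, t)) (𝓝 0) := by
    refine squeeze_zero_norm' ?_ h1
    filter_upwards [self_mem_nhdsWithin] with q hq
    exact dist_flow_le hM hq.1 hy hq.2
  have := h3.add h2
  simpa [ContinuousWithinAt] using this

open Classical in
/-- The flow, set to zero at capitals below `x^*` and at negative times. -/
noncomputable def liveFlow (M : Model) (q : ℝ × ℝ) : ℝ :=
  if q ∈ Set.Ici M.xs ×ˢ Set.Ici (0 : ℝ) then M.flow q.1 q.2 else 0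

lemma measurable_liveFlow (hM : M.Admissible) : Measurable M.liveFlow := by
  classical
  have hs : MeasurableSet (Set.Ici M.xs ×ˢ Set.Ici (0 : ℝ)) :=
    measurableSet_Ici.prod measurableSet_Ici
  exact (continuousOn_flow_uncurry hM).measurable_piecewise continuousOn_const hs

lemma liveFlow_of_ge {x t : ℝ} (hx : M.xs ≤ x) (ht : 0 ≤ t) : M.liveFlow (x, t) = M.flow x t :=
  if_pos ⟨hx, ht⟩

lemma liveFlow_of_lt {x : ℝ} (hx : x < M.xs) (t : ℝ) : M.liveFlow (x, t) = 0 :=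
  if_neg fun h => absurd h.1 (not_le.2 hx)

lemma exists_flow_bound (hM : M.Admissible) (R : ℝ) :
    ∃ C > 0, ∀ x, M.xs ≤ x → x ≤ R → ∀ t, 0 ≤ t → t ≤ 1 → M.flow x t ≤ C := by
  have h1 := hM.hr; have h2 := hM.hcT; have h3 := hM.hxs
  refine ⟨M.flow M.xs 1 + |R| * Real.exp (M.r + M.cT), ?_, fun x hx hxR t ht ht1 => ?_⟩
  · have := le_flow hM le_rfl zero_le_one (x := M.xs)
    have : 0 < M.flow M.xs 1 := by linarith
    positivity
  · have e1 := dist_flow_le hM hx le_rfl ht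
    have e2 := monotoneOn_flow hM le_rfl ht (zero_le_one : (0 : ℝ) ≤ 1) ht1
    have e3 : Real.exp ((M.r + M.cT) * t) ≤ Real.exp (M.r + M.cT) := by
      apply Real.exp_le_exp.2; nlinarith
    have e4 : |x - M.xs| ≤ |R| := by
      rw [abs_of_nonneg (by linarith)]
      refine le_trans ?_ (le_abs_self R); linarith
    have e5 : |x - M.xs| * Real.exp ((M.r + M.cT) * t) ≤ |R| * Real.exp (M.r + M.cT) := by gcongr
    have := (abs_le.1 e1).2
    linarith

end Model

/-! ### Integration against the exponential and the beta law -/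

lemma expMeasure_eq (lam : ℝ) :
    expMeasure lam = volume.withDensity (exponentialPDF lam) := rfl

lemma integral_expMeasure {E : Type*} [NormedAddCommGroup E] [NormedSpace ℝ E] {lam : ℝ}
    (hlam : 0 < lam) (f : ℝ → E) : ∫ t, f t ∂(expMeasure lam) =
      ∫ t in Set.Ioi 0, (lam * Real.exp (-(lam * t))) • f t := by
  have hm : Measurable (exponentialPDF lam) := (measurable_exponentialPDFReal lam).ennreal_ofReal
  rw [expMeasure_eq, integral_withDensity_eq_integral_toReal_smul hm
    (Eventually.of_forall fun _ => ENNReal.ofReal_lt_top), ← integral_Ici_eq_integral_Ioi,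
    ← integral_indicator measurableSet_Ici]
  congr 1
  funext t
  rw [exponentialPDF_eq]
  by_cases ht : 0 ≤ t
  · rw [Set.indicator_of_mem (Set.mem_Ici.2 ht), if_pos ht, ENNReal.toReal_ofReal (by positivity)]
  · rw [Set.indicator_of_notMem (by simpa using ht), if_neg ht]; simp

lemma beta_one {alpha : ℝ} (ha : 0 < alpha) : beta alpha 1 = 1 / alpha := by
  rw [beta, Real.Gamma_one, Real.Gamma_add_one ha.ne']
  have := (Real.Gamma_pos_of_pos ha).ne'
  field_simp

lemma measurable_betaPDF (a b : ℝ) : Measurable (betaPDF a b) :=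
  (measurable_betaPDFReal a b).ennreal_ofReal

lemma integral_betaMeasure_one {E : Type*} [NormedAddCommGroup E] [NormedSpace ℝ E] {alpha : ℝ}
    (ha : 0 < alpha) (f : ℝ → E) : ∫ z, f z ∂(betaMeasure alpha 1) =
      ∫ z in (0 : ℝ)..1, (alpha * z ^ (alpha - 1)) • f z := by
  rw [betaMeasure, integral_withDensity_eq_integral_toReal_smul (measurable_betaPDF _ _)
    (Eventually.of_forall fun _ => ENNReal.ofReal_lt_top),
    intervalIntegral.integral_of_le zero_le_one, integral_Ioc_eq_integral_Ioo,
    ← integral_indicator measurableSet_Ioo]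
  congr 1
  funext z
  rw [betaPDF_eq, beta_one ha]
  by_cases hz : 0 < z ∧ z < 1
  · have := Real.rpow_nonneg hz.1.le (alpha - 1)
    rw [Set.indicator_of_mem (Set.mem_Ioo.2 hz), if_pos hz, sub_self, Real.rpow_zero,
      ENNReal.toReal_ofReal (by positivity)]
    simp
  · rw [Set.indicator_of_notMem (by simpa using hz), if_neg hz]; simp

lemma ae_expMeasure_pos (lam : ℝ) : ∀ᵐ t ∂(expMeasure lam), 0 < t := by
  have hm : Measurable (exponentialPDF lam) := (measurable_exponentialPDFReal lam).ennreal_ofReal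
  rw [expMeasure_eq, ae_withDensity_iff hm]
  filter_upwards [Measure.ae_ne volume (0 : ℝ)] with t ht h
  by_contra hneg
  exact h (exponentialPDF_of_neg (lt_of_le_of_ne (not_lt.1 hneg) ht))

lemma ae_betaMeasure_mem (alpha : ℝ) : ∀ᵐ z ∂(betaMeasure alpha 1), 0 < z ∧ z < 1 := by
  rw [betaMeasure, ae_withDensity_iff (measurable_betaPDF _ _)]
  refine Eventually.of_forall fun z h => ?_
  by_contra hneg
  apply h
  rw [betaPDF_eq, if_neg hneg, ENNReal.ofReal_zero]

namespace Model

variable {M : Model}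

/-! ### Bounded solutions and their first-loss identity -/

/-- A `C^1` bounded function `h` on `[x^*, ∞)`, with `hp = -x h'`, that solves the
integro-differential equation of the model when extended by the constant `ε` below `x^*`. -/
structure IsSolution (M : Model) (δ : ℝ) (ε : ℂ) (h hp : ℝ → ℂ) : Prop where
  deriv : ∀ x, M.xs ≤ x → HasDerivAt h (-hp x / x) x
  flux : ∀ x, M.xs ≤ x → ((x ^ M.alpha : ℝ) : ℂ) *
    (-(M.drift x / x * hp x) - (M.lam + δ) * h x) =
      -(M.lam * (ε * ((M.xs ^ M.alpha : ℝ) : ℂ)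
        + ∫ y in M.xs..x, (M.alpha * ((y ^ (M.alpha - 1) : ℝ) : ℂ) * h y)))
  bdd : ∃ C, ∀ x, M.xs ≤ x → ‖h x‖ ≤ C

/-- `hasDerivAt_flux` gives the integrated equation on each piece up to a constant. The condition
`hbd` fixes it at x*, and continuity of u and p at B carries it to the upper piece. -/
lemma isSolution_glue (hM : M.Admissible) {δ : ℝ} {ε : ℂ} {uL pL uU pU : ℝ → ℂ}
    (hL : IsPieceSol M.lam M.alpha δ (M.r - M.cT) (-M.xss) (Set.Icc M.xs M.B) uL pL)
    (hU : IsPieceSol M.lam M.alpha δ M.r M.xs (Set.Ici M.B) uU pU)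
    (hu : uL M.B = uU M.B) (hp : pL M.B = pU M.B)
    (hbd : (δ + M.lam) * M.xs * uL M.xs + M.cT * (M.B - M.xs) * pL M.xs = M.lam * ε * M.xs)
    (hUb : ∃ C, ∀ x, M.B ≤ x → ‖uU x‖ ≤ C) :
    M.IsSolution δ ε (fun x => if M.B ≤ x then uU x else uL x)
      (fun x => if M.B ≤ x then pU x else pL x) := by
  have hxs := hM.hxs
  have hB := hM.hB
  have hxsc : (M.xs : ℂ) ≠ 0 := by exact_mod_cast hxs.ne'
  have hs := hM.sub_ne_zero
  have hLne : ∀ x ∈ Set.Icc M.xs M.B, x ≠ -M.xss := by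
    intro x hx h0
    have h1 := drift_of_mem_Icc hM hx.1 hx.2
    have h2 := drift_pos hM hx.1
    rw [h1, h0] at h2; simp at h2
  have hLc : ContinuousOn uL (Set.Icc M.xs M.B) := fun x hx =>
    (hL.deriv_u x hx).continuousAt.continuousWithinAt
  have hUc : ContinuousOn uU (Set.Ici M.B) := fun x hx =>
    (hU.deriv_u x hx).continuousAt.continuousWithinAt
  set h : ℝ → ℂ := fun x => if M.B ≤ x then uU x else uL x with hh
  have hLeq : ∀ x, x ≤ M.B → h x = uL x := by
    intro x hx
    simp only [hh]
    split_ifs with h'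
    · obtain rfl := le_antisymm hx h'
      exact hu.symm
    · rfl
  have hUeq : ∀ x, M.B ≤ x → h x = uU x := fun x hx => if_pos hx
  have hw : ∀ a b : ℝ, 0 < a → a ≤ b → ContinuousOn
      (fun y : ℝ => (M.alpha : ℂ) * ((y ^ (M.alpha - 1) : ℝ) : ℂ)) (Set.Icc a b) := by
    intro a b ha hab
    refine continuousOn_const.mul (Complex.continuous_ofReal.comp_continuousOn ?_)
    exact continuousOn_id.rpow_const fun y hy => Or.inl (ha.trans_le hy.1).ne'
  have iL : ∀ x, M.xs ≤ x → x ≤ M.B → IntervalIntegrable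
      (fun y : ℝ => M.alpha * ((y ^ (M.alpha - 1) : ℝ) : ℂ) * uL y) volume M.xs x := by
    intro x hx hx'
    refine ContinuousOn.intervalIntegrable_of_Icc hx ?_
    exact (hw _ _ hxs hx).mul (hLc.mono (Set.Icc_subset_Icc_right hx'))
  have iU : ∀ x, M.B ≤ x → IntervalIntegrable
      (fun y : ℝ => M.alpha * ((y ^ (M.alpha - 1) : ℝ) : ℂ) * uU y) volume M.B x := by
    intro x hx
    refine ContinuousOn.intervalIntegrable_of_Icc hx ?_
    exact (hw _ _ (hxs.trans hB) hx).mul (hUc.mono Set.Icc_subset_Ici_self)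
  have hfluxL : ∀ x, M.xs ≤ x → x ≤ M.B → ((x ^ M.alpha : ℝ) : ℂ) *
    (-(M.drift x / x * pL x) - (M.lam + δ) * uL x) =
      -(M.lam * (ε * ((M.xs ^ M.alpha : ℝ) : ℂ)
        + ∫ y in M.xs..x, (M.alpha * ((y ^ (M.alpha - 1) : ℝ) : ℂ) * uL y))) := by
    intro x hx hx'
    have h1 := intervalIntegral.integral_eq_sub_of_hasDerivAt (a := M.xs) (b := x)
      (f := fun x : ℝ => ((x ^ M.alpha : ℝ) : ℂ) * (-(((M.r - M.cT : ℝ) : ℂ) *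
        (x - (-M.xss : ℝ)) / x * pL x) - (M.lam + δ) * uL x))
      (f' := fun x => -(M.lam * M.alpha * ((x ^ (M.alpha - 1) : ℝ) : ℂ) * uL x))
      (fun y hy => by
        rw [Set.uIcc_of_le hx] at hy
        have hy' : y ∈ Set.Icc M.xs M.B := ⟨hy.1, hy.2.trans hx'⟩
        exact hL.hasDerivAt_flux hs hy' (hxs.trans_le hy.1) (hLne y hy'))
      (((iL x hx hx').const_mul (-M.lam : ℂ)).congr (fun y _ => by ring))
    have h2 : ∫ y in M.xs..x, -(M.lam * M.alpha * ((y ^ (M.alpha - 1) : ℝ) : ℂ) * uL y) =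
        -M.lam * ∫ y in M.xs..x, (M.alpha * ((y ^ (M.alpha - 1) : ℝ) : ℂ) * uL y) := by
      rw [← intervalIntegral.integral_const_mul]
      congr 1; funext y; ring
    rw [h2] at h1
    have e1 : (M.drift x : ℂ) = ((M.r - M.cT : ℝ) : ℂ) * (x - (-M.xss : ℝ)) := by
      rw [drift_of_mem_Icc hM hx hx']; push_cast; ring
    have e2 : ((M.r - M.cT : ℝ) : ℂ) * (M.xs - (-M.xss : ℝ)) = M.cT * (M.B - M.xs) := by
      have : M.drift M.xs = M.cT * (M.B - M.xs) := by
        rw [drift, sub_self, max_self, max_eq_left (by linarith)]; ring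
      rw [drift_of_mem_Icc hM le_rfl hB.le] at this
      exact_mod_cast this
    -- The equation at x* itself: every loss from x* traps, so the beta average there is ε.
    have e3 : -((M.cT : ℂ) * (M.B - M.xs) / M.xs * pL M.xs) - (M.lam + δ) * uL M.xs
        = - (M.lam * ε) := by
      field_simp
      linear_combination - hbd
    rw [e2, e3] at h1
    rw [e1]
    linear_combination - h1
  refine ⟨fun x hx => ?_, fun x hx => ?_, ?_⟩
  · have hcl := lt_or_ge x M.B
    refine hasDerivAt_glue (fun hx' => ?_) (fun hx' => ?_) hu
    · refine (hL.deriv_u x ⟨hx, hx'⟩).congr_deriv ?_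
      split_ifs with h'
      · obtain rfl := le_antisymm hx' h'
        rw [hp]
      · rfl
    · refine (hU.deriv_u x hx').congr_deriv ?_
      rw [if_pos hx']
  · rcases lt_or_ge x M.B with hx' | hx'
    · have := hfluxL x hx hx'.le
      rw [if_neg (not_le.2 hx'), hLeq x hx'.le, this]
      rw [intervalIntegral.integral_congr (g := fun y : ℝ =>
        M.alpha * ((y ^ (M.alpha - 1) : ℝ) : ℂ) * h y) fun y hy => ?_]
      rw [Set.uIcc_of_le hx] at hy
      simp only [hLeq y (hy.2.trans hx'.le)]
    · have h1 := intervalIntegral.integral_eq_sub_of_hasDerivAt (a := M.B) (b := x)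
        (f := fun x : ℝ => ((x ^ M.alpha : ℝ) : ℂ) * (-((M.r : ℂ) *
          (x - M.xs) / x * pU x) - (M.lam + δ) * uU x))
        (f' := fun x => -(M.lam * M.alpha * ((x ^ (M.alpha - 1) : ℝ) : ℂ) * uU x))
        (fun y hy => by
          rw [Set.uIcc_of_le hx'] at hy
          have h0 := hB.trans_le hy.1
          exact hU.hasDerivAt_flux hM.hr.ne' hy.1 (hxs.trans h0) h0.ne')
        (((iU x hx').const_mul (-M.lam : ℂ)).congr (fun y _ => by ring))
      have h2 : ∫ y in M.B..x, -(M.lam * M.alpha * ((y ^ (M.alpha - 1) : ℝ) : ℂ) * uU y) =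
          -M.lam * ∫ y in M.B..x, (M.alpha * ((y ^ (M.alpha - 1) : ℝ) : ℂ) * uU y) := by
        rw [← intervalIntegral.integral_const_mul]
        congr 1; funext y; ring
      rw [h2] at h1
      have h3 := hfluxL M.B hB.le le_rfl
      have e1 : ∀ y, M.B ≤ y → (M.drift y : ℂ) = (M.r : ℂ) * (y - M.xs) := by
        intro y hy
        rw [drift_of_ge hM hy]; push_cast; ring
      rw [e1 _ le_rfl, hu, hp] at h3
      have h4 : ∫ y in M.xs..x, (M.alpha * ((y ^ (M.alpha - 1) : ℝ) : ℂ) * h y) =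
          (∫ y in M.xs..M.B, (M.alpha * ((y ^ (M.alpha - 1) : ℝ) : ℂ) * uL y))
          + ∫ y in M.B..x, (M.alpha * ((y ^ (M.alpha - 1) : ℝ) : ℂ) * uU y) := by
        have c1 : ∀ y ∈ Set.uIcc M.xs M.B, M.alpha * ((y ^ (M.alpha - 1) : ℝ) : ℂ) * h y =
            M.alpha * ((y ^ (M.alpha - 1) : ℝ) : ℂ) * uL y := by
          intro y hy
          rw [Set.uIcc_of_le hB.le] at hy
          rw [hLeq y hy.2]
        have c2 : ∀ y ∈ Set.uIcc M.B x, M.alpha * ((y ^ (M.alpha - 1) : ℝ) : ℂ) * h y =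
            M.alpha * ((y ^ (M.alpha - 1) : ℝ) : ℂ) * uU y := by
          intro y hy
          rw [Set.uIcc_of_le hx'] at hy
          rw [hUeq y hy.1]
        rw [← intervalIntegral.integral_congr c1, ← intervalIntegral.integral_congr c2]
        refine (intervalIntegral.integral_add_adjacent_intervals ?_ ?_).symm
        · exact (iL M.B hB.le le_rfl).congr fun y hy => (c1 y (Set.uIoc_subset_uIcc hy)).symm
        · exact (iU x hx').congr fun y hy => (c2 y (Set.uIoc_subset_uIcc hy)).symm
      rw [h4, if_pos hx', hUeq x hx', e1 x hx']
      linear_combination - h1 + h3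
  · obtain ⟨C, hC⟩ := hUb
    obtain ⟨C', hC'⟩ := isCompact_Icc.exists_bound_of_continuousOn hLc
    refine ⟨max C C', fun x hx => ?_⟩
    rcases lt_or_ge x M.B with hx' | hx'
    · rw [hLeq x hx'.le]; exact (hC' x ⟨hx, hx'.le⟩).trans (le_max_right _ _)
    · rw [hUeq x hx']; exact (hC x hx').trans (le_max_left _ _)

/-- Extension of a function on `[x^*, ∞)` by a constant. -/
noncomputable def extend (M : Model) (h : ℝ → ℂ) (ε : ℂ) (v : ℝ) : ℂ := if M.xs ≤ v then h v else ε

/-- Law of a waiting time and a remaining proportion. -/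
noncomputable def stepLaw (M : Model) : Measure (ℝ × ℝ) :=
  (expMeasure M.lam).prod (betaMeasure M.alpha 1)

lemma isProbabilityMeasure_stepLaw (hM : M.Admissible) : IsProbabilityMeasure M.stepLaw := by
  have := isProbabilityMeasureBeta hM.halpha one_pos
  have := isProbabilityMeasure_expMeasure hM.hlam
  rw [stepLaw]; infer_instance

lemma ae_stepLaw (hM : M.Admissible) : ∀ᵐ q ∂M.stepLaw, 0 < q.1 ∧ 0 < q.2 ∧ q.2 < 1 := by
  have := isProbabilityMeasureBeta hM.halpha one_pos
  have := isProbabilityMeasure_expMeasure hM.hlam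
  filter_upwards [Measure.quasiMeasurePreserving_fst.ae (ae_expMeasure_pos M.lam),
    Measure.quasiMeasurePreserving_snd.ae (ae_betaMeasure_mem M.alpha)] with q h1 h2
  exact ⟨h1, h2⟩

lemma IsSolution.continuousOn {δ : ℝ} {ε : ℂ} {h hp : ℝ → ℂ} (H : M.IsSolution δ ε h hp) :
    ContinuousOn h (Set.Ici M.xs) := fun x hx => (H.deriv x hx).continuousAt.continuousWithinAt

lemma IsSolution.measurable_extend {δ : ℝ} {ε : ℂ} {h hp : ℝ → ℂ} (H : M.IsSolution δ ε h hp) :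
    Measurable (M.extend h ε) := by
  classical
  exact H.continuousOn.measurable_piecewise continuousOn_const measurableSet_Ici

lemma IsSolution.exists_bound_extend {δ : ℝ} {ε : ℂ} {h hp : ℝ → ℂ} (H : M.IsSolution δ ε h hp) :
    ∃ C, ∀ x, ‖M.extend h ε x‖ ≤ C := by
  obtain ⟨C, hC⟩ := H.bdd
  refine ⟨max C ‖ε‖, fun x => ?_⟩
  rw [extend]
  split_ifs with hx
  · exact (hC x hx).trans (le_max_left _ _)
  · exact le_max_right _ _

/-- The substitution v = zx turns the beta average into x^(-α) ∫₀ˣ α v^(α-1) h(v) dv; splitting at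
x* produces the right side of `flux`. -/
lemma IsSolution.integral_beta (hM : M.Admissible) {δ : ℝ} {ε : ℂ} {h hp : ℝ → ℂ}
    (H : M.IsSolution δ ε h hp) {x : ℝ} (hx : M.xs ≤ x) :
    M.lam * ∫ z, M.extend h ε (z * x) ∂(betaMeasure M.alpha 1) =
      (M.lam + δ) * h x + M.drift x / x * hp x := by
  have hxs := hM.hxs
  have ha := hM.halpha
  have hx0 : 0 < x := hxs.trans_le hx
  have hxa : ((x ^ M.alpha : ℝ) : ℂ) ≠ 0 := by
    exact_mod_cast (Real.rpow_pos_of_pos hx0 _).ne'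
  set φ : ℝ → ℂ := fun v => ((M.alpha * v ^ (M.alpha - 1) : ℝ) : ℂ) * M.extend h ε v with hφ
  have e1 : ∫ z, M.extend h ε (z * x) ∂(betaMeasure M.alpha 1) =
      ((x ^ (1 - M.alpha) : ℝ) : ℂ) * ∫ z in (0 : ℝ)..1, φ (z * x) := by
    rw [integral_betaMeasure_one ha, ← intervalIntegral.integral_const_mul]
    refine intervalIntegral.integral_congr_uIoo fun z hz => ?_
    rw [Set.uIoo_of_le zero_le_one] at hz
    simp only [hφ, Complex.real_smul]
    rw [← mul_assoc, ← Complex.ofReal_mul, Real.mul_rpow hz.1.le hx0.le]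
    have : x ^ (1 - M.alpha) * (M.alpha * (z ^ (M.alpha - 1) * x ^ (M.alpha - 1))) =
        M.alpha * z ^ (M.alpha - 1) * (x ^ (1 - M.alpha) * x ^ (M.alpha - 1)) := by ring
    rw [this, ← Real.rpow_add hx0]
    simp
  have iε : IntervalIntegrable (fun v : ℝ => ((M.alpha * v ^ (M.alpha - 1) : ℝ) : ℂ) * ε)
      volume 0 M.xs := by
    have := (intervalIntegral.intervalIntegrable_rpow' (a := 0) (b := M.xs)
      (by linarith : -1 < M.alpha - 1)).const_mul M.alpha
    exact IntervalIntegrable.mul_const ⟨this.1.ofReal, this.2.ofReal⟩ ε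
  have ih : IntervalIntegrable (fun v : ℝ => ((M.alpha * v ^ (M.alpha - 1) : ℝ) : ℂ) * h v)
      volume M.xs x := by
    refine ContinuousOn.intervalIntegrable_of_Icc hx (ContinuousOn.mul ?_
      (H.continuousOn.mono Set.Icc_subset_Ici_self))
    refine Complex.continuous_ofReal.comp_continuousOn (continuousOn_const.mul ?_)
    exact continuousOn_id.rpow_const fun y hy => Or.inl (hxs.trans_le hy.1).ne'
  have c1 : Set.EqOn φ (fun v : ℝ => ((M.alpha * v ^ (M.alpha - 1) : ℝ) : ℂ) * ε)
      (Set.uIoo 0 M.xs) := by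
    intro v hv
    rw [Set.uIoo_of_le hxs.le] at hv
    simp only [hφ, extend, if_neg (not_le.2 hv.2)]
  have c2 : Set.EqOn φ (fun v : ℝ => ((M.alpha * v ^ (M.alpha - 1) : ℝ) : ℂ) * h v)
      (Set.uIoo M.xs x) := by
    intro v hv
    rw [Set.uIoo_of_le hx] at hv
    simp only [hφ, extend, if_pos hv.1.le]
  have e2 : ∫ v in (0 : ℝ)..x, φ v = ε * ((M.xs ^ M.alpha : ℝ) : ℂ)
        + ∫ y in M.xs..x, (M.alpha * ((y ^ (M.alpha - 1) : ℝ) : ℂ) * h y) := by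
    rw [← intervalIntegral.integral_add_adjacent_intervals (b := M.xs) (iε.congr_uIoo c1.symm)
      (ih.congr_uIoo c2.symm), intervalIntegral.integral_congr_uIoo c1,
      intervalIntegral.integral_congr_uIoo c2]
    congr 1
    · rw [intervalIntegral.integral_mul_const, intervalIntegral.integral_ofReal,
        intervalIntegral.integral_const_mul, integral_rpow (Or.inl (by linarith)),
        sub_add_cancel, Real.zero_rpow ha.ne', sub_zero, mul_div_cancel₀ _ ha.ne', mul_comm]
    · simp only [Complex.ofReal_mul]
  have e3 := H.flux x hx
  rw [intervalIntegral.integral_comp_mul_right _ hx0.ne', zero_mul, one_mul, e2] at e1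
  rw [← mul_right_inj' hxa, e1]
  have e4 : (x ^ M.alpha : ℝ) * (x ^ (1 - M.alpha) * x⁻¹) = 1 := by
    rw [← mul_assoc, ← Real.rpow_add hx0]
    simp [hx0.ne']
  have e4' : ((x ^ M.alpha : ℝ) : ℂ) * (((x ^ (1 - M.alpha) : ℝ) : ℂ) * (x : ℂ)⁻¹) = 1 := by
    exact_mod_cast e4
  rw [Complex.real_smul]; push_cast at e3 e4' ⊢
  linear_combination (M.lam * (ε * ((M.xs ^ M.alpha : ℝ) : ℂ)
        + ∫ y in M.xs..x, (M.alpha * ((y ^ (M.alpha - 1) : ℝ) : ℂ) * h y))) * e4' + e3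

/-- Along the flow, e^(-(λ+δ)t) h has derivative -λ e^(-(λ+δ)t) times the beta average of h.
Integrate over (0,∞); boundedness removes the contribution at infinity. -/
lemma IsSolution.eq_integral_exp (hM : M.Admissible) {δ : ℝ} (hδ : 0 ≤ δ) {ε : ℂ} {h hp : ℝ → ℂ}
    (H : M.IsSolution δ ε h hp) {x : ℝ} (hx : M.xs ≤ x) :
    h x = ∫ t, ((Real.exp (-δ * t) : ℝ) : ℂ) *
      ∫ z, M.extend h ε (z * M.liveFlow (x, t)) ∂(betaMeasure M.alpha 1) ∂(expMeasure M.lam) := by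
  have hlam := hM.hlam
  obtain ⟨C, hC⟩ := H.exists_bound_extend
  have := isProbabilityMeasureBeta hM.halpha one_pos
  set K : ℝ → ℂ := fun y => ∫ z, M.extend h ε (z * y) ∂(betaMeasure M.alpha 1) with hK
  have hKb : ∀ y, ‖K y‖ ≤ C := fun y => by
    have := norm_integral_le_of_norm_le_const (μ := betaMeasure M.alpha 1)
      (Eventually.of_forall fun z => hC (z * y))
    simpa using this
  set f : ℝ → ℂ := fun t => ((Real.exp (-(M.lam + δ) * t) : ℝ) : ℂ) * h (M.flow x t) with hf
  have hfd : ∀ t ∈ Set.Ioi (0 : ℝ), HasDerivAt f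
      (-(((M.lam * Real.exp (-(M.lam * t)) : ℝ) : ℂ) * (((Real.exp (-δ * t) : ℝ) : ℂ) *
        K (M.liveFlow (x, t))))) t := by
    intro t (ht : 0 < t)
    have hge : M.xs ≤ M.flow x t := hx.trans (le_flow hM hx ht.le)
    have h1 := (H.deriv _ hge).scomp t (hasDerivAt_flow hM hx ht)
    have h2 : HasDerivAt (fun t => Real.exp (-(M.lam + δ) * t))
        (Real.exp (-(M.lam + δ) * t) * (-(M.lam + δ))) t := by
      have : HasDerivAt (fun t => -(M.lam + δ) * t) (-(M.lam + δ)) t := by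
        simpa using (hasDerivAt_id t).const_mul (-(M.lam + δ))
      exact this.exp
    refine (h2.ofReal_comp.mul h1).congr_deriv ?_
    rw [liveFlow_of_ge hx ht.le]
    have e1 := H.integral_beta hM hge
    have e2 : Real.exp (-(M.lam + δ) * t) = Real.exp (-(M.lam * t)) * Real.exp (-δ * t) := by
      rw [← Real.exp_add]; ring_nf
    rw [e2, Complex.real_smul]
    simp only [Function.comp]
    push_cast
    linear_combination Complex.exp (-(M.lam * t)) * Complex.exp (-δ * t) * e1
  have hfi : IntegrableOn (fun t => -(((M.lam * Real.exp (-(M.lam * t)) : ℝ) : ℂ) *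
      (((Real.exp (-δ * t) : ℝ) : ℂ) * K (M.liveFlow (x, t))))) (Set.Ioi 0) := by
    have hm : AEStronglyMeasurable (fun t => -(((M.lam * Real.exp (-(M.lam * t)) : ℝ) : ℂ) *
      (((Real.exp (-δ * t) : ℝ) : ℂ) * K (M.liveFlow (x, t)))))
        (volume.restrict (Set.Ioi 0)) := by
      -- The integrand is measurable because on (0,∞) it is the derivative of f.
      refine (aestronglyMeasurable_deriv f _).congr ?_
      exact (ae_restrict_iff' measurableSet_Ioi).2 (Eventually.of_forall fun t ht =>
        (hfd t ht).deriv)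
    refine Integrable.mono' (((exp_neg_integrableOn_Ioi 0 hlam).const_mul (M.lam * C))) hm ?_
    refine (ae_restrict_iff' measurableSet_Ioi).2 (Eventually.of_forall fun t (ht : 0 < t) => ?_)
    rw [norm_neg, norm_mul, norm_mul, Complex.norm_real, Complex.norm_real,
      Real.norm_of_nonneg (by positivity), Real.norm_of_nonneg (by positivity)]
    have h1 : Real.exp (-δ * t) ≤ 1 := Real.exp_le_one_iff.2 (by nlinarith)
    have h2 := hKb (M.liveFlow (x, t))
    have h3 : Real.exp (-δ * t) * ‖K (M.liveFlow (x, t))‖ ≤ 1 * C := by gcongr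
    calc _ ≤ M.lam * Real.exp (-(M.lam * t)) * (1 * C) := by gcongr
      _ = M.lam * C * Real.exp (-M.lam * t) := by rw [neg_mul]; ring
  have hlim : Tendsto f atTop (𝓝 0) := by
    rw [tendsto_zero_iff_norm_tendsto_zero]
    obtain ⟨C', hC'⟩ := H.bdd
    refine squeeze_zero' (g := fun t => Real.exp (-(M.lam + δ) * t) * C')
      (Eventually.of_forall fun t => norm_nonneg _) ?_ ?_
    · filter_upwards [eventually_ge_atTop 0] with t ht
      simp only [hf]
      rw [norm_mul, Complex.norm_real, Real.norm_of_nonneg (by positivity)]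
      gcongr
      exact hC' _ (hx.trans (le_flow hM hx ht))
    · have : Tendsto (fun t => Real.exp (-(M.lam + δ) * t)) atTop (𝓝 0) := by
        refine Real.tendsto_exp_atBot.comp ?_
        exact tendsto_id.const_mul_atTop_of_neg (by linarith)
      simpa using this.mul_const C'
  have hcont : ContinuousWithinAt f (Set.Ici 0) 0 := by
    refine ContinuousWithinAt.mul (Continuous.continuousWithinAt (by fun_prop)) ?_
    have h1 := continuousOn_flow hM hx 0 Set.self_mem_Ici
    refine ContinuousAt.comp_continuousWithinAt ?_ h1
    rw [flow_zero_of_ge hM hx]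
    exact (H.deriv x hx).continuousAt
  have key := integral_Ioi_of_hasDerivAt_of_tendsto hcont hfd hfi hlim
  rw [integral_neg] at key
  have hf0 : f 0 = h x := by simp [hf, flow_zero_of_ge hM hx]
  rw [integral_expMeasure hlam, ← hf0]
  simp only [Complex.real_smul]
  linear_combination key

lemma IsSolution.fixed (hM : M.Admissible) {δ : ℝ} (hδ : 0 ≤ δ) {ε : ℂ} {h hp : ℝ → ℂ}
    (H : M.IsSolution δ ε h hp) {x : ℝ} (hx : M.xs ≤ x) :
    Integrable (fun q : ℝ × ℝ => ((Real.exp (-δ * q.1) : ℝ) : ℂ) *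
      M.extend h ε (q.2 * M.liveFlow (x, q.1))) M.stepLaw ∧
    h x = ∫ q, ((Real.exp (-δ * q.1) : ℝ) : ℂ) *
      M.extend h ε (q.2 * M.liveFlow (x, q.1)) ∂M.stepLaw := by
  have := isProbabilityMeasureBeta hM.halpha one_pos
  have := isProbabilityMeasure_expMeasure hM.hlam
  obtain ⟨C, hC⟩ := H.exists_bound_extend
  have hm : Measurable (fun q : ℝ × ℝ => ((Real.exp (-δ * q.1) : ℝ) : ℂ) *
      M.extend h ε (q.2 * M.liveFlow (x, q.1))) := by
    have h1 := H.measurable_extend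
    have h2 := measurable_liveFlow hM
    refine Measurable.mul (by fun_prop) (h1.comp (measurable_snd.mul (h2.comp ?_)))
    fun_prop
  have hint : Integrable (fun q : ℝ × ℝ => ((Real.exp (-δ * q.1) : ℝ) : ℂ) *
      M.extend h ε (q.2 * M.liveFlow (x, q.1))) M.stepLaw := by
    have := isProbabilityMeasure_stepLaw hM
    refine Integrable.of_bound hm.aestronglyMeasurable C ?_
    filter_upwards [ae_stepLaw hM] with q hq
    rw [norm_mul, Complex.norm_real, Real.norm_of_nonneg (by positivity)]
    have h1 : Real.exp (-δ * q.1) ≤ 1 := Real.exp_le_one_iff.2 (by nlinarith [hq.1])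
    have h2 := hC (q.2 * M.liveFlow (x, q.1))
    nlinarith [norm_nonneg (M.extend h ε (q.2 * M.liveFlow (x, q.1)))]
  refine ⟨hint, ?_⟩
  rw [H.eq_integral_exp hM hδ hx, stepLaw, integral_prod _ hint]
  simp only [integral_const_mul]

end Model

namespace Model

variable {M : Model}

/-! ### The discounted one-step operator killed at trapping -/

open Classical in
/-- `f` on `[x^*, ∞)`, zero below. -/
noncomputable def live (M : Model) (f : ℝ → ℝ≥0∞) (v : ℝ) : ℝ≥0∞ := if M.xs ≤ v then f v else 0

open Classical in
/-- Indicator of the trapping region. -/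
noncomputable def dead (M : Model) (v : ℝ) : ℝ≥0∞ := if M.xs ≤ v then 0 else 1

/-- Discount factor of a waiting time. -/
noncomputable def discount (δ t : ℝ) : ℝ≥0∞ := ENNReal.ofReal (Real.exp (-δ * t))

/-- The capital after one loss. -/
noncomputable def stepTo (M : Model) (x : ℝ) (q : ℝ × ℝ) : ℝ := q.2 * M.liveFlow (x, q.1)

/-- `f ↦ E[e^{-δ W} f(X₁); X₁ ≥ x^*]`. -/
noncomputable def stepOp (M : Model) (δ : ℝ) (f : ℝ → ℝ≥0∞) (x : ℝ) : ℝ≥0∞ :=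
  ∫⁻ q, discount δ q.1 * M.live f (M.stepTo x q) ∂M.stepLaw

/-- `E[e^{-δ W}; X₁ < x^*]`. -/
noncomputable def stepTrap (M : Model) (δ : ℝ) (x : ℝ) : ℝ≥0∞ :=
  ∫⁻ q, discount δ q.1 * M.dead (M.stepTo x q) ∂M.stepLaw

lemma measurable_discount (δ : ℝ) : Measurable (discount δ) := by
  unfold discount; fun_prop

lemma measurable_live {f : ℝ → ℝ≥0∞} (hf : Measurable f) : Measurable (M.live f) :=
  Measurable.ite measurableSet_Ici hf measurable_const

lemma measurable_dead : Measurable M.dead :=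
  Measurable.ite measurableSet_Ici measurable_const measurable_const

lemma measurable_stepTo (hM : M.Admissible) :
    Measurable (fun p : ℝ × ℝ × ℝ => M.stepTo p.1 p.2) := by
  unfold stepTo
  exact measurable_snd.snd.mul ((measurable_liveFlow hM).comp
    (measurable_fst.prodMk measurable_snd.fst))

lemma measurable_stepTo_right (hM : M.Admissible) (x : ℝ) : Measurable (M.stepTo x) :=
  (measurable_stepTo hM).comp measurable_prodMk_left

lemma measurable_stepOp (hM : M.Admissible) (δ : ℝ) {f : ℝ → ℝ≥0∞} (hf : Measurable f) :
    Measurable (M.stepOp δ f) := by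
  have := isProbabilityMeasure_stepLaw hM
  refine Measurable.lintegral_prod_right' (f := fun p : ℝ × ℝ × ℝ =>
    discount δ p.2.1 * M.live f (M.stepTo p.1 p.2)) ?_
  exact ((measurable_discount δ).comp measurable_snd.fst).mul
    ((measurable_live hf).comp (measurable_stepTo hM))

lemma measurable_stepTrap (hM : M.Admissible) (δ : ℝ) : Measurable (M.stepTrap δ) := by
  have := isProbabilityMeasure_stepLaw hM
  refine Measurable.lintegral_prod_right' (f := fun p : ℝ × ℝ × ℝ =>
    discount δ p.2.1 * M.dead (M.stepTo p.1 p.2)) ?_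
  exact ((measurable_discount δ).comp measurable_snd.fst).mul
    (measurable_dead.comp (measurable_stepTo hM))

lemma stepOp_mono {δ : ℝ} {f g : ℝ → ℝ≥0∞} (h : ∀ v, M.xs ≤ v → f v ≤ g v) (x : ℝ) :
    M.stepOp δ f x ≤ M.stepOp δ g x := by
  refine lintegral_mono fun q => mul_le_mul_right ?_ _
  simp only [live]
  split_ifs with h'
  · exact h _ h'
  · exact le_rfl

lemma stepOp_const_mul_one_add (hM : M.Admissible) (δ : ℝ) (s : ℝ≥0∞) {V : ℝ → ℝ≥0∞}
    (x : ℝ) : M.stepOp δ (fun v => s + V v) x = s * M.stepOp δ 1 x + M.stepOp δ V x := by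
  have hm : Measurable fun q : ℝ × ℝ => discount δ q.1 * M.live 1 (M.stepTo x q) :=
    ((measurable_discount δ).comp measurable_fst).mul
      ((measurable_live measurable_one).comp (measurable_stepTo_right hM x))
  rw [stepOp, stepOp, stepOp, ← lintegral_const_mul _ hm, ← lintegral_add_left (hm.const_mul s)]
  congr 1
  funext q
  simp only [live]
  split_ifs
  · simp only [Pi.one_apply]; ring
  · simp

lemma stepOp_add (hM : M.Admissible) (δ : ℝ) {U V : ℝ → ℝ≥0∞} (hU : Measurable U) (x : ℝ) :
    M.stepOp δ (fun v => U v + V v) x = M.stepOp δ U x + M.stepOp δ V x := by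
  have hm : Measurable fun q : ℝ × ℝ => discount δ q.1 * M.live U (M.stepTo x q) :=
    ((measurable_discount δ).comp measurable_fst).mul
      ((measurable_live hU).comp (measurable_stepTo_right hM x))
  rw [stepOp, stepOp, stepOp, ← lintegral_add_left hm]
  congr 1
  funext q
  simp only [live]
  split_ifs
  · ring
  · simp

lemma discount_le_one {δ t : ℝ} (hδ : 0 ≤ δ) (ht : 0 < t) : discount δ t ≤ 1 := by
  rw [discount, ENNReal.ofReal_le_one, Real.exp_le_one_iff]
  nlinarith

lemma stepOp_one_le_one (hM : M.Admissible) {δ : ℝ} (hδ : 0 ≤ δ) (x : ℝ) :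
    M.stepOp δ 1 x ≤ 1 := by
  have := isProbabilityMeasure_stepLaw hM
  calc M.stepOp δ 1 x ≤ ∫⁻ _, 1 ∂M.stepLaw := by
        refine lintegral_mono_ae ?_
        filter_upwards [ae_stepLaw hM] with q hq
        have : M.live 1 (M.stepTo x q) ≤ 1 := by
          simp only [live]; split_ifs <;> simp
        exact mul_le_one' (discount_le_one hδ hq.1) this
    _ = 1 := by simp

/-- Bounded subsolutions are dominated by supersolutions `V`, as soon as the one-step survival
is uniformly less than one wherever domination is not known beforehand. -/
lemma le_of_subsolution (hM : M.Admissible) {δ : ℝ} {d V : ℝ → ℝ≥0∞} {C q : ℝ≥0∞}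
    (hd : ∀ x, M.xs ≤ x → d x ≤ M.stepOp δ d x) (hV : ∀ x, M.xs ≤ x → M.stepOp δ V x ≤ V x)
    (hC : C ≠ ∞) (hdC : ∀ x, M.xs ≤ x → d x ≤ C) (hq : q < 1)
    (hor : ∀ x, M.xs ≤ x → d x ≤ V x ∨ M.stepOp δ 1 x ≤ q) :
    ∀ x, M.xs ≤ x → d x ≤ V x := by
  -- Where survival is at most q, one application of the operator multiplies the constant excess by
  -- q; elsewhere domination by V is already assumed.
  have key : ∀ n : ℕ, ∀ x, M.xs ≤ x → d x ≤ q ^ n * C + V x := by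
    intro n
    induction n with
    | zero => intro x hx; simpa using (hdC x hx).trans le_self_add
    | succ n ih =>
      intro x hx
      rcases hor x hx with h | h
      · exact h.trans le_add_self
      · calc d x ≤ M.stepOp δ d x := hd x hx
          _ ≤ M.stepOp δ (fun v => q ^ n * C + V v) x := stepOp_mono ih x
          _ = q ^ n * C * M.stepOp δ 1 x + M.stepOp δ V x := stepOp_const_mul_one_add hM _ _ _
          _ ≤ q ^ n * C * q + V x := by gcongr; exact hV x hx
          _ = q ^ (n + 1) * C + V x := by ring
  intro x hx
  have hlim : Tendsto (fun n : ℕ => q ^ n * C + V x) atTop (𝓝 (0 * C + V x)) :=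
    (ENNReal.Tendsto.mul_const (ENNReal.tendsto_pow_atTop_nhds_zero_of_lt_one hq)
      (Or.inr hC)).add_const _
  have := ge_of_tendsto' hlim fun n => key n x hx
  simpa using this

lemma stepOp_const_le (hM : M.Admissible) {δ : ℝ} (hδ : 0 ≤ δ) (η : ℝ≥0∞) (x : ℝ) :
    M.stepOp δ (fun _ => η) x ≤ η := by
  have h := stepOp_const_mul_one_add hM δ η (V := fun _ => 0) x
  have h0 : M.stepOp δ (fun _ => 0) x = 0 := by simp [stepOp, live]
  simp only [add_zero, h0] at h
  rw [h]
  exact mul_le_of_le_one_right' (stepOp_one_le_one hM hδ x)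

/-- The mean discount of one waiting time is below 1 since W > 0 almost surely; it bounds survival
uniformly in x. -/
lemma exists_stepOp_one_le_of_pos (hM : M.Admissible) {δ : ℝ} (hδ : 0 < δ) :
    ∃ q < 1, ∀ x, M.stepOp δ 1 x ≤ q := by
  have := isProbabilityMeasure_stepLaw hM
  have hle : ∫⁻ q, discount δ q.1 ∂M.stepLaw ≤ 1 := by
    calc _ ≤ ∫⁻ _, 1 ∂M.stepLaw := by
          refine lintegral_mono_ae ?_
          filter_upwards [ae_stepLaw hM] with q hq using discount_le_one hδ.le hq.1
      _ = 1 := by simp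
  refine ⟨∫⁻ q, discount δ q.1 ∂M.stepLaw, ?_, fun x => ?_⟩
  · have := lintegral_strict_mono (μ := M.stepLaw) (f := fun q => discount δ q.1)
      (g := fun _ => 1) (IsProbabilityMeasure.ne_zero _) aemeasurable_const
      (ne_top_of_le_ne_top ENNReal.one_ne_top hle) ?_
    · simpa using this
    · filter_upwards [ae_stepLaw hM] with q hq
      rw [discount, ENNReal.ofReal_lt_one, Real.exp_lt_one_iff]
      nlinarith [hq.1]
  · refine lintegral_mono fun q => ?_
    refine mul_le_of_le_one_right' ?_
    simp only [live]; split_ifs <;> simp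

lemma expMeasure_Iic_one_pos {lam : ℝ} (hlam : 0 < lam) : 0 < expMeasure lam (Set.Iic 1) := by
  have hm : Measurable (exponentialPDF lam) := (measurable_exponentialPDFReal lam).ennreal_ofReal
  rw [pos_iff_ne_zero, expMeasure_eq, Ne, withDensity_apply_eq_zero hm]
  intro h
  have hsub : Set.Ioc (0 : ℝ) 1 ⊆ {x | exponentialPDF lam x ≠ 0} ∩ Set.Iic 1 := by
    intro x hx
    refine ⟨?_, hx.2⟩
    rw [Set.mem_ofPred_eq, exponentialPDF_of_nonneg hx.1.le, Ne, ENNReal.ofReal_eq_zero, not_le]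
    positivity
  have := measure_mono_null hsub h
  simp at this

lemma betaMeasure_Iio_pos {alpha c : ℝ} (ha : 0 < alpha) (hc : 0 < c) :
    0 < betaMeasure alpha 1 (Set.Iio c) := by
  rw [pos_iff_ne_zero, betaMeasure, Ne, withDensity_apply_eq_zero (measurable_betaPDF _ _)]
  intro h
  have hsub : Set.Ioo (0 : ℝ) (min 1 c) ⊆ {x | betaPDF alpha 1 x ≠ 0} ∩ Set.Iio c := by
    intro x hx
    have h1 : x < 1 := hx.2.trans_le (min_le_left _ _)
    refine ⟨?_, hx.2.trans_le (min_le_right _ _)⟩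
    rw [Set.mem_ofPred_eq, betaPDF, Ne, ENNReal.ofReal_eq_zero, not_le]
    exact betaPDFReal_pos hx.1 h1 ha one_pos
  have := measure_mono_null hsub h
  rw [Real.volume_Ioo, ENNReal.ofReal_eq_zero] at this
  have : 0 < min 1 c := lt_min one_pos hc
  linarith

/-- From capital at most R, a wait of at most 1 leads to at most C, and a proportion below x*/C then
traps. This event has positive probability, independently of x. -/
lemma exists_stepOp_one_le (hM : M.Admissible) {δ : ℝ} (hδ : 0 ≤ δ) (R : ℝ) :
    ∃ q < 1, ∀ x, M.xs ≤ x → x ≤ R → M.stepOp δ 1 x ≤ q := by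
  have := isProbabilityMeasure_stepLaw hM
  have := isProbabilityMeasureBeta hM.halpha one_pos
  have := isProbabilityMeasure_expMeasure hM.hlam
  obtain ⟨C, hC0, hC⟩ := exists_flow_bound hM R
  have hxs := hM.hxs
  set A : Set (ℝ × ℝ) := Set.Iic 1 ×ˢ Set.Iio (M.xs / C) with hA
  have hAm : MeasurableSet A := measurableSet_Iic.prod measurableSet_Iio
  have hApos : 0 < M.stepLaw A := by
    rw [stepLaw, Measure.prod_prod]
    exact ENNReal.mul_pos (expMeasure_Iic_one_pos hM.hlam).ne'
      (betaMeasure_Iio_pos hM.halpha (by positivity)).ne'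
  refine ⟨M.stepLaw Aᶜ, ?_, fun x hx hxR => ?_⟩
  · rw [prob_compl_eq_one_sub hAm]
    exact ENNReal.sub_lt_self ENNReal.one_ne_top one_ne_zero hApos.ne'
  · rw [← lintegral_indicator_one hAm.compl]
    refine lintegral_mono_ae ?_
    filter_upwards [ae_stepLaw hM] with q hq
    by_cases hqA : q ∈ A
    · have h1 : M.stepTo x q < M.xs := by
        rw [stepTo, liveFlow_of_ge hx hq.1.le]
        have h2 := hC x hx hxR q.1 hq.1.le hqA.1
        have h3 : q.2 < M.xs / C := hqA.2
        rw [lt_div_iff₀ hC0] at h3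
        nlinarith [hq.2.1]
      simp [live, not_le.2 h1]
    · rw [Set.indicator_of_mem hqA]
      have : M.live 1 (M.stepTo x q) ≤ 1 := by
        simp only [live]; split_ifs <;> simp
      exact mul_le_one' (discount_le_one hδ hq.1) this

end Model

/-! ### A logarithmic supersolution in the recurrent regime -/

lemma lintegral_betaMeasure_one {alpha : ℝ} (ha : 0 < alpha) (f : ℝ → ℝ≥0∞)  :
    ∫⁻ z, f z ∂(betaMeasure alpha 1) =
      ∫⁻ z in Set.Ioo 0 1, ENNReal.ofReal (alpha * z ^ (alpha - 1)) * f z := by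
  rw [betaMeasure, lintegral_withDensity_eq_lintegral_mul_non_measurable _
    (measurable_betaPDF _ _) (Eventually.of_forall fun _ => ENNReal.ofReal_lt_top),
    ← lintegral_indicator measurableSet_Ioo]
  congr 1
  funext z
  rw [Pi.mul_apply, betaPDF_eq, beta_one ha]
  by_cases hz : 0 < z ∧ z < 1
  · rw [Set.indicator_of_mem (Set.mem_Ioo.2 hz), if_pos hz, sub_self, Real.rpow_zero]
    simp
  · rw [Set.indicator_of_notMem (by simpa using hz), if_neg hz]; simp

lemma integrable_id_expMeasure {lam : ℝ} (hlam : 0 < lam) :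
    Integrable (fun t => t) (expMeasure lam) ∧ ∫ t, t ∂(expMeasure lam) = 1 / lam := by
  have h1 : ∫ t in Set.Ioi (0 : ℝ), t * Real.exp (-(lam * t)) = (1 / lam) ^ (2 : ℝ) := by
    have := Real.integral_rpow_mul_exp_neg_mul_Ioi (a := 2) two_pos hlam
    rw [Real.Gamma_two, mul_one] at this
    rw [← this]
    norm_num
  have h2 : ∫ t, t ∂(expMeasure lam) = 1 / lam := by
    rw [integral_expMeasure hlam]
    simp only [smul_eq_mul, mul_assoc]
    rw [integral_const_mul]
    simp only [mul_comm (Real.exp _)]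
    rw [h1, Real.rpow_two]
    field_simp
  refine ⟨?_, h2⟩
  by_contra h
  rw [integral_undef h] at h2
  have : 0 < 1 / lam := by positivity
  linarith

namespace Model

variable {M : Model}

lemma flow_le_mul_exp (hM : M.Admissible) {x c : ℝ} (hx : M.xs ≤ x)
    (hc : ∀ y, x ≤ y → M.drift y ≤ c * y) {t : ℝ} (ht : 0 ≤ t) :
    M.flow x t ≤ x * Real.exp (c * t) := by
  have hd : ∀ t, HasDerivAt (fun t => Real.exp (-c * t)) (Real.exp (-c * t) * (-c)) t := by
    intro t
    have : HasDerivAt (fun t => -c * t) (-c) t := by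
      simpa using (hasDerivAt_id t).const_mul (-c)
    exact this.exp
  have hanti : AntitoneOn (fun t => M.flow x t * Real.exp (-c * t)) (Set.Ici 0) := by
    refine antitoneOn_of_deriv_nonpos (convex_Ici 0)
      ((continuousOn_flow hM hx).mul (Continuous.continuousOn (by fun_prop))) ?_ ?_
    · intro s hs
      rw [interior_Ici] at hs
      exact ((hasDerivAt_flow hM hx hs).mul (hd s)).differentiableAt.differentiableWithinAt
    · intro s hs
      rw [interior_Ici] at hs
      have hh : HasDerivAt (fun t => M.flow x t * Real.exp (-c * t)) _ s :=
        (hasDerivAt_flow hM hx hs).mul (hd s)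
      rw [hh.deriv]
      have h1 := hc _ (le_flow hM hx (le_of_lt hs))
      have h2 := Real.exp_pos (-c * s)
      nlinarith
  have h1 := hanti Set.self_mem_Ici ht ht
  simp only [flow_zero_of_ge hM hx, mul_zero, Real.exp_zero, mul_one] at h1
  calc M.flow x t = M.flow x t * Real.exp (-c * t) * Real.exp (c * t) := by
        rw [mul_assoc, ← Real.exp_add]; simp
    _ ≤ x * Real.exp (c * t) := by gcongr

/-- Logarithmic test function. -/
noncomputable def logTest (M : Model) (K : ℝ) (x : ℝ) : ℝ := Real.log (x / M.xs) + K

/-- The integrand has the antiderivative z^α (log(zy/x*) + K - 1/α). The lower limit x*/y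
contributes the last term, the reduction caused by killing below x*. -/
lemma lintegral_beta_logTest (hM : M.Admissible) {K : ℝ} (hK : 0 ≤ K) {y : ℝ} (hy : M.xs ≤ y) :
    ∫⁻ z, M.live (fun v => ENNReal.ofReal (M.logTest K v)) (z * y) ∂(betaMeasure M.alpha 1) =
      ENNReal.ofReal (Real.log (y / M.xs) + K - 1 / M.alpha
        - (M.xs / y) ^ M.alpha * (K - 1 / M.alpha)) := by
  have hxs := hM.hxs
  have ha := hM.halpha
  have hy0 : 0 < y := hxs.trans_le hy
  set z₀ := M.xs / y with hz₀
  have hz₀0 : 0 < z₀ := by positivity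
  have hz₀1 : z₀ ≤ 1 := (div_le_one hy0).2 hy
  set f : ℝ → ℝ := fun z => M.alpha * z ^ (M.alpha - 1) * M.logTest K (z * y) with hf
  have hzy : ∀ z, z₀ ≤ z ↔ M.xs ≤ z * y := fun z => div_le_iff₀ hy0
  have hfnn : ∀ z, z₀ ≤ z → 0 ≤ f z := by
    intro z hz
    have : 0 ≤ Real.log (z * y / M.xs) := Real.log_nonneg (by
      rw [le_div_iff₀ hxs, one_mul]; exact (hzy z).1 hz)
    have h0 : 0 < z := hz₀0.trans_le hz
    simp only [hf, logTest]
    positivity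
  have hder : ∀ z ∈ Set.uIcc z₀ 1, HasDerivAt (fun z => z ^ M.alpha *
      (M.logTest K (z * y) - 1 / M.alpha)) (f z) z := by
    intro z hz
    rw [Set.uIcc_of_le hz₀1] at hz
    have h0 : 0 < z := hz₀0.trans_le hz.1
    have h1 := Real.hasDerivAt_rpow_const (p := M.alpha) (Or.inl h0.ne')
    have h2 : HasDerivAt (fun z => z * y / M.xs) (y / M.xs) z := by
      simpa using ((hasDerivAt_id z).mul_const y).div_const M.xs
    have h3 := ((h2.log (by positivity)).add_const K).sub_const (1 / M.alpha)
    refine (h1.mul h3).congr_deriv ?_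
    have e : z ^ M.alpha = z ^ (M.alpha - 1) * z := by
      rw [Real.rpow_sub_one h0.ne']; field_simp
    simp only [hf, logTest, e]
    field_simp
    ring
  have hcont : ContinuousOn f (Set.uIcc z₀ 1) := by
    rw [Set.uIcc_of_le hz₀1]
    refine ContinuousOn.mul (continuousOn_const.mul (continuousOn_id.rpow_const fun z hz =>
      Or.inl (hz₀0.trans_le hz.1).ne')) (ContinuousOn.add (ContinuousOn.log
        (Continuous.continuousOn (by fun_prop)) fun z hz => ?_) continuousOn_const)
    have : 0 < z := hz₀0.trans_le hz.1
    positivity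
  have hint : IntervalIntegrable f volume z₀ 1 := hcont.intervalIntegrable
  have hFTC := intervalIntegral.integral_eq_sub_of_hasDerivAt hder hint
  rw [lintegral_betaMeasure_one ha]
  have e1 : ∫⁻ z in Set.Ioo 0 1, ENNReal.ofReal (M.alpha * z ^ (M.alpha - 1)) *
      M.live (fun v => ENNReal.ofReal (M.logTest K v)) (z * y) =
      ∫⁻ z in Set.Ioc z₀ 1, ENNReal.ofReal (f z) := by
    rw [← setLIntegral_congr (Ico_ae_eq_Ioc (a := z₀) (b := 1)),
      ← lintegral_indicator measurableSet_Ico,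
      ← lintegral_indicator measurableSet_Ioo]
    congr 1
    funext z
    by_cases hz : z ∈ Set.Ico z₀ 1
    · have hz' : z ∈ Set.Ioo (0 : ℝ) 1 := ⟨hz₀0.trans_le hz.1, hz.2⟩
      rw [Set.indicator_of_mem hz, Set.indicator_of_mem hz', live, if_pos ((hzy z).1 hz.1),
        ← ENNReal.ofReal_mul]
      have := Real.rpow_nonneg hz'.1.le (M.alpha - 1)
      positivity
    · rw [Set.indicator_of_notMem hz]
      by_cases hz' : z ∈ Set.Ioo (0 : ℝ) 1
      · have : ¬ M.xs ≤ z * y := fun h => hz ⟨(hzy z).2 h, hz'.2⟩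
        rw [Set.indicator_of_mem hz', live, if_neg this, mul_zero]
      · rw [Set.indicator_of_notMem hz']
  rw [e1, ← ofReal_integral_eq_lintegral_ofReal
    ((intervalIntegrable_iff_integrableOn_Ioc_of_le hz₀1).1 hint)
    ((ae_restrict_iff' measurableSet_Ioc).2 (Eventually.of_forall fun z hz => hfnn z hz.1.le)),
    ← intervalIntegral.integral_of_le hz₀1, hFTC]
  congr 1
  have e2 : z₀ * y / M.xs = 1 := by rw [hz₀]; field_simp
  simp only [logTest, e2, Real.log_one, Real.one_rpow, one_mul]
  ring

/-- In `hb`, c bounds the logarithmic growth rate, and κ is the gain from killing, claimed only for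
waits of at most 1, where the flow can be bounded. -/
lemma stepOp_logTest_le (hM : M.Admissible) {K : ℝ} (hK : 0 ≤ K - 1 / M.alpha) {x A c κ : ℝ}
    (hx : M.xs ≤ x)
    (hb : ∀ t, 0 < t → Real.log (M.flow x t / M.xs) + K - 1 / M.alpha
        - (M.xs / M.flow x t) ^ M.alpha * (K - 1 / M.alpha) ≤
          A + c * t - (Set.Iic 1).indicator (fun _ => κ) t) :
    M.stepOp 0 (fun v => ENNReal.ofReal (M.logTest K v)) x ≤
      ENNReal.ofReal (A + c / M.lam - κ * (expMeasure M.lam).real (Set.Iic 1)) := by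
  have := isProbabilityMeasure_stepLaw hM
  have := isProbabilityMeasureBeta hM.halpha one_pos
  have := isProbabilityMeasure_expMeasure hM.hlam
  have ha := hM.halpha
  have hK0 : 0 ≤ K := by
    have : 0 < 1 / M.alpha := by positivity
    linarith
  have hm : Measurable fun q : ℝ × ℝ => discount 0 q.1 *
      M.live (fun v => ENNReal.ofReal (M.logTest K v)) (M.stepTo x q) := by
    refine ((measurable_discount 0).comp measurable_fst).mul
      ((measurable_live ?_).comp (measurable_stepTo_right hM x))
    unfold logTest; fun_prop
  have hi1 := (integrable_id_expMeasure hM.hlam).1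
  have hi2 : Integrable ((Set.Iic (1 : ℝ)).indicator (fun _ => κ)) (expMeasure M.lam) :=
    (integrable_const κ).indicator measurableSet_Iic
  have hi : Integrable (fun t => A + c * t - (Set.Iic 1).indicator (fun _ => κ) t)
      (expMeasure M.lam) := ((integrable_const A).add (hi1.const_mul c)).sub hi2
  have hnn : ∀ᵐ t ∂(expMeasure M.lam), 0 ≤ A + c * t - (Set.Iic 1).indicator (fun _ => κ) t := by
    filter_upwards [ae_expMeasure_pos M.lam] with t ht
    refine le_trans ?_ (hb t ht)
    have hge : M.xs ≤ M.flow x t := hx.trans (le_flow hM hx ht.le)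
    have hxs := hM.hxs
    have h0 : 0 < M.flow x t := hxs.trans_le hge
    have h1 : 0 ≤ Real.log (M.flow x t / M.xs) := Real.log_nonneg (by
      rwa [le_div_iff₀ hxs, one_mul])
    have h2 : (M.xs / M.flow x t) ^ M.alpha ≤ 1 :=
      Real.rpow_le_one (by positivity) ((div_le_one h0).2 hge) ha.le
    nlinarith
  have hval : ∫ t, (A + c * t - (Set.Iic 1).indicator (fun _ => κ) t) ∂(expMeasure M.lam) =
      A + c / M.lam - κ * (expMeasure M.lam).real (Set.Iic 1) := by
    have hi3 : Integrable (fun t => A + c * t) (expMeasure M.lam) :=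
      (integrable_const A).add (hi1.const_mul c)
    rw [integral_sub hi3 hi2, integral_add (integrable_const A) (hi1.const_mul c),
      integral_const_mul, (integrable_id_expMeasure hM.hlam).2, integral_indicator_const _ measurableSet_Iic]
    simp
    ring
  rw [stepOp, stepLaw, lintegral_prod _ hm.aemeasurable, ← hval,
    ofReal_integral_eq_lintegral_ofReal hi hnn]
  refine lintegral_mono_ae ?_
  filter_upwards [ae_expMeasure_pos M.lam] with t ht
  have hge : M.xs ≤ M.flow x t := hx.trans (le_flow hM hx ht.le)
  simp only [stepTo, liveFlow_of_ge hx ht.le, discount, neg_zero, zero_mul, Real.exp_zero,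
    ENNReal.ofReal_one, one_mul]
  rw [lintegral_beta_logTest hM hK0 hge]
  exact ENNReal.ofReal_le_ofReal (hb t ht)

/-- In the recurrent regime the logarithm is a supersolution. -/
lemma exists_logTest_supersolution (hM : M.Admissible) (hrec : M.alpha * M.r ≤ M.lam) :
    ∃ K, 0 ≤ K ∧ ∀ x, M.xs ≤ x → M.stepOp 0 (fun v => ENNReal.ofReal (M.logTest K v)) x ≤
      ENNReal.ofReal (M.logTest K x) := by
  have hxs := hM.hxs; have ha := hM.halpha; have hr := hM.hr; have hcT := hM.hcT
  have hlam := hM.hlam; have hB := hM.hB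
  obtain ⟨C, hC0, hC⟩ := exists_flow_bound hM M.B
  have := isProbabilityMeasure_expMeasure hlam
  set p := (expMeasure M.lam).real (Set.Iic 1) with hp
  have hp0 : 0 < p := ENNReal.toReal_pos (expMeasure_Iic_one_pos hlam).ne' (measure_ne_top _ _)
  -- A crude rate with drift(y) ≤ c y for every y ≥ x*; above B the sharper rate r is available.
  set c := M.r + M.cT * M.B / M.xs with hc
  have hB0 : 0 < M.B := hxs.trans hB
  have hc0 : 0 < c := by positivity
  set η := (M.xs / C) ^ M.alpha with hη
  have hη0 : 0 < η := by positivity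
  -- K is chosen so that the gain from killing, η (K - 1/α) p, equals the mean growth c/λ when
  -- starting below B.
  set K := 1 / M.alpha + c / M.lam / (η * p) with hK
  have hK1 : 0 ≤ K - 1 / M.alpha := by rw [hK, add_sub_cancel_left]; positivity
  have hK0 : 0 ≤ K := by positivity
  have hlog : ∀ x c', M.xs ≤ x → (∀ y, x ≤ y → M.drift y ≤ c' * y) → ∀ t, 0 < t →
      Real.log (M.flow x t / M.xs) ≤ Real.log (x / M.xs) + c' * t := by
    intro x c' hx hc' t ht
    have h1 := flow_le_mul_exp hM hx hc' ht.le
    have hx0 : 0 < x := hxs.trans_le hx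
    have h2 : 0 < M.flow x t := hx0.trans_le (le_flow hM hx ht.le)
    rw [← Real.log_exp (c' * t), ← Real.log_mul (by positivity) (by positivity)]
    refine Real.log_le_log (by positivity) ?_
    rw [div_mul_eq_mul_div]
    gcongr
  refine ⟨K, hK0, fun x hx => ?_⟩
  have hx0 : 0 < x := hxs.trans_le hx
  rcases lt_or_ge x M.B with hxB | hxB
  · refine (stepOp_logTest_le hM hK1 hx (A := Real.log (x / M.xs) + K - 1 / M.alpha) (c := c)
      (κ := η * (K - 1 / M.alpha)) ?_).trans ?_
    · intro t ht
      have h1 := hlog x c hx (fun y hy => by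
        have hy0 : M.xs ≤ y := hx.trans hy
        have e1 : max (y - M.xs) 0 ≤ y := max_le (by linarith) (by linarith)
        have e2 : max (M.B - y) 0 ≤ M.B := max_le (by linarith) (by linarith)
        have e3 : M.cT * M.B ≤ M.cT * M.B / M.xs * y := by
          rw [div_mul_eq_mul_div, le_div_iff₀ hxs]
          gcongr
        rw [drift, hc, add_mul]
        have e4 : M.r * max (y - M.xs) 0 ≤ M.r * y := by gcongr
        have e5 : M.cT * max (M.B - y) 0 ≤ M.cT * M.B := by gcongr
        linarith) t ht
      have hfl : 0 < M.flow x t := hx0.trans_le (le_flow hM hx ht.le)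
      by_cases ht1 : t ≤ 1
      · rw [Set.indicator_of_mem (Set.mem_Iic.2 ht1)]
        have h2 : η ≤ (M.xs / M.flow x t) ^ M.alpha := by
          rw [hη]
          have := hC x hx hxB.le t ht.le ht1
          gcongr
        nlinarith
      · rw [Set.indicator_of_notMem (by simpa using ht1)]
        have h2 : 0 ≤ (M.xs / M.flow x t) ^ M.alpha := by positivity
        nlinarith
    · refine ENNReal.ofReal_le_ofReal ?_
      have e : η * (K - 1 / M.alpha) * p = c / M.lam := by
        rw [hK, add_sub_cancel_left]
        field_simp
      have : 0 < 1 / M.alpha := by positivity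
      rw [logTest, ← hp, e]
      linarith
  · refine (stepOp_logTest_le hM hK1 hx (A := Real.log (x / M.xs) + K - 1 / M.alpha) (c := M.r)
      (κ := 0) ?_).trans ?_
    · intro t ht
      have h1 := hlog x M.r hx (fun y hy => by
        rw [drift_of_ge hM (hxB.trans hy)]; gcongr; linarith) t ht
      have hfl : 0 < M.flow x t := hx0.trans_le (le_flow hM hx ht.le)
      have h2 : 0 ≤ (M.xs / M.flow x t) ^ M.alpha * (K - 1 / M.alpha) := by positivity
      simp only [Set.indicator_zero, sub_zero]
      linarith
    · refine ENNReal.ofReal_le_ofReal ?_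
      -- Recurrence enters here: the mean logarithmic growth r/λ between losses does not exceed 1/α,
      -- the mean of -log Z.
      have : M.r / M.lam ≤ 1 / M.alpha := by
        rw [div_le_div_iff₀ hlam ha]; linarith
      rw [logTest]; linarith

end Model

/-- The joint law is the product of four marginals, which can be regrouped. With A, C the histories
of W, Z and B, D their next terms, this separates the past from the next step. -/
lemma indepFun_prodMk_comm {Ω α β γ κ : Type*} [MeasurableSpace Ω] [MeasurableSpace α]
    [MeasurableSpace β] [MeasurableSpace γ] [MeasurableSpace κ] {P : Measure Ω}
    [IsProbabilityMeasure P] {A : Ω → α} {B : Ω → β} {C : Ω → γ} {D : Ω → κ}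
    (hA : Measurable A) (hB : Measurable B) (hC : Measurable C) (hD : Measurable D)
    (hAB : IndepFun A B P) (hCD : IndepFun C D P)
    (h : IndepFun (fun ω => (A ω, B ω)) (fun ω => (C ω, D ω)) P) :
    IndepFun (fun ω => (A ω, C ω)) (fun ω => (B ω, D ω)) P := by
  have := Measure.isProbabilityMeasure_map (μ := P) hA.aemeasurable
  have := Measure.isProbabilityMeasure_map (μ := P) hB.aemeasurable
  have := Measure.isProbabilityMeasure_map (μ := P) hC.aemeasurable
  have := Measure.isProbabilityMeasure_map (μ := P) hD.aemeasurable
  set μA := P.map A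
  set μB := P.map B
  set μC := P.map C
  set μD := P.map D
  have hAC : IndepFun A C P := h.comp measurable_fst measurable_fst
  have hBD : IndepFun B D P := h.comp measurable_snd measurable_snd
  rw [indepFun_iff_map_prod_eq_prod_map_map (by fun_prop) (by fun_prop)] at hAB hCD hAC hBD h ⊢
  rw [hAB, hCD] at h
  rw [hAC, hBD]
  have e1 := measurePreserving_prodAssoc μA μB (μC.prod μD)
  have e2 : MeasurePreserving MeasurableEquiv.prodAssoc.symm (μB.prod (μC.prod μD))
      ((μB.prod μC).prod μD) := (measurePreserving_prodAssoc μB μC μD).symm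
  have e3 := (Measure.measurePreserving_swap (μ := μB) (ν := μC)).prod (MeasurePreserving.id μD)
  have e4 := measurePreserving_prodAssoc μC μB μD
  have e5 := (MeasurePreserving.id μA).prod (e4.comp (e3.comp e2))
  have e6 : MeasurePreserving MeasurableEquiv.prodAssoc.symm (μA.prod (μC.prod (μB.prod μD)))
      ((μA.prod μC).prod (μB.prod μD)) := (measurePreserving_prodAssoc μA μC (μB.prod μD)).symm
  have e7 := (e6.comp (e5.comp e1)).map_eq
  rw [← h, Measure.map_map (by fun_prop) (by fun_prop)] at e7
  rw [← e7]
  rfl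

/-! ### Losses -/

lemma lossTime_succ (w : ℕ → ℝ) (n : ℕ) : lossTime w (n + 1) = lossTime w n + w n :=
  Finset.sum_range_succ _ _

lemma strictMono_lossTime {w : ℕ → ℝ} (hw : ∀ n, 0 < w n) : StrictMono (lossTime w) :=
  strictMono_nat_of_lt_succ fun n => by rw [lossTime_succ]; linarith [hw n]

lemma lossTime_nonneg {w : ℕ → ℝ} (hw : ∀ n, 0 < w n) (n : ℕ) : 0 ≤ lossTime w n :=
  Finset.sum_nonneg fun i _ => (hw i).le

/-- Divergence of the loss times bounds the set in `lossCount`; without it the supremum in ℕ would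
take its default value 0. -/
lemma lossCount_spec {w : ℕ → ℝ} (hT : Tendsto (lossTime w) atTop atTop) {t : ℝ} (ht : 0 ≤ t) :
    lossTime w (lossCount w t) ≤ t ∧ ∀ n, lossTime w n ≤ t → n ≤ lossCount w t := by
  obtain ⟨N, hN⟩ := eventually_atTop.1 (hT.eventually_gt_atTop t)
  have hbdd : BddAbove {n : ℕ | lossTime w n ≤ t} := ⟨N, fun n hn => by
    by_contra h
    exact absurd (hN n (not_le.1 h).le) (not_lt.2 hn)⟩
  exact ⟨Nat.sSup_mem ⟨0, by simpa [lossTime] using ht⟩ hbdd, fun n hn => le_csSup hbdd hn⟩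

namespace Model

variable {M : Model}

/-- The capital after the `n`-th loss, set to zero one step after trapping. -/
noncomputable def liveLoss (M : Model) (w z : ℕ → ℝ) (x : ℝ) : ℕ → ℝ
  | 0 => x
  | n + 1 => M.stepTo (liveLoss M w z x n) (w n, z n)

lemma liveLoss_succ_of_dead (hM : M.Admissible) {w z : ℕ → ℝ} {x : ℝ} {n : ℕ}
    (h : M.liveLoss w z x n < M.xs) : M.liveLoss w z x (n + 1) < M.xs := by
  rw [liveLoss, stepTo, liveFlow_of_lt h, mul_zero]
  exact hM.hxs

lemma liveLoss_dead_of_le (hM : M.Admissible) {w z : ℕ → ℝ} {x : ℝ} {n m : ℕ} (hnm : n ≤ m)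
    (h : M.liveLoss w z x n < M.xs) : M.liveLoss w z x m < M.xs := by
  induction m, hnm using Nat.le_induction with
  | base => exact h
  | succ m _ ih => exact liveLoss_succ_of_dead hM ih

lemma postLoss_eq_liveLoss {w z : ℕ → ℝ} (hw : ∀ n, 0 < w n) {x : ℝ} {n : ℕ}
    (h : ∀ k < n, M.xs ≤ M.liveLoss w z x k) : M.postLoss w z x n = M.liveLoss w z x n := by
  induction n with
  | zero => rfl
  | succ n ih =>
    rw [postLoss, liveLoss, stepTo, ih fun k hk => h k (by omega),
      liveFlow_of_ge (h n (by omega)) (hw n).le]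

/-- Capital does not decrease between losses and `liveLoss` stays dead once dead, so being alive at
the last loss suffices. -/
lemma le_capital (hM : M.Admissible) {w z : ℕ → ℝ} (hw : ∀ n, 0 < w n)
    (hT : Tendsto (lossTime w) atTop atTop) {x t : ℝ} (ht : 0 ≤ t)
    (h : M.xs ≤ M.liveLoss w z x (lossCount w t)) : M.xs ≤ M.capital w z x t := by
  have h1 : M.postLoss w z x (lossCount w t) = M.liveLoss w z x (lossCount w t) := by
    refine postLoss_eq_liveLoss hw fun k hk => ?_
    by_contra hneg
    exact absurd (liveLoss_dead_of_le hM hk.le (not_le.1 hneg)) (not_lt.2 h)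
  rw [capital, h1]
  exact h.trans (le_flow hM h (sub_nonneg.2 (lossCount_spec hT ht).1))

lemma trappingTime_eq_top (hM : M.Admissible) {w z : ℕ → ℝ} (hw : ∀ n, 0 < w n)
    (hT : Tendsto (lossTime w) atTop atTop) {x : ℝ} (h : ∀ n, M.xs ≤ M.liveLoss w z x n) :
    M.trappingTime w z x = ∞ := by
  simp only [trappingTime, iInf_eq_top]
  intro t ht hlt
  exact absurd (le_capital hM hw hT ht (h _)) (not_le.2 hlt)

lemma trappingTime_eq (hM : M.Admissible) {w z : ℕ → ℝ} (hw : ∀ n, 0 < w n)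
    (hT : Tendsto (lossTime w) atTop atTop) {x : ℝ} {n : ℕ} (hn : M.xs ≤ M.liveLoss w z x n)
    (hn' : M.liveLoss w z x (n + 1) < M.xs) :
    M.trappingTime w z x = ENNReal.ofReal (lossTime w (n + 1)) := by
  have hmono := strictMono_lossTime hw
  have h0 := lossTime_nonneg hw (n + 1)
  apply le_antisymm
  · refine iInf_le_of_le (lossTime w (n + 1)) (iInf_le_of_le h0 (iInf_le_of_le ?_ le_rfl))
    have hc : lossCount w (lossTime w (n + 1)) = n + 1 := by
      obtain ⟨h1, h2⟩ := lossCount_spec hT h0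
      exact le_antisymm (hmono.le_iff_le.1 h1) (h2 _ le_rfl)
    rw [capital, hc, sub_self]
    apply flow_zero_lt hM
    rw [postLoss_eq_liveLoss hw fun k hk => ?_]
    · exact hn'
    · by_contra hneg
      exact absurd (liveLoss_dead_of_le hM (by omega : k ≤ n) (not_le.1 hneg)) (not_lt.2 hn)
  · refine le_iInf fun t => le_iInf fun ht => le_iInf fun hlt => ?_
    apply ENNReal.ofReal_le_ofReal
    by_contra hneg
    push Not at hneg
    refine absurd (le_capital hM hw hT ht ?_) (not_le.2 hlt)
    have h1 := (lossCount_spec hT ht).1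
    have h2 : lossCount w t < n + 1 := hmono.lt_iff_lt.1 (h1.trans_lt hneg)
    by_contra hneg'
    exact absurd (liveLoss_dead_of_le hM (by omega : lossCount w t ≤ n) (not_le.1 hneg'))
      (not_lt.2 hn)

/-- Contribution of trapping at loss `n + 1` to the Laplace transform. -/
noncomputable def trapTerm (M : Model) (δ : ℝ) (w z : ℕ → ℝ) (x : ℝ) (n : ℕ) : ℝ≥0∞ :=
  M.live (fun _ => discount δ (lossTime w n)) (M.liveLoss w z x n) *
    (discount δ (w n) * M.dead (M.liveLoss w z x (n + 1)))

lemma discount_add (δ s t : ℝ) : discount δ (s + t) = discount δ s * discount δ t := by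
  rw [discount, discount, discount, ← ENNReal.ofReal_mul (Real.exp_nonneg _), ← Real.exp_add]
  ring_nf

open Classical in
/-- The random variable whose mean is the Laplace transform. -/
noncomputable def discountedTrapping (M : Model) (δ : ℝ) (w z : ℕ → ℝ) (x : ℝ) : ℝ :=
  if M.trappingTime w z x < ∞ then Real.exp (-δ * (M.trappingTime w z x).toReal) else 0

/-- At most one n is alive after n losses and dead after n+1, so the sum has at most one nonzero
term, the discount at the trapping time. -/
lemma tsum_trapTerm (hM : M.Admissible) {δ : ℝ} {w z : ℕ → ℝ} (hw : ∀ n, 0 < w n)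
    (hT : Tendsto (lossTime w) atTop atTop) {x : ℝ} (hx : M.xs ≤ x) :
    ∑' n, M.trapTerm δ w z x n = ENNReal.ofReal (M.discountedTrapping δ w z x) := by
  by_cases h : ∀ n, M.xs ≤ M.liveLoss w z x n
  · rw [discountedTrapping, trappingTime_eq_top hM hw hT h]
    simp [trapTerm, dead, h]
  · push Not at h
    classical
    have hne : Nat.find h ≠ 0 := by
      intro h0
      have := Nat.find_spec h
      rw [h0] at this
      exact absurd hx (not_le.2 this)
    obtain ⟨n, hn⟩ := Nat.exists_eq_succ_of_ne_zero hne
    have hdead : M.liveLoss w z x (n + 1) < M.xs := by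
      have := Nat.find_spec h; rwa [hn] at this
    have hlive : ∀ k ≤ n, M.xs ≤ M.liveLoss w z x k := fun k hk =>
      not_lt.1 (Nat.find_min h (by omega))
    rw [tsum_eq_single n]
    · rw [discountedTrapping, trappingTime_eq hM hw hT (hlive n le_rfl) hdead,
        if_pos ENNReal.ofReal_lt_top, ENNReal.toReal_ofReal (lossTime_nonneg hw _), trapTerm, live,
        if_pos (hlive n le_rfl), dead, if_neg (not_le.2 hdead), mul_one, ← discount_add,
        ← lossTime_succ, discount]
    · intro m hm
      rcases lt_or_gt_of_ne hm with h' | h'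
      · rw [trapTerm, dead, if_pos (hlive (m + 1) h'), mul_zero, mul_zero]
      · have := liveLoss_dead_of_le hM (by omega : n + 1 ≤ m) hdead
        rw [trapTerm, live, if_neg (not_le.2 this), zero_mul]

lemma measurable_liveLoss (hM : M.Admissible) {α : Type*} [MeasurableSpace α]
    {w z : α → ℕ → ℝ} (hw : ∀ i, Measurable fun a => w a i) (hz : ∀ i, Measurable fun a => z a i)
    (x : ℝ) (n : ℕ) : Measurable fun a => M.liveLoss (w a) (z a) x n := by
  induction n with
  | zero => exact measurable_const
  | succ n ih => exact (measurable_stepTo hM).comp (ih.prodMk ((hw n).prodMk (hz n)))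

lemma measurable_lossTime {α : Type*} [MeasurableSpace α]
    {w : α → ℕ → ℝ} (hw : ∀ i, Measurable fun a => w a i) (n : ℕ) :
    Measurable fun a => lossTime (w a) n := by
  unfold lossTime
  exact Finset.measurable_sum _ fun i _ => hw i

lemma liveLoss_congr {w z w' z' : ℕ → ℝ} {x : ℝ} {n : ℕ} (hw : ∀ i < n, w i = w' i)
    (hz : ∀ i < n, z i = z' i) : M.liveLoss w z x n = M.liveLoss w' z' x n := by
  induction n with
  | zero => rfl
  | succ n ih =>
    rw [liveLoss, liveLoss, ih (fun i hi => hw i (by omega)) fun i hi => hz i (by omega),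
      hw n (by omega), hz n (by omega)]

lemma measurable_trapTerm (hM : M.Admissible) {α : Type*} [MeasurableSpace α]
    {w z : α → ℕ → ℝ} (hw : ∀ i, Measurable fun a => w a i) (hz : ∀ i, Measurable fun a => z a i)
    (δ x : ℝ) (n : ℕ) : Measurable fun a => M.trapTerm δ (w a) (z a) x n := by
  have h1 := measurable_liveLoss hM hw hz x
  refine Measurable.mul ?_ (((measurable_discount δ).comp (hw n)).mul
    (measurable_dead.comp (h1 (n + 1))))
  exact Measurable.ite (measurableSet_Ici.preimage (h1 n))
    ((measurable_discount δ).comp (measurable_lossTime hw n)) measurable_const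

/-! ### The Neumann series under the driving sequences -/

/-- Measurable waiting times and remaining proportions with the laws of the model. -/
structure Driving {Ω : Type*} [MeasurableSpace Ω] (M : Model) (P : Measure Ω) (W Z : ℕ → Ω → ℝ) :
    Prop where
  measurable_W : ∀ i, Measurable (W i)
  measurable_Z : ∀ i, Measurable (Z i)
  law_W : ∀ i, HasLaw (W i) (expMeasure M.lam) P
  law_Z : ∀ i, HasLaw (Z i) (betaMeasure M.alpha 1) P
  indep_W : iIndepFun W P
  indep_Z : iIndepFun Z P
  indep : IndepFun (fun ω i => W i ω) (fun ω i => Z i ω) P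

section Driving

variable {Ω : Type*} [MeasurableSpace Ω] {P : Measure Ω} {W Z : ℕ → Ω → ℝ}

lemma Driving.ae_pos (hD : M.Driving P W Z) : ∀ᵐ ω ∂P, ∀ n, 0 < W n ω := by
  rw [ae_all_iff]
  intro n
  have := ae_expMeasure_pos M.lam
  rw [← (hD.law_W n).map_eq] at this
  exact ae_of_ae_map (hD.law_W n).aemeasurable this

/-- By the strong law, lossTime n / n tends to 1/λ > 0. -/
lemma Driving.ae_tendsto (hM : M.Admissible) (hD : M.Driving P W Z) :
    ∀ᵐ ω ∂P, Tendsto (lossTime fun i => W i ω) atTop atTop := by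
  have hlam := hM.hlam
  have hid := integrable_id_expMeasure hlam
  have hint : Integrable (W 0) P := by
    have := hid.1
    rw [← (hD.law_W 0).map_eq] at this
    exact this.comp_aemeasurable (hD.law_W 0).aemeasurable
  have hmean : P[W 0] = 1 / M.lam := by
    rw [← hid.2, ← (hD.law_W 0).map_eq]
    exact (integral_map (hD.law_W 0).aemeasurable measurable_id.aestronglyMeasurable).symm
  have hslln := strong_law_ae_real W hint (fun i j hij => hD.indep_W.indepFun hij)
    (fun i => (hD.law_W i).identDistrib (hD.law_W 0))
  filter_upwards [hslln] with ω hω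
  rw [hmean] at hω
  have h1 := hω.pos_mul_atTop (by positivity) tendsto_natCast_atTop_atTop
  refine h1.congr' ?_
  filter_upwards [eventually_gt_atTop 0] with n hn
  have : (n : ℝ) ≠ 0 := by exact_mod_cast hn.ne'
  rw [lossTime]
  field_simp

lemma Driving.ae_discountedTrapping (hM : M.Admissible) (hD : M.Driving P W Z) (δ : ℝ) {x : ℝ}
    (hx : M.xs ≤ x) : ∀ᵐ ω ∂P, ∑' n, M.trapTerm δ (fun i => W i ω) (fun i => Z i ω) x n =
      ENNReal.ofReal (M.discountedTrapping δ (fun i => W i ω) (fun i => Z i ω) x) := by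
  filter_upwards [hD.ae_pos, hD.ae_tendsto hM] with ω h1 h2 using tsum_trapTerm hM h1 h2 hx

lemma discountedTrapping_nonneg (δ : ℝ) (w z : ℕ → ℝ) (x : ℝ) :
    0 ≤ M.discountedTrapping δ w z x := by
  rw [discountedTrapping]; split_ifs <;> positivity

lemma Driving.aemeasurable_discountedTrapping (hM : M.Admissible) (hD : M.Driving P W Z) (δ : ℝ)
    {x : ℝ} (hx : M.xs ≤ x) :
    AEMeasurable (fun ω => M.discountedTrapping δ (fun i => W i ω) (fun i => Z i ω) x) P := by
  have hm : Measurable fun ω => ∑' n, M.trapTerm δ (fun i => W i ω) (fun i => Z i ω) x n :=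
    Measurable.tsum fun n => measurable_trapTerm hM (fun i => hD.measurable_W i)
      (fun i => hD.measurable_Z i) δ x n
  refine hm.ennreal_toReal.aemeasurable.congr ?_
  filter_upwards [hD.ae_discountedTrapping hM δ hx] with ω h
  rw [h, ENNReal.toReal_ofReal (discountedTrapping_nonneg _ _ _ _)]

variable [IsProbabilityMeasure P]

/-- The time and capital at the `n`-th loss are independent of the next step. -/
lemma Driving.lintegral_next (hM : M.Admissible) (hD : M.Driving P W Z) (x : ℝ) (n : ℕ)
    {k : (ℝ × ℝ) × ℝ × ℝ → ℝ≥0∞} (hk : Measurable k) :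
    ∫⁻ ω, k ((lossTime (fun i => W i ω) n, M.liveLoss (fun i => W i ω) (fun i => Z i ω) x n),
      (W n ω, Z n ω)) ∂P =
    ∫⁻ ω, ∫⁻ q, k ((lossTime (fun i => W i ω) n,
      M.liveLoss (fun i => W i ω) (fun i => Z i ω) x n), q) ∂M.stepLaw ∂P := by
  have := isProbabilityMeasure_stepLaw hM
  set S := Finset.range n
  -- Finite histories are padded with zeros so that the recursions, defined on sequences, become
  -- measurable functions of the first n terms only.
  set ext : (S → ℝ) → ℕ → ℝ := fun u i => if h : i ∈ S then u ⟨i, h⟩ else 0 with hext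
  have hextm : ∀ i, Measurable fun u : S → ℝ => ext u i := by
    intro i
    simp only [hext]
    split_ifs with h
    · exact measurable_pi_apply _
    · exact measurable_const
  have hpast : ∀ V : ℕ → Ω → ℝ, (∀ i, Measurable (V i)) →
      Measurable fun ω (i : S) => V i ω := fun V hV => measurable_pi_lambda _ fun i => hV i
  have hsplit : ∀ V : ℕ → Ω → ℝ, (∀ i, Measurable (V i)) → iIndepFun V P →
      IndepFun (fun ω (i : S) => V i ω) (V n) P := by
    intro V hV hi
    have := hi.indepFun_finset S {n} (by simp [S]) hV
    exact this.comp measurable_id (measurable_pi_apply (⟨n, by simp⟩ : ({n} : Finset ℕ)))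
  have hpair : ∀ V : ℕ → Ω → ℝ, Measurable fun v : ℕ → ℝ => ((fun i : S => v i), v n) := by
    intro V
    exact (measurable_pi_lambda _ fun i => measurable_pi_apply _).prodMk (measurable_pi_apply _)
  have h1 : IndepFun (fun ω => ((fun i : S => W i ω), (fun i : S => Z i ω)))
      (fun ω => (W n ω, Z n ω)) P :=
    indepFun_prodMk_comm (hpast W hD.measurable_W) (hD.measurable_W n) (hpast Z hD.measurable_Z)
      (hD.measurable_Z n) (hsplit W hD.measurable_W hD.indep_W)
      (hsplit Z hD.measurable_Z hD.indep_Z) (hD.indep.comp (hpair W) (hpair Z))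
  set past : Ω → ℝ × ℝ := fun ω => (lossTime (fun i => W i ω) n,
    M.liveLoss (fun i => W i ω) (fun i => Z i ω) x n) with hpast_def
  have hpastm : Measurable past := (measurable_lossTime (fun i => hD.measurable_W i) n).prodMk
    (measurable_liveLoss hM (fun i => hD.measurable_W i) (fun i => hD.measurable_Z i) x n)
  have hnextm : Measurable fun ω => (W n ω, Z n ω) :=
    (hD.measurable_W n).prodMk (hD.measurable_Z n)
  have h2 : IndepFun past (fun ω => (W n ω, Z n ω)) P := by
    have hG : Measurable fun p : (S → ℝ) × (S → ℝ) =>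
        (lossTime (ext p.1) n, M.liveLoss (ext p.1) (ext p.2) x n) :=
      (measurable_lossTime (fun i => (hextm i).comp measurable_fst) n).prodMk
        (measurable_liveLoss hM (fun i => (hextm i).comp measurable_fst)
          (fun i => (hextm i).comp measurable_snd) x n)
    have := h1.comp hG measurable_id
    refine this.congr (Eventually.of_forall fun ω => ?_) (Eventually.of_forall fun ω => rfl)
    have hE : ∀ V : ℕ → Ω → ℝ, ∀ i < n, ext (fun i : S => V i ω) i = V i ω := by
      intro V i hi
      simp [hext, S, hi]
    simp only [Function.comp, hpast_def]
    refine Prod.ext ?_ ?_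
    · exact Finset.sum_congr rfl fun i hi => hE W i (Finset.mem_range.1 hi)
    · exact liveLoss_congr (hE W) (hE Z)
  have h3 : P.map (fun ω => (W n ω, Z n ω)) = M.stepLaw := by
    have h4 : IndepFun (W n) (Z n) P :=
      hD.indep.comp (measurable_pi_apply n) (measurable_pi_apply n)
    rw [indepFun_iff_map_prod_eq_prod_map_map (hD.measurable_W n).aemeasurable
      (hD.measurable_Z n).aemeasurable, (hD.law_W n).map_eq, (hD.law_Z n).map_eq] at h4
    exact h4
  rw [indepFun_iff_map_prod_eq_prod_map_map hpastm.aemeasurable hnextm.aemeasurable, h3] at h2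
  have := Measure.isProbabilityMeasure_map (μ := P) hpastm.aemeasurable
  calc _ = ∫⁻ p, k p ∂(P.map fun ω => (past ω, (W n ω, Z n ω))) :=
        (lintegral_map hk (hpastm.prodMk hnextm)).symm
    _ = ∫⁻ p, ∫⁻ q, k (p, q) ∂M.stepLaw ∂(P.map past) := by
        rw [h2, lintegral_prod _ hk.aemeasurable]
    _ = _ := lintegral_map hk.lintegral_prod_right' hpastm

/-- Markov property: integrating out the last step replaces f by T f one loss earlier. The induction
therefore runs over all measurable f. -/
lemma Driving.lintegral_live (hM : M.Admissible) (hD : M.Driving P W Z) (δ : ℝ) {x : ℝ}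
    (hx : M.xs ≤ x) (n : ℕ) {f : ℝ → ℝ≥0∞} (hf : Measurable f) :
    ∫⁻ ω, M.live (fun v => discount δ (lossTime (fun i => W i ω) n) * f v)
      (M.liveLoss (fun i => W i ω) (fun i => Z i ω) x n) ∂P = (M.stepOp δ)^[n] f x := by
  induction n generalizing f with
  | zero => simp [liveLoss, live, hx, lossTime, discount]
  | succ n ih =>
    rw [Function.iterate_succ_apply, ← ih (measurable_stepOp hM δ hf)]
    set k : (ℝ × ℝ) × ℝ × ℝ → ℝ≥0∞ := fun p => M.live (fun _ => discount δ p.1.1) p.1.2 *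
      (discount δ p.2.1 * M.live f (M.stepTo p.1.2 p.2)) with hk
    have hkm : Measurable k := by
      refine Measurable.mul ?_ (((measurable_discount δ).comp measurable_snd.fst).mul
        ((measurable_live hf).comp ((measurable_stepTo hM).comp
          (measurable_fst.snd.prodMk measurable_snd))))
      exact Measurable.ite (measurableSet_Ici.preimage measurable_fst.snd)
        ((measurable_discount δ).comp measurable_fst.fst) measurable_const
    have h := hD.lintegral_next hM x n hkm
    refine Eq.trans (lintegral_congr fun ω => ?_) (h.trans (lintegral_congr fun ω => ?_))
    · simp only [hk, live]
      by_cases h1 : M.xs ≤ M.liveLoss (fun i => W i ω) (fun i => Z i ω) x n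
      · rw [if_pos h1, lossTime_succ, discount_add]
        split_ifs with h2 h3 h3
        · rw [mul_assoc]; rfl
        · exact absurd h2 h3
        · exact absurd h3 h2
        · simp
      · have h2 := liveLoss_succ_of_dead hM (not_le.1 h1)
        rw [if_neg h1, if_neg (not_le.2 h2), zero_mul]
    · simp only [hk]
      have hm : Measurable fun q : ℝ × ℝ => discount δ q.1 * M.live f
          (M.stepTo (M.liveLoss (fun i => W i ω) (fun i => Z i ω) x n) q) :=
        ((measurable_discount δ).comp measurable_fst).mul
          ((measurable_live hf).comp (measurable_stepTo_right hM _))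
      rw [lintegral_const_mul _ hm]
      simp only [live]
      split_ifs
      · rfl
      · simp

lemma Driving.lintegral_trapTerm (hM : M.Admissible) (hD : M.Driving P W Z) (δ : ℝ) {x : ℝ}
    (hx : M.xs ≤ x) (n : ℕ) :
    ∫⁻ ω, M.trapTerm δ (fun i => W i ω) (fun i => Z i ω) x n ∂P =
      (M.stepOp δ)^[n] (M.stepTrap δ) x := by
  rw [← hD.lintegral_live hM δ hx n (measurable_stepTrap hM δ)]
  set k : (ℝ × ℝ) × ℝ × ℝ → ℝ≥0∞ := fun p => M.live (fun _ => discount δ p.1.1) p.1.2 *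
    (discount δ p.2.1 * M.dead (M.stepTo p.1.2 p.2)) with hk
  have hkm : Measurable k := by
    refine Measurable.mul ?_ (((measurable_discount δ).comp measurable_snd.fst).mul
      (measurable_dead.comp ((measurable_stepTo hM).comp
        (measurable_fst.snd.prodMk measurable_snd))))
    exact Measurable.ite (measurableSet_Ici.preimage measurable_fst.snd)
      ((measurable_discount δ).comp measurable_fst.fst) measurable_const
  have h := hD.lintegral_next hM x n hkm
  refine h.trans (lintegral_congr fun ω => ?_)
  simp only [hk]
  have hm : Measurable fun q : ℝ × ℝ => discount δ q.1 * M.dead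
      (M.stepTo (M.liveLoss (fun i => W i ω) (fun i => Z i ω) x n) q) :=
    ((measurable_discount δ).comp measurable_fst).mul
      (measurable_dead.comp (measurable_stepTo_right hM _))
  rw [lintegral_const_mul _ hm]
  simp only [live]
  split_ifs
  · rfl
  · simp

/-- The Laplace transform as a Neumann series. -/
noncomputable def trapSeries (M : Model) (δ x : ℝ) : ℝ≥0∞ :=
  ∑' n, (M.stepOp δ)^[n] (M.stepTrap δ) x

lemma Driving.laplace_eq (hM : M.Admissible) (hD : M.Driving P W Z) (δ : ℝ) {x : ℝ}
    (hx : M.xs ≤ x) : M.laplace P W Z δ x = (M.trapSeries δ x).toReal := by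
  have h1 : M.laplace P W Z δ x =
      ∫ ω, M.discountedTrapping δ (fun i => W i ω) (fun i => Z i ω) x ∂P := rfl
  rw [h1, integral_eq_lintegral_of_nonneg_ae
    (Eventually.of_forall fun ω => discountedTrapping_nonneg _ _ _ _)
    (hD.aemeasurable_discountedTrapping hM δ hx).aestronglyMeasurable,
    ← lintegral_congr_ae (hD.ae_discountedTrapping hM δ hx), lintegral_tsum fun n =>
      (measurable_trapTerm hM (fun i => hD.measurable_W i) (fun i => hD.measurable_Z i)
        δ x n).aemeasurable]
  simp only [hD.lintegral_trapTerm hM δ hx, trapSeries]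

end Driving

end Model

namespace Model

variable {M : Model}

/-! ### Minimality of the Neumann series and uniqueness -/

lemma measurable_discount_live (hM : M.Admissible) (δ : ℝ) {f : ℝ → ℝ≥0∞} (hf : Measurable f)
    (x : ℝ) : Measurable fun q : ℝ × ℝ => discount δ q.1 * M.live f (M.stepTo x q) :=
  ((measurable_discount δ).comp measurable_fst).mul
    ((measurable_live hf).comp (measurable_stepTo_right hM x))

lemma measurable_discount_dead (hM : M.Admissible) (δ x : ℝ) :
    Measurable fun q : ℝ × ℝ => discount δ q.1 * M.dead (M.stepTo x q) :=
  ((measurable_discount δ).comp measurable_fst).mul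
    (measurable_dead.comp (measurable_stepTo_right hM x))

lemma stepOp_tsum (hM : M.Admissible) (δ : ℝ) {f : ℕ → ℝ → ℝ≥0∞} (hf : ∀ n, Measurable (f n))
    (x : ℝ) : M.stepOp δ (fun v => ∑' n, f n v) x = ∑' n, M.stepOp δ (f n) x := by
  simp only [stepOp]
  rw [← lintegral_tsum fun n => (measurable_discount_live hM δ (hf n) x).aemeasurable]
  refine lintegral_congr fun q => ?_
  rw [ENNReal.tsum_mul_left]
  simp only [live]
  split_ifs <;> simp

lemma stepOp_sum (hM : M.Admissible) (δ : ℝ) {f : ℕ → ℝ → ℝ≥0∞} (hf : ∀ n, Measurable (f n))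
    (N : ℕ) (x : ℝ) : M.stepOp δ (fun v => ∑ n ∈ Finset.range N, f n v) x =
      ∑ n ∈ Finset.range N, M.stepOp δ (f n) x := by
  induction N with
  | zero => simp [stepOp, live]
  | succ N ih =>
    simp only [Finset.sum_range_succ]
    rw [stepOp_add hM δ (Finset.measurable_sum _ fun n _ => hf n), ih]

lemma measurable_iterate_stepOp (hM : M.Admissible) (δ : ℝ) (n : ℕ) :
    Measurable ((M.stepOp δ)^[n] (M.stepTrap δ)) := by
  induction n with
  | zero => exact measurable_stepTrap hM δ
  | succ n ih => rw [Function.iterate_succ_apply']; exact measurable_stepOp hM δ ih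

lemma measurable_trapSeries (hM : M.Admissible) (δ : ℝ) : Measurable (M.trapSeries δ) :=
  Measurable.tsum fun n => measurable_iterate_stepOp hM δ n

lemma trapSeries_eq (hM : M.Admissible) (δ x : ℝ) :
    M.trapSeries δ x = M.stepTrap δ x + M.stepOp δ (M.trapSeries δ) x := by
  have h2 : M.stepOp δ (M.trapSeries δ) x = ∑' n, (M.stepOp δ)^[n + 1] (M.stepTrap δ) x := by
    simp only [Function.iterate_succ_apply']
    exact stepOp_tsum hM δ (measurable_iterate_stepOp hM δ) x
  rw [h2, trapSeries, tsum_eq_zero_add' ENNReal.summable, Function.iterate_zero_apply]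

/-- Minimality: by induction every partial sum of the Neumann series lies below u, through
monotonicity of T. -/
lemma trapSeries_le (hM : M.Admissible) {δ : ℝ} {u : ℝ → ℝ≥0∞}
    (hu : ∀ x, M.xs ≤ x → M.stepTrap δ x + M.stepOp δ u x ≤ u x) :
    ∀ x, M.xs ≤ x → M.trapSeries δ x ≤ u x := by
  have key : ∀ N : ℕ, ∀ x, M.xs ≤ x →
      ∑ n ∈ Finset.range N, (M.stepOp δ)^[n] (M.stepTrap δ) x ≤ u x := by
    intro N
    induction N with
    | zero => simp
    | succ N ih =>
      intro x hx
      rw [Finset.sum_range_succ', Function.iterate_zero_apply, add_comm]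
      refine le_trans ?_ (hu x hx)
      gcongr
      simp only [Function.iterate_succ_apply']
      rw [← stepOp_sum hM δ (measurable_iterate_stepOp hM δ)]
      exact stepOp_mono ih x
  intro x hx
  exact ENNReal.tsum_le_of_sum_range_le fun N => key N x hx

lemma stepTrap_add_stepOp (hM : M.Admissible) (δ : ℝ) (f : ℝ → ℝ≥0∞) (x : ℝ) :
    M.stepTrap δ x + M.stepOp δ f x =
      ∫⁻ q, discount δ q.1 * (if M.xs ≤ M.stepTo x q then f (M.stepTo x q) else 1)
        ∂M.stepLaw := by
  rw [stepTrap, stepOp, ← lintegral_add_left (measurable_discount_dead hM δ x)]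
  refine lintegral_congr fun q => ?_
  simp only [live, dead]
  split_ifs <;> simp

lemma trapSeries_le_one (hM : M.Admissible) {δ : ℝ} (hδ : 0 ≤ δ) {x : ℝ} (hx : M.xs ≤ x) :
    M.trapSeries δ x ≤ 1 := by
  have := isProbabilityMeasure_stepLaw hM
  refine trapSeries_le hM (u := 1) (fun x hx => ?_) x hx
  rw [stepTrap_add_stepOp hM]
  calc _ ≤ ∫⁻ _, 1 ∂M.stepLaw := by
        refine lintegral_mono_ae ?_
        filter_upwards [ae_stepLaw hM] with q hq
        simpa using discount_le_one hδ hq.1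
    _ = 1 := by simp

lemma stepOp_const_mul (δ : ℝ) {s : ℝ≥0∞} (hs : s ≠ ∞) (f : ℝ → ℝ≥0∞) (x : ℝ) :
    M.stepOp δ (fun v => s * f v) x = s * M.stepOp δ f x := by
  rw [stepOp, stepOp, ← lintegral_const_mul' _ _ hs]
  refine lintegral_congr fun q => ?_
  simp only [live]
  split_ifs
  · ring
  · simp

/-- The test function is unbounded, so each of its multiples 1/(n+1) exceeds C far out, while below
that level survival is at most some q < 1. Domination then holds everywhere, and n tends to
infinity. -/
lemma eq_zero_of_subsolution_recurrent (hM : M.Admissible) {d : ℝ → ℝ≥0∞} {C : ℝ≥0∞}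
    (hd : ∀ x, M.xs ≤ x → d x ≤ M.stepOp 0 d x) (hC : C ≠ ∞) (hdC : ∀ x, M.xs ≤ x → d x ≤ C)
    (hrec : M.alpha * M.r ≤ M.lam) : ∀ x, M.xs ≤ x → d x = 0 := by
  have hxs := hM.hxs
  obtain ⟨K, hK, hV⟩ := exists_logTest_supersolution hM hrec
  have key : ∀ n : ℕ, ∀ x, M.xs ≤ x →
      d x ≤ ((n + 1 : ℕ) : ℝ≥0∞)⁻¹ * ENNReal.ofReal (M.logTest K x) := by
    intro n
    have hs : ((n + 1 : ℕ) : ℝ≥0∞)⁻¹ ≠ ∞ := by simp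
    have hnC : C * (n + 1 : ℕ) ≠ ∞ := ENNReal.mul_ne_top hC (ENNReal.natCast_ne_top _)
    -- The level beyond which `logTest` is at least C (n+1).
    set R := M.xs * Real.exp ((C * (n + 1 : ℕ)).toReal - K) with hR
    obtain ⟨q, hq, hle⟩ := exists_stepOp_one_le hM le_rfl R
    refine le_of_subsolution hM hd (fun x hx => ?_) hC hdC hq fun x hx => ?_
    · rw [stepOp_const_mul 0 hs fun v => ENNReal.ofReal (M.logTest K v)]
      gcongr
      exact hV x hx
    · rcases le_total x R with h1 | h1
      · exact Or.inr (hle x hx h1)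
      · left
        refine (hdC x hx).trans ?_
        rw [mul_comm, ← div_eq_mul_inv, ENNReal.le_div_iff_mul_le (Or.inl (by simp))
          (Or.inl (ENNReal.natCast_ne_top _)), ENNReal.le_ofReal_iff_toReal_le hnC, logTest]
        · have h2 : Real.exp ((C * (n + 1 : ℕ)).toReal - K) ≤ x / M.xs := by
            rw [le_div_iff₀ hxs]; linarith
          have := (Real.le_log_iff_exp_le (by have := hxs.trans_le hx; positivity)).2 h2
          linarith
        · have : 0 ≤ Real.log (x / M.xs) := Real.log_nonneg (by rwa [le_div_iff₀ hxs, one_mul])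
          rw [logTest]; linarith
  intro x hx
  refine le_antisymm ?_ zero_le
  have hlim : Tendsto (fun n : ℕ => ((n + 1 : ℕ) : ℝ≥0∞)⁻¹ * ENNReal.ofReal (M.logTest K x))
      atTop (𝓝 (0 * ENNReal.ofReal (M.logTest K x))) :=
    ENNReal.Tendsto.mul_const ((tendsto_add_atTop_iff_nat 1).2
      ENNReal.tendsto_inv_nat_nhds_zero) (Or.inr ENNReal.ofReal_ne_top)
  rw [zero_mul] at hlim
  exact ge_of_tendsto' hlim fun n => key n x hx

/-- Bounded subsolutions of the killed equation vanish. -/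
lemma eq_zero_of_subsolution (hM : M.Admissible) {δ : ℝ} (hδ : 0 ≤ δ) {d : ℝ → ℝ≥0∞} {C : ℝ≥0∞}
    (hd : ∀ x, M.xs ≤ x → d x ≤ M.stepOp δ d x) (hC : C ≠ ∞) (hdC : ∀ x, M.xs ≤ x → d x ≤ C)
    (hdec : 0 < δ ∨ M.alpha * M.r ≤ M.lam ∨ Tendsto d atTop (𝓝 0)) :
    ∀ x, M.xs ≤ x → d x = 0 := by
  rcases hδ.lt_or_eq with h0 | rfl
  · obtain ⟨q, hq, hle⟩ := exists_stepOp_one_le_of_pos hM h0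
    intro x hx
    exact le_antisymm (le_of_subsolution hM hd (V := fun _ => 0)
      (fun y _ => stepOp_const_le hM hδ 0 y) hC hdC hq (fun y _ => Or.inr (hle y)) x hx) zero_le
  rcases hdec with h | h | h
  · exact absurd h (lt_irrefl 0)
  · exact eq_zero_of_subsolution_recurrent hM hd hC hdC h
  · intro x hx
    refine le_antisymm (le_of_forall_pos_le_add fun η hη => ?_) zero_le
    rw [zero_add]
    obtain ⟨R, hR⟩ := eventually_atTop.1 ((tendsto_order.1 h).2 η hη)
    obtain ⟨q, hq, hle⟩ := exists_stepOp_one_le hM le_rfl R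
    exact le_of_subsolution hM hd (V := fun _ => η) (fun y _ => stepOp_const_le hM hδ η y) hC hdC
      hq (fun y hy => (le_total y R).elim (fun h => Or.inr (hle y hy h))
        fun h => Or.inl (hR y h).le) x hx

lemma ofReal_integral_le {α : Type*} [MeasurableSpace α] {μ : Measure α} {f : α → ℝ}
    (hf : Integrable f μ) : ENNReal.ofReal (∫ a, f a ∂μ) ≤ ∫⁻ a, ENNReal.ofReal (f a) ∂μ := by
  rw [integral_eq_lintegral_pos_part_sub_lintegral_neg_part hf]
  refine (ENNReal.ofReal_le_ofReal (sub_le_self _ ENNReal.toReal_nonneg)).trans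
    ENNReal.ofReal_toReal_le

variable {δ : ℝ} {h hp : ℝ → ℂ}

lemma exists_enorm_bound {h : ℝ → ℂ} (hbdd : ∃ C, ∀ x, M.xs ≤ x → ‖h x‖ ≤ C) :
    ∃ C : ℝ≥0∞, C ≠ ∞ ∧ ∀ x, M.xs ≤ x → ‖h x‖ₑ ≤ C := by
  obtain ⟨C, hC⟩ := hbdd
  refine ⟨ENNReal.ofReal C, ENNReal.ofReal_ne_top, fun x hx => ?_⟩
  rw [← ofReal_norm]
  exact ENNReal.ofReal_le_ofReal (hC x hx)

lemma enorm_discount_mul (δ t : ℝ) (z : ℂ) :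
    ‖((Real.exp (-δ * t) : ℝ) : ℂ) * z‖ₑ = discount δ t * ‖z‖ₑ := by
  rw [enorm_mul, discount, ← ofReal_norm, Complex.norm_real, Real.norm_of_nonneg (by positivity)]

lemma enorm_le_stepOp {d : ℝ → ℂ} {x : ℝ} (hd : d x = ∫ q, ((Real.exp (-δ * q.1) : ℝ) : ℂ) *
      M.extend d 0 (M.stepTo x q) ∂M.stepLaw) : ‖d x‖ₑ ≤ M.stepOp δ (fun v => ‖d v‖ₑ) x := by
  conv_lhs => rw [hd]
  refine (enorm_integral_le_lintegral_enorm _).trans (lintegral_mono fun q => ?_)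
  rw [enorm_discount_mul]
  gcongr
  simp only [extend, live]
  split_ifs <;> simp

lemma IsSolution.eq_zero (hM : M.Admissible) (hδ : 0 ≤ δ) (H : M.IsSolution δ 0 h hp)
    (hdec : 0 < δ ∨ M.alpha * M.r ≤ M.lam ∨ Tendsto h atTop (𝓝 0)) {x : ℝ} (hx : M.xs ≤ x) :
    h x = 0 := by
  obtain ⟨C, hC, hle⟩ := exists_enorm_bound H.bdd
  have := eq_zero_of_subsolution hM hδ (d := fun x => ‖h x‖ₑ)
    (fun x hx => enorm_le_stepOp (H.fixed hM hδ hx).2) hC hle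
    (hdec.imp_right (Or.imp_right fun h => by simpa using h.enorm)) x hx
  simpa using this

lemma IsSolution.re_fixed (hM : M.Admissible) (hδ : 0 ≤ δ) (H : M.IsSolution δ 1 h hp)
    {x : ℝ} (hx : M.xs ≤ x) :
    Integrable (fun q : ℝ × ℝ => Real.exp (-δ * q.1) * (M.extend h 1 (M.stepTo x q)).re)
      M.stepLaw ∧
    (h x).re = ∫ q, Real.exp (-δ * q.1) * (M.extend h 1 (M.stepTo x q)).re ∂M.stepLaw := by
  obtain ⟨h1, h2⟩ := H.fixed hM hδ hx
  have h3 := h1.re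
  simp only [RCLike.re_eq_complex_re, Complex.re_ofReal_mul] at h3
  refine ⟨h3, ?_⟩
  have h4 := integral_re h1
  simp only [RCLike.re_eq_complex_re, Complex.re_ofReal_mul] at h4
  rw [h2, ← h4]
  rfl

/-- The negative part of Re h is a bounded subsolution of the killed equation, because the boundary
value 1 has no negative part. -/
lemma IsSolution.re_nonneg (hM : M.Admissible) (hδ : 0 ≤ δ) (H : M.IsSolution δ 1 h hp)
    (hdec : 0 < δ ∨ M.alpha * M.r ≤ M.lam ∨ Tendsto h atTop (𝓝 0)) {x : ℝ} (hx : M.xs ≤ x) :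
    0 ≤ (h x).re := by
  obtain ⟨C, hC, hle⟩ := exists_enorm_bound H.bdd
  have := eq_zero_of_subsolution hM hδ (d := fun x => ENNReal.ofReal (-(h x).re))
    (fun x hx => ?_) hC (fun x hx => ?_) (hdec.imp_right (Or.imp_right fun h0 => ?_)) x hx
  · simpa using this
  · obtain ⟨h1, h2⟩ := H.re_fixed hM hδ hx
    rw [h2, ← integral_neg]
    refine (ofReal_integral_le h1.neg).trans (lintegral_mono fun q => ?_)
    rw [Pi.neg_apply, ← mul_neg, ENNReal.ofReal_mul (by positivity)]
    refine mul_le_mul_right ?_ _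
    simp only [extend, live]
    split_ifs <;> simp
  · refine le_trans ?_ (hle x hx)
    rw [← ofReal_norm]
    exact ENNReal.ofReal_le_ofReal ((neg_le_abs _).trans (Complex.abs_re_le_norm _))
  · have := ENNReal.tendsto_ofReal ((Complex.continuous_re.tendsto 0).comp h0).neg
    simpa using this

/-- Minimality of the series applied to Re h. In the transient regime this is what makes
`trapSeries` decay. -/
lemma IsSolution.trapSeries_le_re (hM : M.Admissible) (hδ : 0 ≤ δ) (H : M.IsSolution δ 1 h hp)
    (hdec : 0 < δ ∨ M.alpha * M.r ≤ M.lam ∨ Tendsto h atTop (𝓝 0)) {x : ℝ} (hx : M.xs ≤ x) :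
    M.trapSeries δ x ≤ ENNReal.ofReal (h x).re := by
  refine trapSeries_le hM (u := fun x => ENNReal.ofReal (h x).re) (fun x hx => ?_) x hx
  obtain ⟨h1, h2⟩ := H.re_fixed hM hδ hx
  have hnn : ∀ v, 0 ≤ (M.extend h 1 v).re := by
    intro v
    simp only [extend]
    split_ifs with hv
    · exact H.re_nonneg hM hδ hdec hv
    · simp
  rw [h2, ofReal_integral_eq_lintegral_ofReal h1 (Eventually.of_forall fun q =>
    mul_nonneg (Real.exp_nonneg _) (hnn _)), stepTrap_add_stepOp hM]
  refine lintegral_mono fun q => ?_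
  rw [ENNReal.ofReal_mul (by positivity)]
  refine mul_le_mul_right ?_ _
  simp only [extend]
  split_ifs <;> simp

lemma trapSeries_fixed (hM : M.Admissible) (hδ : 0 ≤ δ) {x : ℝ} (hx : M.xs ≤ x) :
    Integrable (fun q : ℝ × ℝ => ((Real.exp (-δ * q.1) : ℝ) : ℂ) *
      M.extend (fun v => ((M.trapSeries δ v).toReal : ℂ)) 1 (M.stepTo x q)) M.stepLaw ∧
    ((M.trapSeries δ x).toReal : ℂ) = ∫ q, ((Real.exp (-δ * q.1) : ℝ) : ℂ) *
      M.extend (fun v => ((M.trapSeries δ v).toReal : ℂ)) 1 (M.stepTo x q) ∂M.stepLaw := by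
  classical
  have := isProbabilityMeasure_stepLaw hM
  set G : ℝ × ℝ → ℝ≥0∞ := fun q => discount δ q.1 *
    (if M.xs ≤ M.stepTo x q then M.trapSeries δ (M.stepTo x q) else 1) with hG
  have hGm : Measurable G := by
    refine ((measurable_discount δ).comp measurable_fst).mul (Measurable.ite
      (measurableSet_Ici.preimage (measurable_stepTo_right hM x)) ((measurable_trapSeries hM δ).comp
      (measurable_stepTo_right hM x)) measurable_const)
  have hint : ∫⁻ q, G q ∂M.stepLaw = M.trapSeries δ x := by
    rw [trapSeries_eq hM, stepTrap_add_stepOp hM]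
  have hfin : ∫⁻ q, G q ∂M.stepLaw ≠ ∞ := by
    rw [hint]; exact ne_top_of_le_ne_top ENNReal.one_ne_top (trapSeries_le_one hM hδ hx)
  have heq : ∀ q, (((G q).toReal : ℝ) : ℂ) = ((Real.exp (-δ * q.1) : ℝ) : ℂ) *
      M.extend (fun v => ((M.trapSeries δ v).toReal : ℂ)) 1 (M.stepTo x q) := by
    intro q
    simp only [hG, extend, ENNReal.toReal_mul, discount,
      ENNReal.toReal_ofReal (Real.exp_nonneg _)]
    split_ifs <;> simp
  simp only [← heq]
  refine ⟨(integrable_toReal_of_lintegral_ne_top hGm.aemeasurable hfin).ofReal, ?_⟩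
  rw [integral_complex_ofReal, integral_toReal hGm.aemeasurable (ae_lt_top hGm hfin), hint]

/-- Bounded solutions of the boundary value problem give the Laplace transform. -/
lemma IsSolution.eq_trapSeries (hM : M.Admissible) (hδ : 0 ≤ δ) (H : M.IsSolution δ 1 h hp)
    (hdec : 0 < δ ∨ M.alpha * M.r ≤ M.lam ∨ Tendsto h atTop (𝓝 0)) {x : ℝ} (hx : M.xs ≤ x) :
    ((M.trapSeries δ x).toReal : ℂ) = h x := by
  set d : ℝ → ℂ := fun x => h x - (M.trapSeries δ x).toReal with hd
  have hbdd : ∃ C, ∀ x, M.xs ≤ x → ‖d x‖ ≤ C := by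
    obtain ⟨C, hC⟩ := H.bdd
    refine ⟨C + 1, fun x hx => (norm_sub_le _ _).trans (add_le_add (hC x hx) ?_)⟩
    rw [Complex.norm_real, Real.norm_of_nonneg ENNReal.toReal_nonneg]
    exact ENNReal.toReal_le_of_le_ofReal zero_le_one (by simpa using trapSeries_le_one hM hδ hx)
  obtain ⟨C, hC, hle⟩ := exists_enorm_bound hbdd
  have := eq_zero_of_subsolution hM hδ (d := fun x => ‖d x‖ₑ)
    (fun x hx => enorm_le_stepOp ?_) hC hle (hdec.imp_right (Or.imp_right fun h0 => ?_)) x hx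
  · rw [enorm_eq_zero, hd, sub_eq_zero] at this
    exact this.symm
  · obtain ⟨h1, h2⟩ := H.fixed hM hδ hx
    obtain ⟨h3, h4⟩ := trapSeries_fixed hM hδ hx
    simp only [hd]
    rw [h2, h4]
    refine (integral_sub h1 h3).symm.trans (integral_congr_ae (Eventually.of_forall fun q => ?_))
    by_cases hq : M.xs ≤ q.2 * M.liveFlow (x, q.1)
    · simp only [stepTo]
      simp only [extend, if_pos hq, mul_sub]
    · simp only [stepTo]
      simp only [extend, if_neg hq, mul_zero, sub_self]
  -- If h decays, `trapSeries` is squeezed between 0 and Re h, so the difference decays as well.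
  · have h1 : Tendsto (fun x => ENNReal.ofReal (h x).re) atTop (𝓝 0) := by
      simpa using ENNReal.tendsto_ofReal ((Complex.continuous_re.tendsto 0).comp h0)
    have h2 : Tendsto (M.trapSeries δ) atTop (𝓝 0) :=
      tendsto_of_tendsto_of_tendsto_of_le_of_le' tendsto_const_nhds h1
        (Eventually.of_forall fun _ => zero_le) ((eventually_ge_atTop M.xs).mono fun x hx =>
          H.trapSeries_le_re hM hδ hdec hx)
    have h3 := (ENNReal.tendsto_toReal ENNReal.zero_ne_top).comp h2
    have h4 : Tendsto (fun x => ((M.trapSeries δ x).toReal : ℂ)) atTop (𝓝 0) :=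
      (Complex.continuous_ofReal.tendsto' _ _ (by simp)).comp h3
    simpa using (h0.sub h4).enorm

end Model

/-! ### Roots of the indicial equations -/

/-- For s < 0, which occurs when r < c_T, the given form may contain a negative term; the rewritten
one is visibly nonnegative. -/
lemma disc_nonneg {lam δ : ℝ} (hlam : 0 ≤ lam) (hδ : 0 ≤ δ) (alpha s : ℝ) :
    0 ≤ (δ + lam - alpha * s) ^ 2 + 4 * s * alpha * δ := by
  have : (δ + lam - alpha * s) ^ 2 + 4 * s * alpha * δ =
      (δ + alpha * s - lam) ^ 2 + 4 * lam * δ := by ring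
  rw [this]; positivity

lemma mul_rootMinus_mul_rootPlus {lam δ : ℝ} (hlam : 0 ≤ lam) (hδ : 0 ≤ δ) (alpha : ℝ) {s : ℝ}
    (hs : s ≠ 0) : s * (rootMinus lam alpha s δ * rootPlus lam alpha s δ) = -(alpha * δ) := by
  have h := Real.sq_sqrt (disc_nonneg hlam hδ alpha s)
  rw [rootMinus, rootPlus]
  generalize √((δ + lam - alpha * s) ^ 2 + 4 * s * alpha * δ) = S at h ⊢
  field_simp
  linear_combination -h

lemma mul_rootMinus_add_rootPlus (lam δ alpha : ℝ) {s : ℝ} (hs : s ≠ 0) :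
    s * (rootMinus lam alpha s δ + rootPlus lam alpha s δ) = -(δ + lam - alpha * s) := by
  rw [rootMinus, rootPlus]
  field_simp
  ring

lemma rootMinus_le_rootPlus (lam δ alpha : ℝ) {s : ℝ} (hs : 0 < s) :
    rootMinus lam alpha s δ ≤ rootPlus lam alpha s δ := by
  rw [rootMinus, rootPlus]
  have := Real.sqrt_nonneg ((δ + lam - alpha * s) ^ 2 + 4 * s * alpha * δ)
  gcongr
  linarith

lemma rootPlus_nonneg (lam : ℝ) {δ alpha s : ℝ} (hδ : 0 ≤ δ) (ha : 0 ≤ alpha) (hs : 0 < s) :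
    0 ≤ rootPlus lam alpha s δ := by
  rw [rootPlus]
  have : δ + lam - alpha * s ≤ √((δ + lam - alpha * s) ^ 2 + 4 * s * alpha * δ) :=
    Real.le_sqrt_of_sq_le (le_add_of_nonneg_right (by positivity))
  apply div_nonneg _ (by positivity)
  linarith

/-- For s = r and δ = 0 the condition is that of the transient regime; it makes the upper solution
decay. -/
lemma rootPlus_pos {lam δ alpha s : ℝ} (hδ : 0 ≤ δ) (ha : 0 < alpha) (hs : 0 < s)
    (h : 0 < δ ∨ lam < alpha * s) : 0 < rootPlus lam alpha s δ := by
  rw [rootPlus]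
  apply div_pos _ (by positivity)
  rcases hδ.lt_or_eq with h0 | rfl
  · have : δ + lam - alpha * s < √((δ + lam - alpha * s) ^ 2 + 4 * s * alpha * δ) :=
      Real.lt_sqrt_of_sq_lt (lt_add_of_pos_right _ (by positivity))
    linarith
  · have h1 : lam < alpha * s := h.resolve_left (lt_irrefl 0)
    have := Real.sqrt_nonneg ((0 + lam - alpha * s) ^ 2 + 4 * s * alpha * 0)
    linarith

lemma lowerParam_of_forall_ne_int {a b : ℝ} (h : ∀ k : ℤ, a - b ≠ k) :
    LowerParam ((a - b + 1 : ℝ) : ℂ) := by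
  intro k hk
  apply h (-(k + 1))
  have : a - b + 1 + (k : ℝ) = 0 := by exact_mod_cast hk
  push_cast
  linarith

/-! ### Behaviour at infinity -/

lemma tendsto_gaussF_inv_atTop (a b : ℝ) {c : ℝ} (hc : LowerParam (c : ℂ)) :
    Tendsto (fun y : ℝ => gaussF a b c y⁻¹) atTop (𝓝 1) := by
  have h0 : (0 : ℂ) ∈ cutPlane := mem_cutPlane_of_norm_lt (by simp)
  have h1 := ((differentiableOn_gaussCont a b hc).differentiableAt
    (isOpen_cutPlane.mem_nhds h0)).continuousAt.tendsto
  rw [gaussCont_zero a b hc] at h1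
  have h2 : Tendsto (fun y : ℝ => ((y⁻¹ : ℝ) : ℂ)) atTop (𝓝 0) :=
    (Complex.continuous_ofReal.tendsto' 0 0 (by simp)).comp tendsto_inv_atTop_zero
  simp only [gaussF_eq_gaussCont]
  exact h1.comp h2

lemma norm_ofReal_cpow_neg {y : ℝ} (hy : 0 < y) (b : ℝ) : ‖(y : ℂ) ^ (-b : ℂ)‖ = y ^ (-b) := by
  rw [Complex.norm_cpow_eq_rpow_re_of_pos hy]; simp

lemma exists_bound_sol {a b : ℝ} (c : ℝ) (hb : LowerParam ((a - b + 1 : ℝ) : ℂ)) (ha : 0 ≤ a)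
    {R : ℝ} (hR : 1 < R) : ∃ C, ∀ y, R ≤ y → ‖sol a b c y‖ ≤ C := by
  have hcont : ContinuousOn (fun t : ℝ => gaussCont a (a - c + 1) (a - b + 1) t)
      (Set.Icc 0 R⁻¹) := by
    refine (differentiableOn_gaussCont a (a - c + 1) hb).continuousOn.comp
      Complex.continuous_ofReal.continuousOn fun t ht => ofReal_mem_cutPlane ?_
    exact (ht.2.trans_lt (inv_lt_one_of_one_lt₀ hR)).ne
  obtain ⟨C, hC⟩ := isCompact_Icc.exists_bound_of_continuousOn hcont
  refine ⟨C, fun y hy => ?_⟩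
  have hy1 : 1 < y := hR.trans_le hy
  have hy0 : 0 < y := one_pos.trans hy1
  have h1 := hC y⁻¹ ⟨by positivity, inv_anti₀ (by linarith) hy⟩
  rw [sol, norm_mul, norm_ofReal_cpow_neg hy0, gaussF_eq_gaussCont]
  calc _ ≤ 1 * C := by
        gcongr
        exact Real.rpow_le_one_of_one_le_of_nonpos hy1.le (by linarith)
    _ = C := one_mul C

lemma tendsto_sol_atTop {a b : ℝ} (c : ℝ) (hb : LowerParam ((a - b + 1 : ℝ) : ℂ)) (ha : 0 < a) :
    Tendsto (sol a b c) atTop (𝓝 0) := by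
  have h1 : Tendsto (fun y : ℝ => (y : ℂ) ^ (-a : ℂ)) atTop (𝓝 0) := by
    rw [tendsto_zero_iff_norm_tendsto_zero]
    exact (tendsto_rpow_neg_atTop ha).congr' ((eventually_gt_atTop 0).mono fun y hy =>
      (norm_ofReal_cpow_neg hy a).symm)
  have h2 := h1.mul (tendsto_gaussF_inv_atTop a (a - c + 1) hb)
  rwa [zero_mul] at h2

lemma gamma_ne_zero_of_lowerParam {c : ℝ} (hc : LowerParam (c : ℂ)) :
    Complex.Gamma (c : ℂ) ≠ 0 :=
  Complex.Gamma_ne_zero fun k h => hc k (by rw [h]; ring)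

lemma gaussF_eq_regF (a b : ℝ) {c : ℝ} (hc : LowerParam (c : ℂ)) (x : ℝ) :
    gaussF a b c x = Complex.Gamma c * regF a b c x := by
  rw [regF, mul_div_cancel₀ _ (gamma_ne_zero_of_lowerParam hc)]

namespace Model

variable {M : Model} {δ : ℝ}

/-! ### The glued hypergeometric candidate -/

lemma yl_eq (M : Model) (x : ℝ) : M.yl x = x / -M.xss := by rw [yl, neg_div, div_neg]

/-- Solution combining the fundamental solutions of both pieces. -/
noncomputable def candidate (M : Model) (δ : ℝ) (k l m : ℂ) (x : ℝ) : ℂ :=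
  if M.B ≤ x then m * sol (M.bu δ) (M.au δ) M.alpha (M.yu x)
  else k * sol (M.al δ) (M.bl δ) M.alpha (M.yl x) + l * sol (M.bl δ) (M.al δ) M.alpha (M.yl x)

/-- `-x` times the derivative of `candidate`. -/
noncomputable def candidateFlux (M : Model) (δ : ℝ) (k l m : ℂ) (x : ℝ) : ℂ :=
  if M.B ≤ x then m * solFlux (M.bu δ) (M.au δ) M.alpha (M.yu x)
  else k * solFlux (M.al δ) (M.bl δ) M.alpha (M.yl x)
    + l * solFlux (M.bl δ) (M.al δ) M.alpha (M.yl x)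

/-- Standing assumptions on the discount rate. -/
structure Regular (M : Model) (δ : ℝ) : Prop extends M.Admissible where
  nonneg : 0 ≤ δ
  ne_int : ∀ k : ℤ, M.al δ - M.bl δ ≠ k

lemma Regular.lower_ab (h : M.Regular δ) : LowerParam ((M.al δ - M.bl δ + 1 : ℝ) : ℂ) :=
  lowerParam_of_forall_ne_int h.ne_int

lemma Regular.lower_ba (h : M.Regular δ) : LowerParam ((M.bl δ - M.al δ + 1 : ℝ) : ℂ) :=
  lowerParam_of_forall_ne_int fun k hk => h.ne_int (-k) (by push_cast; linarith)

lemma Regular.lower_u (h : M.Regular δ) : LowerParam ((M.bu δ - M.au δ + 1 : ℝ) : ℂ) :=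
  lowerParam_of_pos (by
    have := rootMinus_le_rootPlus M.lam δ M.alpha h.hr
    rw [bu, au]; linarith)

lemma Regular.al_ne_bl (h : M.Regular δ) : M.al δ ≠ M.bl δ := fun h' =>
  h.ne_int 0 (by simp [h'])

lemma Regular.xss_ne_zero (h : M.Regular δ) : M.xss ≠ 0 :=
  div_ne_zero (sub_ne_zero.2 h.hxss) h.sub_ne_zero

lemma Regular.ne_neg_xss (h : M.Regular δ) {x : ℝ} (hx : M.xs ≤ x) (hx' : x ≤ M.B) :
    x ≠ -M.xss := by
  have h1 := drift_pos h.toAdmissible hx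
  rw [drift_of_mem_Icc h.toAdmissible hx hx'] at h1
  intro h2
  rw [← h2] at h1
  simp at h1

lemma Regular.yl_ne_zero (h : M.Regular δ) {x : ℝ} (hx : M.xs ≤ x) : M.yl x ≠ 0 := by
  rw [yl]
  exact div_ne_zero (neg_ne_zero.2 (h.hxs.trans_le hx).ne') h.xss_ne_zero

lemma Regular.isPieceSol_lower (h : M.Regular δ) (k l : ℂ) :
    IsPieceSol M.lam M.alpha δ (M.r - M.cT) (-M.xss) (Set.Icc M.xs M.B)
      (fun x => k * sol (M.al δ) (M.bl δ) M.alpha (M.yl x)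
        + l * sol (M.bl δ) (M.al δ) M.alpha (M.yl x))
      (fun x => k * solFlux (M.al δ) (M.bl δ) M.alpha (M.yl x)
        + l * solFlux (M.bl δ) (M.al δ) M.alpha (M.yl x)) := by
  have hS : ∀ x ∈ Set.Icc M.xs M.B, x ≠ 0 ∧ x ≠ -M.xss := fun x hx =>
    ⟨(h.hxs.trans_le hx.1).ne', h.ne_neg_xss hx.1 hx.2⟩
  have hprod := mul_rootMinus_mul_rootPlus h.hlam.le h.nonneg M.alpha h.sub_ne_zero
  have hsum := mul_rootMinus_add_rootPlus M.lam δ M.alpha h.sub_ne_zero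
  simp only [yl_eq]
  exact (isPieceSol_sol h.sub_ne_zero (neg_ne_zero.2 h.xss_ne_zero) hS h.lower_ab hprod
    hsum).comb (isPieceSol_sol h.sub_ne_zero (neg_ne_zero.2 h.xss_ne_zero) hS h.lower_ba
      (by rw [mul_comm (M.bl δ)]; exact hprod) (by rw [add_comm (M.bl δ)]; exact hsum)) k l

lemma Regular.isPieceSol_upper (h : M.Regular δ) (m : ℂ) :
    IsPieceSol M.lam M.alpha δ M.r M.xs (Set.Ici M.B)
      (fun x => m * sol (M.bu δ) (M.au δ) M.alpha (M.yu x))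
      (fun x => m * solFlux (M.bu δ) (M.au δ) M.alpha (M.yu x)) := by
  have hS : ∀ x ∈ Set.Ici M.B, x ≠ 0 ∧ x ≠ M.xs := fun x hx =>
    ⟨(h.hxs.trans (h.hB.trans_le hx)).ne', (h.hB.trans_le hx).ne'⟩
  have hprod := mul_rootMinus_mul_rootPlus h.hlam.le h.nonneg M.alpha h.hr.ne'
  have hsum := mul_rootMinus_add_rootPlus M.lam δ M.alpha h.hr.ne'
  have h1 : IsPieceSol M.lam M.alpha δ M.r M.xs (Set.Ici M.B)
      (fun x => sol (M.bu δ) (M.au δ) M.alpha (M.yu x))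
      (fun x => solFlux (M.bu δ) (M.au δ) M.alpha (M.yu x)) :=
    isPieceSol_sol h.hr.ne' h.hxs.ne' hS h.lower_u
      (by rw [mul_comm (M.bu δ)]; exact hprod) (by rw [add_comm (M.bu δ)]; exact hsum)
  simpa using h1.comb h1 m 0

lemma Regular.isSolution_candidate (h : M.Regular δ) {k l m ε : ℂ}
    (hu : k * sol (M.al δ) (M.bl δ) M.alpha (M.yl M.B)
      + l * sol (M.bl δ) (M.al δ) M.alpha (M.yl M.B)
        = m * sol (M.bu δ) (M.au δ) M.alpha (M.yu M.B))
    (hp : k * solFlux (M.al δ) (M.bl δ) M.alpha (M.yl M.B)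
      + l * solFlux (M.bl δ) (M.al δ) M.alpha (M.yl M.B)
        = m * solFlux (M.bu δ) (M.au δ) M.alpha (M.yu M.B))
    (hbd : (δ + M.lam) * M.xs * (k * sol (M.al δ) (M.bl δ) M.alpha (M.yl M.xs)
        + l * sol (M.bl δ) (M.al δ) M.alpha (M.yl M.xs))
      + M.cT * (M.B - M.xs) * (k * solFlux (M.al δ) (M.bl δ) M.alpha (M.yl M.xs)
        + l * solFlux (M.bl δ) (M.al δ) M.alpha (M.yl M.xs)) = M.lam * ε * M.xs) :
    M.IsSolution δ ε (M.candidate δ k l m) (M.candidateFlux δ k l m) := by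
  refine isSolution_glue h.toAdmissible (h.isPieceSol_lower k l) (h.isPieceSol_upper m) hu hp hbd ?_
  have hxs := h.hxs
  obtain ⟨C, hC⟩ := exists_bound_sol M.alpha h.lower_u
    (rootPlus_nonneg M.lam h.nonneg h.halpha.le h.hr) (R := M.B / M.xs)
    ((one_lt_div hxs).2 h.hB)
  refine ⟨‖m‖ * C, fun x hx => ?_⟩
  rw [norm_mul]
  gcongr
  exact hC _ (by rw [yu]; gcongr)

/-- The trichotomy required by the uniqueness lemmas; outside the recurrent regime b_u > 0 forces
decay. -/
lemma Regular.decay_candidate (h : M.Regular δ) (k l m : ℂ) :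
    0 < δ ∨ M.alpha * M.r ≤ M.lam ∨ Tendsto (M.candidate δ k l m) atTop (𝓝 0) := by
  rcases le_or_gt (M.alpha * M.r) M.lam with h1 | h1
  · exact Or.inr (Or.inl h1)
  refine Or.inr (Or.inr ?_)
  have h2 : Tendsto (fun x => m * sol (M.bu δ) (M.au δ) M.alpha (M.yu x)) atTop (𝓝 (m * 0)) :=
    ((tendsto_sol_atTop M.alpha h.lower_u (rootPlus_pos h.nonneg h.halpha h.hr
      (Or.inr h1))).comp (tendsto_id.atTop_div_const h.hxs)).const_mul m
  rw [mul_zero] at h2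
  exact h2.congr' ((eventually_ge_atTop M.B).mono fun x hx => by rw [candidate, if_pos hx])

lemma wronskian_sol {a b : ℝ} (c y : ℝ) :
    solFlux a b c y * sol b a c y - solFlux b a c y * sol a b c y =
      (y : ℂ) ^ (-a : ℂ) * (y : ℂ) ^ (-b : ℂ) * wronskian a b c (y⁻¹ : ℝ) := by
  simp only [sol, solFlux, wronskian, gaussF_eq_gaussCont]
  push_cast
  ring

lemma Regular.wronskian_sol_ne_zero (h : M.Regular δ) {x : ℝ} (hx : M.xs ≤ x) (hx' : x ≤ M.B) :
    solFlux (M.al δ) (M.bl δ) M.alpha (M.yl x) * sol (M.bl δ) (M.al δ) M.alpha (M.yl x)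
      - solFlux (M.bl δ) (M.al δ) M.alpha (M.yl x) * sol (M.al δ) (M.bl δ) M.alpha (M.yl x)
      ≠ 0 := by
  rw [wronskian_sol]
  have h0 : (M.yl x : ℂ) ≠ 0 := by exact_mod_cast h.yl_ne_zero hx
  refine mul_ne_zero (mul_ne_zero ?_ ?_) (wronskian_ne_zero h.al_ne_bl h.lower_ab h.lower_ba _
    (ofReal_mem_cutPlane ?_))
  · simp [Complex.cpow_eq_zero_iff, h0]
  · simp [Complex.cpow_eq_zero_iff, h0]
  · rw [Ne, inv_eq_one, yl_eq, div_eq_one_iff_eq (neg_ne_zero.2 h.xss_ne_zero)]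
    exact h.ne_neg_xss hx hx'

/-- A homogeneous solution vanishes by uniqueness, whereas the hypergeometric factor of the upper
solution tends to 1 at infinity. -/
lemma Regular.upper_coeff_eq_zero (h : M.Regular δ) {k l m : ℂ}
    (H : M.IsSolution δ 0 (M.candidate δ k l m) (M.candidateFlux δ k l m)) : m = 0 := by
  have hxs := h.hxs
  have hB := h.hB
  have hz : ∀ x, M.xs ≤ x → M.candidate δ k l m x = 0 := fun x hx =>
    H.eq_zero h.toAdmissible h.nonneg (h.decay_candidate k l m) hx
  by_contra hm
  have h3 := tendsto_gaussF_inv_atTop (M.bu δ) (M.bu δ - M.alpha + 1) h.lower_u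
  have h4 := h3.comp (tendsto_id.atTop_div_const hxs)
  refine one_ne_zero (tendsto_nhds_unique h4 (tendsto_const_nhds.congr' ?_))
  filter_upwards [eventually_ge_atTop M.B] with y hy
  have h5 := hz y (hB.le.trans hy)
  have hy0 : (M.yu y : ℂ) ≠ 0 := by
    have : y / M.xs ≠ 0 := (div_pos (hxs.trans (hB.trans_le hy)) hxs).ne'
    rw [yu]; exact_mod_cast this
  rw [candidate, if_pos hy, sol] at h5
  have h6 : (M.yu y : ℂ) ^ (-M.bu δ : ℂ) ≠ 0 := by simp [Complex.cpow_eq_zero_iff, hy0]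
  exact ((mul_eq_zero.1 ((mul_eq_zero.1 h5).resolve_left hm)).resolve_left h6).symm

end Model

namespace Model

variable {M : Model} {δ : ℝ}

/-! ### The closed form -/

lemma Regular.div_gamma_mul_sol_ab (h : M.Regular δ) (k : ℂ) (x : ℝ) :
    k / Complex.Gamma ((M.al δ - M.bl δ + 1 : ℝ) : ℂ) *
      sol (M.al δ) (M.bl δ) M.alpha (M.yl x) = k * (M.yl x : ℂ) ^ (-M.al δ : ℂ) * M.RA δ x := by
  rw [sol, gaussF_eq_regF _ _ h.lower_ab, RA, cl]
  have := gamma_ne_zero_of_lowerParam h.lower_ab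
  generalize regF _ _ _ _ = R
  field_simp

lemma Regular.div_gamma_mul_solFlux_ab (h : M.Regular δ) (k : ℂ) (x : ℝ) :
    k / Complex.Gamma ((M.al δ - M.bl δ + 1 : ℝ) : ℂ) *
      solFlux (M.al δ) (M.bl δ) M.alpha (M.yl x) =
        k * (M.yl x : ℂ) ^ (-M.al δ : ℂ) * (M.al δ * M.RA' δ x) := by
  rw [solFlux, gaussF_eq_regF _ _ h.lower_ab, RA', cl]
  have := gamma_ne_zero_of_lowerParam h.lower_ab
  generalize regF _ _ _ _ = R
  field_simp

lemma Regular.div_gamma_mul_sol_ba (h : M.Regular δ) (k : ℂ) (x : ℝ) :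
    k / Complex.Gamma ((M.bl δ - M.al δ + 1 : ℝ) : ℂ) *
      sol (M.bl δ) (M.al δ) M.alpha (M.yl x) = k * (M.yl x : ℂ) ^ (-M.bl δ : ℂ) * M.RB δ x := by
  rw [sol, gaussF_eq_regF _ _ h.lower_ba, RB, cl]
  have := gamma_ne_zero_of_lowerParam h.lower_ba
  generalize regF _ _ _ _ = R
  field_simp

lemma Regular.div_gamma_mul_solFlux_ba (h : M.Regular δ) (k : ℂ) (x : ℝ) :
    k / Complex.Gamma ((M.bl δ - M.al δ + 1 : ℝ) : ℂ) *
      solFlux (M.bl δ) (M.al δ) M.alpha (M.yl x) =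
        k * (M.yl x : ℂ) ^ (-M.bl δ : ℂ) * (M.bl δ * M.RB' δ x) := by
  rw [solFlux, gaussF_eq_regF _ _ h.lower_ba, RB', cl]
  have := gamma_ne_zero_of_lowerParam h.lower_ba
  generalize regF _ _ _ _ = R
  field_simp

lemma Regular.yu_cpow_mul (h : M.Regular δ) :
    (M.yu M.B : ℂ) ^ (M.bu δ : ℂ) * (M.yu M.B : ℂ) ^ (-M.bu δ : ℂ) = 1 := by
  have h0 : (M.yu M.B : ℂ) ≠ 0 := by
    have := (div_pos (h.hxs.trans h.hB) h.hxs).ne'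
    rw [yu]; exact_mod_cast this
  rw [← Complex.cpow_add _ _ h0, add_neg_cancel, Complex.cpow_zero]

lemma Regular.div_gamma_mul_sol_u (h : M.Regular δ) (k : ℂ) :
    k * (M.yu M.B : ℂ) ^ (M.bu δ : ℂ) / Complex.Gamma ((M.bu δ - M.au δ + 1 : ℝ) : ℂ) *
      sol (M.bu δ) (M.au δ) M.alpha (M.yu M.B) = k * M.RU δ M.B := by
  rw [sol, gaussF_eq_regF _ _ h.lower_u, RU, cu]
  have := gamma_ne_zero_of_lowerParam h.lower_u
  generalize regF _ _ _ _ = R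
  field_simp
  linear_combination k * R * h.yu_cpow_mul

lemma Regular.div_gamma_mul_solFlux_u (h : M.Regular δ) (k : ℂ) :
    k * (M.yu M.B : ℂ) ^ (M.bu δ : ℂ) / Complex.Gamma ((M.bu δ - M.au δ + 1 : ℝ) : ℂ) *
      solFlux (M.bu δ) (M.au δ) M.alpha (M.yu M.B) = k * (M.bu δ * M.RU' δ M.B) := by
  rw [solFlux, gaussF_eq_regF _ _ h.lower_u, RU', cu]
  have := gamma_ne_zero_of_lowerParam h.lower_u
  generalize regF _ _ _ _ = R
  field_simp
  linear_combination k * M.bu δ * R * h.yu_cpow_mul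

/-- `candidate` with coefficients relative to the regularised fundamental solutions. -/
noncomputable def regCandidate (M : Model) (δ : ℝ) (k l m : ℂ) : ℝ → ℂ :=
  M.candidate δ (k / Complex.Gamma ((M.al δ - M.bl δ + 1 : ℝ) : ℂ))
    (l / Complex.Gamma ((M.bl δ - M.al δ + 1 : ℝ) : ℂ))
    (m * (M.yu M.B : ℂ) ^ (M.bu δ : ℂ) / Complex.Gamma ((M.bu δ - M.au δ + 1 : ℝ) : ℂ))

lemma Regular.isSolution_regCandidate (h : M.Regular δ) {k l m ε : ℂ}
    (hu : k * (M.yl M.B : ℂ) ^ (-M.al δ : ℂ) * M.RA δ M.B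
      + l * (M.yl M.B : ℂ) ^ (-M.bl δ : ℂ) * M.RB δ M.B = m * M.RU δ M.B)
    (hp : k * (M.yl M.B : ℂ) ^ (-M.al δ : ℂ) * (M.al δ * M.RA' δ M.B)
      + l * (M.yl M.B : ℂ) ^ (-M.bl δ : ℂ) * (M.bl δ * M.RB' δ M.B) = m * (M.bu δ * M.RU' δ M.B))
    (hbd : k * (M.yl M.xs : ℂ) ^ (-M.al δ : ℂ) * M.PA δ
      + l * (M.yl M.xs : ℂ) ^ (-M.bl δ : ℂ) * M.PB δ = M.lam * ε * M.xs) :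
    ∃ hp, M.IsSolution δ ε (M.regCandidate δ k l m) hp ∧ (ε = 0 → m = 0) := by
  have H := h.isSolution_candidate (ε := ε)
    (k := k / Complex.Gamma ((M.al δ - M.bl δ + 1 : ℝ) : ℂ))
    (l := l / Complex.Gamma ((M.bl δ - M.al δ + 1 : ℝ) : ℂ))
    (m := m * (M.yu M.B : ℂ) ^ (M.bu δ : ℂ) / Complex.Gamma ((M.bu δ - M.au δ + 1 : ℝ) : ℂ))
    (by rw [h.div_gamma_mul_sol_ab, h.div_gamma_mul_sol_ba, h.div_gamma_mul_sol_u, hu])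
    (by rw [h.div_gamma_mul_solFlux_ab, h.div_gamma_mul_solFlux_ba, h.div_gamma_mul_solFlux_u, hp])
    (by
      rw [h.div_gamma_mul_sol_ab, h.div_gamma_mul_sol_ba, h.div_gamma_mul_solFlux_ab,
        h.div_gamma_mul_solFlux_ba, ← hbd, PA, PB]
      ring)
  refine ⟨_, H, ?_⟩
  rintro rfl
  have := h.upper_coeff_eq_zero H
  have hy : (M.yu M.B : ℂ) ^ (M.bu δ : ℂ) ≠ 0 := left_ne_zero_of_mul_eq_one h.yu_cpow_mul
  simpa [-Complex.ofReal_sub, -Complex.ofReal_add, gamma_ne_zero_of_lowerParam h.lower_u, hy]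
    using this

/-- Wronskian at `B` of the lower regularised solutions. -/
noncomputable def regWronskian (M : Model) (δ : ℝ) : ℂ :=
  M.al δ * M.RA' δ M.B * M.RB δ M.B - M.bl δ * M.RA δ M.B * M.RB' δ M.B

lemma Regular.regWronskian_ne_zero (h : M.Regular δ) : M.regWronskian δ ≠ 0 := by
  have hw := h.wronskian_sol_ne_zero h.hB.le le_rfl
  contrapose! hw
  have h1 := gamma_ne_zero_of_lowerParam h.lower_ab
  have h2 := gamma_ne_zero_of_lowerParam h.lower_ba
  have e1 := h.div_gamma_mul_sol_ab (Complex.Gamma ((M.al δ - M.bl δ + 1 : ℝ) : ℂ)) M.B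
  have e2 := h.div_gamma_mul_sol_ba (Complex.Gamma ((M.bl δ - M.al δ + 1 : ℝ) : ℂ)) M.B
  have e3 := h.div_gamma_mul_solFlux_ab (Complex.Gamma ((M.al δ - M.bl δ + 1 : ℝ) : ℂ)) M.B
  have e4 := h.div_gamma_mul_solFlux_ba (Complex.Gamma ((M.bl δ - M.al δ + 1 : ℝ) : ℂ)) M.B
  rw [div_self h1, one_mul] at e1 e3
  rw [div_self h2, one_mul] at e2 e4
  rw [e1, e2, e3, e4]
  rw [regWronskian] at hw
  linear_combination Complex.Gamma ((M.al δ - M.bl δ + 1 : ℝ) : ℂ) *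
    Complex.Gamma ((M.bl δ - M.al δ + 1 : ℝ) : ℂ) * (M.yl M.B : ℂ) ^ (-M.al δ : ℂ) *
    (M.yl M.B : ℂ) ^ (-M.bl δ : ℂ) * hw

lemma Regular.yl_cpow_ne_zero (h : M.Regular δ) {x : ℝ} (hx : M.xs ≤ x) (s : ℂ) :
    (M.yl x : ℂ) ^ s ≠ 0 := by
  have h0 : (M.yl x : ℂ) ≠ 0 := by exact_mod_cast h.yl_ne_zero hx
  simp [Complex.cpow_eq_zero_iff, h0]

lemma Regular.cpow_sub_yl (h : M.Regular δ) :
    (M.yl M.xs : ℂ) ^ (-M.al δ : ℂ) * (M.yl M.xs : ℂ) ^ (M.al δ - M.bl δ : ℂ) =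
      (M.yl M.xs : ℂ) ^ (-M.bl δ : ℂ) := by
  rw [← Complex.cpow_add _ _ (by exact_mod_cast h.yl_ne_zero le_rfl)]
  congr 1
  ring

/-- The combination satisfying both matching conditions at `B`. -/
lemma Regular.isSolution_matched (h : M.Regular δ) {t ε : ℂ}
    (hbd : t * (M.yl M.xs : ℂ) ^ (-M.al δ : ℂ) * M.den δ = M.lam * ε * M.xs) :
    ∃ hp, M.IsSolution δ ε (M.regCandidate δ (t * (M.yl M.B : ℂ) ^ (-M.bl δ : ℂ) * M.QB δ)
      (-(t * (M.yl M.B : ℂ) ^ (-M.al δ : ℂ) * M.QA δ))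
      (t * ((M.yl M.B : ℂ) ^ (-M.al δ : ℂ) * (M.yl M.B : ℂ) ^ (-M.bl δ : ℂ)) *
        M.regWronskian δ)) hp ∧
      (ε = 0 → t * ((M.yl M.B : ℂ) ^ (-M.al δ : ℂ) * (M.yl M.B : ℂ) ^ (-M.bl δ : ℂ)) *
          M.regWronskian δ = 0) := by
  -- The coefficients solve the two matching equations at B by Cramer's rule; the condition at x*
  -- then collapses to t times `den`.
  refine h.isSolution_regCandidate ?_ ?_ ?_
  · rw [QA, QB, regWronskian]; ring
  · rw [QA, QB, regWronskian]; ring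
  · rw [← hbd, den, ← h.cpow_sub_yl]; ring

/-- If `den` vanished, t = 1 would satisfy the homogeneous boundary condition, forcing the upper
coefficient, a nonzero multiple of `regWronskian`, to be 0. -/
lemma Regular.den_ne_zero (h : M.Regular δ) : M.den δ ≠ 0 := by
  intro h0
  obtain ⟨_, -, h1⟩ := h.isSolution_matched (t := 1) (ε := 0) (by rw [h0]; ring)
  exact mul_ne_zero (mul_ne_zero one_ne_zero (mul_ne_zero (h.yl_cpow_ne_zero h.hB.le _)
    (h.yl_cpow_ne_zero h.hB.le _))) h.regWronskian_ne_zero (h1 rfl)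

/-- The reflection formula; it explains the sine in A_{2,l}, which stands for the reciprocal of
Γ(b_l - a_l + 1). -/
lemma Regular.gamma_mul_gamma_mul_sin (h : M.Regular δ) :
    Complex.Gamma (1 + M.al δ - M.bl δ) * Complex.Gamma ((M.bl δ - M.al δ + 1 : ℝ) : ℂ) *
      Complex.sin ((M.al δ - M.bl δ) * Real.pi) = (M.al δ - M.bl δ) * Real.pi := by
  have hw : (M.al δ - M.bl δ : ℂ) ≠ 0 := sub_ne_zero.2 (by exact_mod_cast h.al_ne_bl)
  have h1 := gamma_ne_zero_of_lowerParam h.lower_ab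
  have h2 := gamma_ne_zero_of_lowerParam h.lower_ba
  have e1 : (1 + M.al δ - M.bl δ : ℂ) = M.al δ - M.bl δ + 1 := by ring
  have e2 : ((M.bl δ - M.al δ + 1 : ℝ) : ℂ) = 1 - (M.al δ - M.bl δ) := by push_cast; ring
  push_cast at h1
  rw [Complex.Gamma_add_one _ hw] at h1
  rw [e2] at h2
  have h3 := Complex.Gamma_mul_Gamma_one_sub (M.al δ - M.bl δ)
  rw [mul_comm (Real.pi : ℂ)] at h3
  have hs : Complex.sin ((M.al δ - M.bl δ) * Real.pi) ≠ 0 := by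
    intro h0
    rw [h0, div_zero] at h3
    exact mul_ne_zero (right_ne_zero_of_mul h1) h2 h3
  rw [e1, e2, Complex.Gamma_add_one _ hw, mul_assoc (M.al δ - M.bl δ : ℂ), h3,
    mul_assoc, div_mul_cancel₀ _ hs]

lemma Regular.trapSeries_eq (h : M.Regular δ) {x : ℝ} (hx : M.xs ≤ x) :
    ((M.trapSeries δ x).toReal : ℂ) = M.candidate δ (M.A1l δ) (M.A2l δ) (M.A2u δ) x := by
  have hD := h.den_ne_zero
  have hy : (M.yl M.xs : ℂ) ^ (-M.al δ : ℂ) * (M.yl M.xs : ℂ) ^ (M.al δ : ℂ) = 1 := by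
    rw [← Complex.cpow_add _ _ (by exact_mod_cast h.yl_ne_zero le_rfl), neg_add_cancel,
      Complex.cpow_zero]
  -- This t is the value that the condition at x* imposes for boundary value 1.
  obtain ⟨hp, H, -⟩ := h.isSolution_matched (ε := 1)
    (t := M.lam * M.xs * (M.yl M.xs : ℂ) ^ (M.al δ : ℂ) / M.den δ) (by
      rw [mul_right_comm, div_mul_cancel₀ _ hD]
      linear_combination M.lam * M.xs * hy)
  have key := H.eq_trapSeries h.toAdmissible h.nonneg (h.decay_candidate _ _ _) hx
  rw [key, regCandidate]
  congr 1
  · rw [A1l]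
    have e : (1 + M.al δ - M.bl δ : ℂ) = ((M.al δ - M.bl δ + 1 : ℝ) : ℂ) := by push_cast; ring
    rw [e]
    have := gamma_ne_zero_of_lowerParam h.lower_ab
    field_simp
  · have h1 := gamma_ne_zero_of_lowerParam h.lower_ba
    have h2 : ((M.al δ - M.bl δ) * Real.pi : ℂ) ≠ 0 :=
      mul_ne_zero (sub_ne_zero.2 (by exact_mod_cast h.al_ne_bl)) (by exact_mod_cast Real.pi_ne_zero)
    have h3 := h.gamma_mul_gamma_mul_sin
    rw [A2l, div_eq_div_iff h1 (mul_ne_zero h2 (neg_ne_zero.2 hD))]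
    generalize Complex.sin _ = S at h3 ⊢
    rw [← h3]
    field_simp
  · rw [A2u]
    have e : (1 - M.au δ + M.bu δ : ℂ) = ((M.bu δ - M.au δ + 1 : ℝ) : ℂ) := by push_cast; ring
    have e2 : (M.yl M.B : ℂ) ^ (-(M.al δ + M.bl δ) : ℂ) =
        (M.yl M.B : ℂ) ^ (-M.al δ : ℂ) * (M.yl M.B : ℂ) ^ (-M.bl δ : ℂ) := by
      rw [← Complex.cpow_add _ _ (by exact_mod_cast h.yl_ne_zero h.hB.le)]
      congr 1
      ring
    rw [e, e2, regWronskian]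
    have := gamma_ne_zero_of_lowerParam h.lower_u
    field_simp

end Model

namespace Model

variable {M : Model}

/-! ### The Laplace transform as the discount rate vanishes -/

section

variable {Ω : Type*} [MeasurableSpace Ω] {P : Measure Ω} {W Z : ℕ → Ω → ℝ}

/-- At δ = 0 the integrand is the indicator of trapping, and its measurability makes the event
null-measurable. -/
lemma laplace_zero_eq_trappingProb (x : ℝ) (hm : AEMeasurable
      (fun ω => M.discountedTrapping 0 (fun i => W i ω) (fun i => Z i ω) x) P) :
    M.laplace P W Z 0 x = M.trappingProb P W Z x := by
  classical
  set S := {ω | M.trappingTime (fun i => W i ω) (fun i => Z i ω) x < ∞} with hS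
  have heq : (fun ω => M.discountedTrapping 0 (fun i => W i ω) (fun i => Z i ω) x) =
      S.indicator 1 := by
    funext ω
    simp [discountedTrapping, Set.indicator, hS]
  have hSm : NullMeasurableSet S P := by
    have : S = (fun ω => M.discountedTrapping 0 (fun i => W i ω) (fun i => Z i ω) x) ⁻¹' {1} := by
      rw [heq]
      ext ω
      by_cases h : ω ∈ S <;> simp [h]
    rw [this]
    exact hm.nullMeasurableSet_preimage (measurableSet_singleton 1)
  have h1 : M.laplace P W Z 0 x =
      ∫ ω, M.discountedTrapping 0 (fun i => W i ω) (fun i => Z i ω) x ∂P := rfl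
  rw [h1, heq, integral_indicator₀ hSm]
  simp [trappingProb, hS]

/-- Dominated convergence with bound 1; integrality of a_l - b_l plays no role. -/
lemma tendsto_laplace [IsProbabilityMeasure P] (x : ℝ) (hm : ∀ δ, AEMeasurable
      (fun ω => M.discountedTrapping δ (fun i => W i ω) (fun i => Z i ω) x) P) :
    Tendsto (fun δ : ℝ => M.laplace P W Z δ x) (𝓝[>] 0) (𝓝 (M.laplace P W Z 0 x)) := by
  refine tendsto_integral_filter_of_dominated_convergence (fun _ => 1)
    (Eventually.of_forall fun δ => (hm δ).aestronglyMeasurable) ?_ (integrable_const 1) ?_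
  · filter_upwards [self_mem_nhdsWithin] with δ (hδ : 0 < δ)
    refine Eventually.of_forall fun ω => ?_
    split_ifs
    · rw [Real.norm_of_nonneg (Real.exp_nonneg _), Real.exp_le_one_iff]
      have := ENNReal.toReal_nonneg
        (a := M.trappingTime (fun i => W i ω) (fun i => Z i ω) x)
      nlinarith
    · simp
  · refine Eventually.of_forall fun ω => ?_
    split_ifs
    · exact (Continuous.tendsto (by fun_prop) 0).mono_left nhdsWithin_le_nhds
    · exact tendsto_const_nhds

end

/-- `HasLaw` gives only almost everywhere measurability. Measurable modifications agree with the
data for all indices at once outside a null set, so laws, independence and expectations are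
unchanged. -/
lemma Driving.mk_of_hasLaw {Ω : Type*} [MeasurableSpace Ω] {P : Measure Ω} {W Z : ℕ → Ω → ℝ}
    (hW : ∀ i, HasLaw (W i) (expMeasure M.lam) P)
    (hZ : ∀ i, HasLaw (Z i) (betaMeasure M.alpha 1) P)
    (hWi : iIndepFun W P) (hZi : iIndepFun Z P)
    (hWZ : IndepFun (fun ω i => W i ω) (fun ω i => Z i ω) P) :
    ∃ W' Z' : ℕ → Ω → ℝ, M.Driving P W' Z' ∧ ∀ᵐ ω ∂P,
      (fun i => W i ω) = (fun i => W' i ω) ∧ (fun i => Z i ω) = fun i => Z' i ω := by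
  have eW : ∀ᵐ ω ∂P, (fun i => W i ω) = fun i => (hW i).aemeasurable.mk (W i) ω := by
    filter_upwards [ae_all_iff.2 fun i => (hW i).aemeasurable.ae_eq_mk] with ω h using funext h
  have eZ : ∀ᵐ ω ∂P, (fun i => Z i ω) = fun i => (hZ i).aemeasurable.mk (Z i) ω := by
    filter_upwards [ae_all_iff.2 fun i => (hZ i).aemeasurable.ae_eq_mk] with ω h using funext h
  exact ⟨fun i => (hW i).aemeasurable.mk (W i), fun i => (hZ i).aemeasurable.mk (Z i),
    { measurable_W := fun i => (hW i).aemeasurable.measurable_mk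
      measurable_Z := fun i => (hZ i).aemeasurable.measurable_mk
      law_W := fun i => (hW i).congr (hW i).aemeasurable.ae_eq_mk.symm
      law_Z := fun i => (hZ i).congr (hZ i).aemeasurable.ae_eq_mk.symm
      indep_W := hWi.congr fun i => (hW i).aemeasurable.ae_eq_mk
      indep_Z := hZi.congr fun i => (hZ i).aemeasurable.ae_eq_mk
      indep := hWZ.congr eW eZ }, eW.and eZ⟩

end Model

end Trapping

theorem proposition3p1 {Ω : Type*} [MeasurableSpace Ω] (P : Measure Ω) [IsProbabilityMeasure P]
    (M : Trapping.Model)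
    (hr : 0 < M.r) (hcT : 0 < M.cT) (hxs : 0 < M.xs) (hB : M.xs < M.B)
    (hlam : 0 < M.lam) (halpha : 0 < M.alpha)
    -- `x^{**}` is defined and nonzero
    (hrc : M.r ≠ M.cT) (hxss : M.cT * M.B ≠ M.r * M.xs)
    -- waiting times between losses (Poisson process) and remaining proportions
    (W Z : ℕ → Ω → ℝ)
    (hW : ∀ i, HasLaw (W i) (expMeasure M.lam) P)
    (hZ : ∀ i, HasLaw (Z i) (betaMeasure M.alpha 1) P)
    (hWi : iIndepFun W P) (hZi : iIndepFun Z P)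
    (hWZ : IndepFun (fun ω i => W i ω) (fun ω i => Z i ω) P) :
    (∀ δ : ℝ, 0 ≤ δ → (∀ k : ℤ, M.al δ - M.bl δ ≠ k) →
      (∀ x : ℝ, M.B ≤ x →
        (M.laplace P W Z δ x : ℂ) =
          M.A2u δ * (M.yu x : ℂ) ^ (-M.bu δ : ℂ)
            * Trapping.gaussF (M.bu δ) (M.bu δ - M.cu + 1) (M.bu δ - M.au δ + 1) (M.yu x)⁻¹) ∧
      (∀ x : ℝ, M.xs ≤ x → x < M.B →
        (M.laplace P W Z δ x : ℂ) =
          M.A1l δ * (M.yl x : ℂ) ^ (-M.al δ : ℂ)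
            * Trapping.gaussF (M.al δ) (M.al δ - M.cl + 1) (M.al δ - M.bl δ + 1) (M.yl x)⁻¹
          + M.A2l δ * (M.yl x : ℂ) ^ (-M.bl δ : ℂ)
            * Trapping.gaussF (M.bl δ) (M.bl δ - M.cl + 1) (M.bl δ - M.al δ + 1) (M.yl x)⁻¹)) ∧
    (∀ x : ℝ, M.xs ≤ x →
      M.laplace P W Z 0 x = M.trappingProb P W Z x ∧
      Tendsto (fun δ : ℝ => M.laplace P W Z δ x) (𝓝[>] 0) (𝓝 (M.trappingProb P W Z x))) := by
  have hM : M.Admissible := ⟨hr, hcT, hxs, hB, hlam, halpha, hrc, hxss⟩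
  obtain ⟨W', Z', hD, hae⟩ := Trapping.Model.Driving.mk_of_hasLaw hW hZ hWi hZi hWZ
  have hdisc : ∀ δ x, (fun ω => M.discountedTrapping δ (fun i => W' i ω) (fun i => Z' i ω) x)
      =ᵐ[P] fun ω => M.discountedTrapping δ (fun i => W i ω) (fun i => Z i ω) x := by
    intro δ x
    filter_upwards [hae] with ω hω
    rw [hω.1, hω.2]
  have hlap : ∀ δ x, M.xs ≤ x → M.laplace P W Z δ x = (M.trapSeries δ x).toReal := by
    intro δ x hx
    rw [← hD.laplace_eq hM δ hx]
    exact integral_congr_ae (hdisc δ x).symm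
  refine ⟨fun δ hδ hint => ?_, fun x hx => ?_⟩
  · have h : M.Regular δ := ⟨hM, hδ, hint⟩
    refine ⟨fun x hx => ?_, fun x hx hx' => ?_⟩
    · rw [hlap δ x (hB.le.trans hx), h.trapSeries_eq (hB.le.trans hx),
        Trapping.Model.candidate, if_pos hx, mul_assoc]
      rfl
    · rw [hlap δ x hx, h.trapSeries_eq hx,
        Trapping.Model.candidate, if_neg (not_le.2 hx'), mul_assoc, mul_assoc]
      rfl
  · have hm := fun δ => (hD.aemeasurable_discountedTrapping hM δ hx).congr (hdisc δ x)
    have h0 := Trapping.Model.laplace_zero_eq_trappingProb x (hm 0)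
    exact ⟨h0, h0 ▸ Trapping.Model.tendsto_laplace x hm⟩
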